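/- **Setting.** Let $R=\begin{pmatrix}1&1\\0&1\end{pmatrix}$, $L=\begin{pmatrix}1&0\\1&1\end{pmatrix}$. Let $\varphi\in SL(2,\mathbb Z)$ be Anosov (two distinct real eigenvalues), conjugate in $SL(2,\mathbb Z)$ to $\varepsilon W$, where $\varepsilon=\pm1$ and $W=w_0w_1\cdots w_{N-1}$ is a word in $R$ and $L$. Let $M$ be the punctured torus bundle over the circle with monodromy $\varphi$, and let $\mathcal T=\{\mathcal T_0,\dots,\mathcal T_{N-1}\}$ be its monodromy triangulation: with $W_k=w_0\cdots w_{k-1}$, the ideal tetrahedron $\mathcal T_k$ projects to the $W_k$-image of the unit square in $\mathbb R^2/\mathbb Z^2$, with bottom edge the diagonal in direction $W_k(-1,1)$ and top edge the diagonal in direction $W_k(1,1)$; the top faces of $\mathcal T_k$ are glued to the bottom faces of $\mathcal T_{k+1}$, and those of $\mathcal T_{N-1}$ to the bottom faces of $\mathcal T_0$ by the monodromy. Let $\mathcal B$ be $\mathbb R$, $\mathbb C$ or $\mathbb R+\mathbb R\tau$ ($\tau^2=1$), with square-norm $|z|^2=z\bar z$. Let $\mathbb X$ be the set of lines of Hermitian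 $2\times2$ matrices over $\mathcal B$ with positive determinant; it is $\mathbb H^2$, $\mathbb H^3$, $\mathrm{AdS}^3$ respectively. The group $PGL^+(2,\mathcal B)=\{A:|\det A|^2>0\}/\!\sim$ acts on $\mathbb X$ and on its ideal boundary, the lines of nonzero Hermitian matrices of determinant $0$, by $X\mapsto AXA^*$. Four ideal points span an ideal tetrahedron if representatives $Z_1,\dots,Z_4$ can be chosen so that $\sum s_iZ_i\in\mathbb X$ whenever $0\le s_i<1$, $\sum s_i=1$. Its shape parameter $z\in\mathcal B$ at the edge $Z_1Z_2$ is the image of $Z_4$ under the element of $PGL^+(2,\mathcal B)$ taking $Z_1,Z_2,Z_3$ to $\infty,0,1$; the shape parameters at the other edges are $z$, $\frac1{1-z}$, $\frac{z-1}z$. A *triangulated $\mathbb X$-structure on $(M,\mathcal T)$* is a realization of the tetrahedra of $\mathcal T$ as ideal tetrahedra in $\mathbb X$ and of the face gluings by elements of $PGL^+(2,\mathcal B)$, such that around every edge the gluing isometries compose to the identity and the total dihedral angle (the angle swept out in the plane $\mathcal B$ by the tetrahedra developed around the edge $0\infty$) is $2\pi$. For $\mathcal B=\mathbb R$, where the tetrahedra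 are collapsed, it is called a *transversely hyperbolic foliation on $(M,\mathcal T)$*, and a negative (positive) shape parameter has dihedral angle $\pi$ ($0$). A *hyperbolic* (resp. *AdS*) *structure on $(M,\mathcal T)$* is one for $\mathcal B=\mathbb C$ (resp. $\mathbb R+\mathbb R\tau$) whose tetrahedra are all positively oriented. Let $z_j$ be the shape parameter of $\mathcal T_j$ at its top and bottom edges. The real deformation variety $\mathscr D_{\mathbb R}$ is the set of $(z_j)\in(\mathbb R\setminus\{0,1\})^N$ such that around every edge of $\mathcal T$ the shape parameters have product $1$ and the total dihedral angle is $2\pi$. Let $\mathcal V^\pm\subset\mathscr D_{\mathbb R}$ be the union of its two canonical components, namely the set of $(z_j)\in\mathscr D_{\mathbb R}$ with $z_j>0$ for all $j$. Structures $S_t$ ($t>0$) *collapse* to a foliation $\mathcal F$ as $t\to0$ if, along every path of tetrahedra, the ideal vertices of the tetrahedra developed by $S_t$ converge in real projective space to those developed by $\mathcal F$, the holonomy of $S_t$ converges to that of $\mathcal F$ in $PGL(2,\mathcal B)$, and the shape parameters of $S_t$ converge to those of $\mathcal F$. **Theorem.** Every point of $\mathcal V^\pm$ is the shape parameter vector of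 some transversely hyperbolic foliation on $(M,\mathcal T)$. For every such foliation $\mathcal F$ there are hyperbolic structures $\mathscr H_t$ and AdS structures $\mathscr A_t$ on $(M,\mathcal T)$, defined for all $t>0$ and with shape parameters depending continuously on $t$, such that both $\mathscr H_t$ and $\mathscr A_t$ collapse to $\mathcal F$ as $t\to0$. -/

import Mathlib

open Matrix Filter Topology

noncomputable section

namespace Regen

/-! ### Shape parameter algebras -/

/-- Linear coordinates `a + b κ ↦ a + b i` on the algebra `B = ℝ + ℝ κ` (or `B = ℝ`), used only to
speak of orientations, angles and limits in the real plane underlying `B`. -/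
class HasPlane (B : Type) where
  /-- the point of the oriented real plane with the coordinates of an element of `B` -/
  plane : B → ℂ

/-- The pseudo-complex numbers `ℝ + ℝ τ` with `τ² = 1`, with conjugation `star (a + b τ) = a - b τ`. -/
abbrev PseudoComplex : Type := QuadraticAlgebra ℝ 1 0

instance : HasPlane ℝ := ⟨fun x => (x : ℂ)⟩
instance : HasPlane ℂ := ⟨fun z => z⟩
instance : HasPlane PseudoComplex := ⟨fun z => ⟨z.re, z.im⟩⟩

section Model

variable {B : Type} [CommRing B] [StarRing B] [Algebra ℝ B]

/-- `b` is a positive real number. -/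
def IsPosReal (b : B) : Prop := ∃ r : ℝ, 0 < r ∧ b = algebraMap ℝ B r

/-- A matrix that represents a point of the projective model space `𝕏`: the lines in the space of
Hermitian matrices on which the form `⟨X, X⟩ = - det X` is negative. The space `𝕏` is the hyperbolic
plane for `B = ℝ`, hyperbolic three-space for `B = ℂ`, anti de Sitter space for `B = ℝ + ℝ τ`. -/
def InModel (X : Matrix (Fin 2) (Fin 2) B) : Prop := Xᴴ = X ∧ IsPosReal X.det

/-- A matrix that represents a point of the ideal boundary of `𝕏`. -/
def IsIdealPoint (X : Matrix (Fin 2) (Fin 2) B) : Prop := Xᴴ = X ∧ X ≠ 0 ∧ X.det = 0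

/-- Equality of points of the real projective space of Hermitian matrices. -/
def SamePoint (X Y : Matrix (Fin 2) (Fin 2) B) : Prop := ∃ r : ℝ, r ≠ 0 ∧ X = r • Y

/-- A matrix that represents an element of `PGL⁺(2, B)`: the condition is `|det A|² > 0`. -/
def IsIsometry (A : Matrix (Fin 2) (Fin 2) B) : Prop := IsPosReal (A.det * star A.det)

/-- The action of `PGL⁺(2, B)` on Hermitian matrices. -/
def act (A X : Matrix (Fin 2) (Fin 2) B) : Matrix (Fin 2) (Fin 2) B := A * X * Aᴴ

/-- `Z₀, …, Z₃` span an ideal tetrahedron: the map `s ↦ [∑ sᵥ Zᵥ]` sends the standard simplex with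
its vertices removed into `𝕏`. (It may be collapsed, and it always is for `B = ℝ`, where this
map is the projection of the simplex onto an ideal quadrilateral of the hyperbolic plane.) -/
def IsIdealTetrahedron (Z : Fin 4 → Matrix (Fin 2) (Fin 2) B) : Prop :=
  (∀ v, IsIdealPoint (Z v)) ∧
    ∀ s : Fin 4 → ℝ, (∀ v, 0 ≤ s v ∧ s v < 1) → ∑ v, s v = 1 → InModel (∑ v, s v • Z v)

/-- The ideal points `∞, 0, 1, z` as rank one Hermitian matrices `u u*`, for
`u = (1, 0), (0, 1), (1, 1), (z, 1)`. -/
def standardPosition (z : B) : Fin 4 → Matrix (Fin 2) (Fin 2) B :=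
  ![!![1, 0; 0, 0], !![0, 0; 0, 1], !![1, 1; 1, 1], !![z * star z, z; star z, 1]]

/-- The generalized cross ratio `(Z₀, Z₁; Z₂, Z₃)` is `z`: an element of `PGL⁺(2, B)` takes the
four ideal points to `∞, 0, 1, z`. -/
def HasShape (Z : Fin 4 → Matrix (Fin 2) (Fin 2) B) (z : B) : Prop :=
  ∃ A, IsIsometry A ∧ ∀ v, SamePoint (act A (Z v)) (standardPosition z v)

/-- The coordinates `x₁, …, x₄` of the Hermitian matrix
`[x₁ + x₂, x₃ - x₄ κ; x₃ + x₄ κ, x₁ - x₂]`. -/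
def hermCoord [HasPlane B] (X : Matrix (Fin 2) (Fin 2) B) : Fin 4 → ℝ :=
  ![((HasPlane.plane (X 0 0)).re + (HasPlane.plane (X 1 1)).re) / 2,
    ((HasPlane.plane (X 0 0)).re - (HasPlane.plane (X 1 1)).re) / 2,
    (HasPlane.plane (X 1 0)).re, (HasPlane.plane (X 1 0)).im]

/-- The map `s ↦ [∑ sᵥ Zᵥ]` preserves orientation, for the orientation of projective space given by
the coordinates `x₁, …, x₄`. -/
def IsPositivelyOriented [HasPlane B] (Z : Fin 4 → Matrix (Fin 2) (Fin 2) B) : Prop :=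
  0 < (Matrix.of fun v => hermCoord (Z v)).det

end Model

/-! ### Ideal triangulations -/

/-- An oriented ideal triangulation with `n` tetrahedra, each with vertices `0, 1, 2, 3`. The face
opposite to the vertex `f` of the tetrahedron `j` is glued to a face of `nbr j f`, a vertex `v ≠ f`
of `j` being identified with the vertex `perm j f v`; by convention `perm j f f` is the vertex
opposite to the face of `nbr j f`. The manifold is the union of the tetrahedra, vertices removed. -/
structure IdealTriangulation (n : ℕ) where
  nbr : Fin n → Fin 4 → Fin n
  perm : Fin n → Fin 4 → Equiv.Perm (Fin 4)
  nbr_nbr : ∀ j f, nbr (nbr j f) (perm j f f) = j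
  perm_perm : ∀ j f, perm (nbr j f) (perm j f f) = (perm j f)⁻¹
  sign_perm : ∀ j f, Equiv.Perm.sign (perm j f) = -1
  not_self : ∀ j f, (nbr j f, perm j f f) ≠ (j, f)

namespace IdealTriangulation

variable {n : ℕ} (T : IdealTriangulation n)

/-- A tetrahedron with an ordering of its vertices. The flag `(j, π)` singles out the oriented edge
from `π 0` to `π 1`. -/
abbrev Flag (n : ℕ) : Type := Fin n × Equiv.Perm (Fin 4)

/-- Turning around the edge `π 0, π 1`: pass from `(j, π)` through the face `π 0, π 1, π 3` to the
next tetrahedron, in which the vertices of this face take the places `0, 1, 2`. -/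
def turn (x : Flag n) : Flag n :=
  (T.nbr x.1 (x.2 2), T.perm x.1 (x.2 2) * x.2 * Equiv.swap 2 3)

/-- The number of tetrahedra around the edge of a flag. -/
def valence (x : Flag n) : ℕ := Function.minimalPeriod T.turn x

/-- The last tetrahedron of the path that starts in `j` and crosses the faces in the list. -/
def endpoint : Fin n → List (Fin 4) → Fin n
  | j, [] => j
  | j, f :: l => endpoint (T.nbr j f) l

end IdealTriangulation

/-! ### Shape parameters and Thurston's equations -/

section Equations

variable {B : Type} [CommRing B]

/-- The shape parameter of the edge `a b` of a tetrahedron whose edge `0 1` has shape parameter `z`: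
it is `z` at `01, 23`, it is `1 / (1 - z)` at `02, 13`, and `(z - 1) / z` at `03, 12`. -/
def edgeShape (z : B) (a b : Fin 4) : B :=
  if ({a, b} : Finset (Fin 4)) = {0, 1} ∨ ({a, b} : Finset (Fin 4)) = {2, 3} then z
  else if ({a, b} : Finset (Fin 4)) = {0, 2} ∨ ({a, b} : Finset (Fin 4)) = {1, 3} then
    Ring.inverse (1 - z)
  else (z - 1) * Ring.inverse z

variable {n : ℕ} (T : IdealTriangulation n)

/-- The product of the shape parameters at the first `k` tetrahedra around the edge of a flag. -/
def partialHolonomy (z : Fin n → B) (x : IdealTriangulation.Flag n) (k : ℕ) : B :=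
  ∏ i ∈ Finset.range k,
    edgeShape (z (T.turn^[i] x).1) ((T.turn^[i] x).2 0) ((T.turn^[i] x).2 1)

/-- The total dihedral angle around the edge of a flag. Put the edge at `0, ∞`; then the `k`-th
tetrahedron around it develops to the ideal vertices `∞, 0, w k, w (k + 1)`, where `w` is the
partial holonomy, and the total dihedral angle is the angle swept out at `0` by the segments from
`w k` to `w (k + 1)`. Over `ℂ` it is the sum of the arguments of the shape parameters. Over `ℝ` a
negative shape parameter contributes `π` and a positive one contributes `0`. -/
def totalAngle [HasPlane B] (z : Fin n → B) (x : IdealTriangulation.Flag n) : ℝ :=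
  ∑ k ∈ Finset.range (T.valence x),
    (HasPlane.plane (partialHolonomy T z x (k + 1)) / HasPlane.plane (partialHolonomy T z x k)).arg

/-- Thurston's equations at every edge: the shape parameters around the edge have product one, and
the total dihedral angle is `2π`. (The orientation of the triangulation is the one in which the
order `0, 1, 2, 3` of the vertices of each tetrahedron is positive.) -/
def ThurstonEquations [HasPlane B] (z : Fin n → B) : Prop :=
  ∀ x : IdealTriangulation.Flag n, Equiv.Perm.sign x.2 = 1 →
    partialHolonomy T z x (T.valence x) = 1 ∧ totalAngle T z x = 2 * Real.pi

/-- The real deformation variety. -/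
def realDeformationVariety : Set (Fin n → ℝ) :=
  {z | (∀ j, z j ≠ 0 ∧ z j ≠ 1) ∧ ThurstonEquations T z}

end Equations

/-! ### Triangulated geometric structures -/

/-- A triangulated `𝕏`-structure: every tetrahedron is realized as an ideal tetrahedron in `𝕏`, every
face gluing is realized by an isometry, and the structure extends over every edge: the composition
of the gluing isometries around the edge is trivial in `PGL⁺(2, B)`, and the total dihedral angle is
`2π`. -/
structure TriangulatedStructure {n : ℕ} (T : IdealTriangulation n) (B : Type) [CommRing B]
    [StarRing B] [Algebra ℝ B] [HasPlane B] where
  /-- the ideal vertices of the tetrahedra -/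
  vertex : Fin n → Fin 4 → Matrix (Fin 2) (Fin 2) B
  /-- the isometry that attaches the neighbour of `j` at the face opposite to `f` to `j` -/
  glue : Fin n → Fin 4 → Matrix (Fin 2) (Fin 2) B
  /-- the shape parameters at the edges `01` -/
  shape : Fin n → B
  ideal : ∀ j, IsIdealTetrahedron (vertex j)
  hasShape : ∀ j, HasShape (vertex j) (shape j)
  isometry : ∀ j f, IsIsometry (glue j f)
  glue_vertex : ∀ j f v, v ≠ f →
    SamePoint (act (glue j f) (vertex (T.nbr j f) (T.perm j f v))) (vertex j v)
  edge_holonomy : ∀ x : IdealTriangulation.Flag n, Equiv.Perm.sign x.2 = 1 →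
    ∃ c : B, ((List.range (T.valence x)).map fun k =>
      glue (T.turn^[k] x).1 ((T.turn^[k] x).2 2)).prod = c • (1 : Matrix (Fin 2) (Fin 2) B)
  edge_angle : ∀ x : IdealTriangulation.Flag n, Equiv.Perm.sign x.2 = 1 →
    totalAngle T shape x = 2 * Real.pi

namespace TriangulatedStructure

variable {n : ℕ} {T : IdealTriangulation n} {B : Type} [CommRing B] [StarRing B] [Algebra ℝ B]
  [HasPlane B]

/-- The holonomy along the path that starts in the tetrahedron `j` and crosses the given faces. -/
def holonomy (S : TriangulatedStructure T B) : Fin n → List (Fin 4) → Matrix (Fin 2) (Fin 2) B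
  | _, [] => 1
  | j, f :: l => S.glue j f * S.holonomy (T.nbr j f) l

/-- The developing map: the ideal vertices of the last tetrahedron of a path, developed along the
path into the frame of its first tetrahedron `j`. (The paths are the tetrahedra of the universal
cover of the complement of the edges; they give the same tetrahedron of the universal
cover of the manifold if they differ by turns around edges.) -/
def develop (S : TriangulatedStructure T B) (j : Fin n) (l : List (Fin 4)) (v : Fin 4) :
    Matrix (Fin 2) (Fin 2) B :=
  act (S.holonomy j l) (S.vertex (T.endpoint j l) v)

end TriangulatedStructure

/-- A transversely hyperbolic foliation on `(M, T)`: the tetrahedra are collapsed to the hyperbolic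
plane. -/
abbrev Foliation {n : ℕ} (T : IdealTriangulation n) : Type := TriangulatedStructure T ℝ

/-- A hyperbolic structure on `(M, T)`, made of positively oriented ideal tetrahedra. -/
abbrev HyperbolicStructure {n : ℕ} (T : IdealTriangulation n) : Type :=
  {S : TriangulatedStructure T ℂ // ∀ j, IsPositivelyOriented (S.vertex j)}

/-- An anti de Sitter structure on `(M, T)`, made of positively oriented ideal tetrahedra. -/
abbrev AdSStructure {n : ℕ} (T : IdealTriangulation n) : Type :=
  {S : TriangulatedStructure T PseudoComplex // ∀ j, IsPositivelyOriented (S.vertex j)}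

section Collapse

variable {n : ℕ} {T : IdealTriangulation n} {B : Type} [CommRing B] [StarRing B] [Algebra ℝ B]
  [HasPlane B]

/-- The limit `t → 0` for `t > 0`. -/
def toZero : Filter (Set.Ioi (0 : ℝ)) := comap Subtype.val (𝓝 0)

/-- Entrywise convergence, as `t → 0`, of matrices over `B` to a real matrix. -/
def TendsToReal (X : Set.Ioi (0 : ℝ) → Matrix (Fin 2) (Fin 2) B) (Y : Matrix (Fin 2) (Fin 2) ℝ) :
    Prop :=
  ∀ a b, Tendsto (fun t => HasPlane.plane (X t a b)) toZero (𝓝 (Y a b : ℂ))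

/-- The structures `S t` collapse to the foliation `F` as `t → 0`: along every path of tetrahedra,
the ideal vertices of the developed tetrahedra converge in real projective space to those of the
collapsed tetrahedra of `F`, the holonomy converges in `PGL(2, B)` to that of `F`, and
the shape parameters converge to those of `F`. -/
def CollapsesTo (S : Set.Ioi (0 : ℝ) → TriangulatedStructure T B) (F : Foliation T) : Prop :=
  (∀ j l v, ∃ r : Set.Ioi (0 : ℝ) → ℝ, (∀ t, r t ≠ 0) ∧
    TendsToReal (fun t => r t • (S t).develop j l v) (F.develop j l v)) ∧
  (∀ j l, ∃ c : Set.Ioi (0 : ℝ) → B, (∀ t, IsUnit (c t)) ∧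
    TendsToReal (fun t => c t • (S t).holonomy j l) (F.holonomy j l)) ∧
  ∀ j, Tendsto (fun t => HasPlane.plane ((S t).shape j)) toZero (𝓝 (F.shape j : ℂ))

/-- The structures `S t` form a path: their shape parameters depend continuously on `t`. -/
def IsPath (S : Set.Ioi (0 : ℝ) → TriangulatedStructure T B) : Prop :=
  ∀ j, Continuous fun t => HasPlane.plane ((S t).shape j)

end Collapse

/-! ### Punctured torus bundles and the monodromy triangulation -/

/-- An element of `SL(2, ℤ)` is Anosov if it has two distinct real eigenvalues. -/
def IsAnosov (φ : Matrix.SpecialLinearGroup (Fin 2) ℤ) : Prop :=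
  ∃ a b : ℝ, a ≠ b ∧
    Module.End.HasEigenvalue (Matrix.toLin' (φ.1.map (Int.cast : ℤ → ℝ))) a ∧
    Module.End.HasEigenvalue (Matrix.toLin' (φ.1.map (Int.cast : ℤ → ℝ))) b

/-- The letters `R` and `L`. -/
inductive Letter where
  | R : Letter
  | L : Letter

/-- The transvections `R` and `L`. -/
def Letter.mat : Letter → Matrix (Fin 2) (Fin 2) ℤ
  | .R => !![1, 1; 0, 1]
  | .L => !![1, 0; 1, 1]

/-- The product of the letters of a word. -/
def wordMat (w : List Letter) : Matrix (Fin 2) (Fin 2) ℤ := (w.map Letter.mat).prod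

/-- The vertices of a tetrahedron of the monodromy triangulation, seen from above: the vertices
`0, 1, 2, 3` are these corners of the unit square. The top edge is the diagonal `01`, the
bottom edge is the diagonal `23`, the top faces are those opposite to `2, 3`, and the bottom faces
are those opposite to `0, 1`. -/
def corner : Fin 4 → Fin 2 → ℤ := ![![0, 0], ![1, 1], ![0, 1], ![1, 0]]

/-- The rotation of the unit square by `π`. -/
def halfTurn : Equiv.Perm (Fin 4) := Equiv.swap 0 1 * Equiv.swap 2 3

/-- The top and bottom faces, named by their opposite vertices, that coincide when the unit square
is stacked below its image under a letter. -/
def Letter.mate : Letter → Equiv.Perm (Fin 4)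
  | .R => Equiv.swap 0 3 * Equiv.swap 1 2
  | .L => Equiv.swap 0 2 * Equiv.swap 1 3

/-- Gluing of the top face `f` of a tetrahedron to a bottom face of the next one. -/
def upPerm (a : Letter) (h : Equiv.Perm (Fin 4)) (f : Fin 4) : Equiv.Perm (Fin 4) :=
  h * Equiv.swap f (a.mate f)

/-- Gluing of the bottom face `f` of a tetrahedron to a top face of the previous one. -/
def downPerm (a : Letter) (h : Equiv.Perm (Fin 4)) (f : Fin 4) : Equiv.Perm (Fin 4) :=
  Equiv.swap (h f) (a.mate (h f)) * h

/-- Check of `upPerm`: if the previous tetrahedron is the unit square and the next one is its image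
under the letter `a`, then the identified vertices agree up to a lattice translation. -/
theorem upPerm_corner (a : Letter) (f : Fin 4) (hf : 2 ≤ f) :
    ∃ u : Fin 2 → ℤ, ∀ v, v ≠ f → a.mat *ᵥ corner (upPerm a 1 f v) = corner v + u := by
  have hf' : f = 2 ∨ f = 3 := by revert f; decide
  rcases hf' with rfl | rfl <;> cases a
  · exact ⟨![0, 0], by decide⟩
  · exact ⟨![0, 1], by decide⟩
  · exact ⟨![1, 0], by decide⟩
  · exact ⟨![0, 0], by decide⟩

/-- The same check for the image of the unit square under minus the letter `a`. -/
theorem upPerm_halfTurn_corner (a : Letter) (f : Fin 4) (hf : 2 ≤ f) :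
    ∃ u : Fin 2 → ℤ, ∀ v, v ≠ f → -a.mat *ᵥ corner (upPerm a halfTurn f v) = corner v + u := by
  have hf' : f = 2 ∨ f = 3 := by revert f; decide
  rcases hf' with rfl | rfl <;> cases a
  · exact ⟨![-2, -1], by decide⟩
  · exact ⟨![-1, -1], by decide⟩
  · exact ⟨![-1, -1], by decide⟩
  · exact ⟨![-1, -2], by decide⟩

/-- The half turn enters at the closing layer of the bundle, and only for monodromy `-W`. -/
def layerTurn (w : List Letter) (ε : ℤˣ) (k : Fin w.length) : Equiv.Perm (Fin 4) :=
  if ε = -1 ∧ (k : ℕ) + 1 = w.length then halfTurn else 1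

theorem layerTurn_cases (w : List Letter) (ε : ℤˣ) (k : Fin w.length) :
    layerTurn w ε k = 1 ∨ layerTurn w ε k = halfTurn := by
  unfold layerTurn; split_ifs <;> simp

theorem up_down (a : Letter) (h : Equiv.Perm (Fin 4)) (hh : h = 1 ∨ h = halfTurn) (f : Fin 4) :
    Equiv.Perm.sign (upPerm a h f) = -1 ∧ Equiv.Perm.sign (downPerm a h f) = -1 ∧
    downPerm a h (upPerm a h f f) = (upPerm a h f)⁻¹ ∧
    upPerm a h (downPerm a h f f) = (downPerm a h f)⁻¹ ∧
    (2 ≤ f → ¬ 2 ≤ upPerm a h f f) ∧ (¬ 2 ≤ f → 2 ≤ downPerm a h f f) := by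
  rcases hh with rfl | rfl <;> cases a <;> revert f <;> decide

/-- The monodromy triangulation of the mapping torus of `ε W`, where `W = w₀ w₁ ⋯ w_{N-1}` is a word
in `R` and `L`. With `W_k = w₀ ⋯ w_{k-1}`, the tetrahedron `k` projects to the image of the unit
square under `W_k`; it realizes the diagonal exchange from the triangulation `W_k τ₀` of the
punctured torus, with slopes `W_k (1,0), W_k (0,1), W_k (-1,1)`, to the triangulation `W_{k+1} τ₀`.
Its top faces are glued to the bottom faces of the tetrahedron `k + 1`; the top faces of the last
tetrahedron are glued to the bottom faces of the first one by the monodromy. -/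
def monodromyTriangulation (w : List Letter) (ε : ℤˣ) : IdealTriangulation w.length where
  nbr k f := if 2 ≤ f then finRotate _ k else (finRotate _).symm k
  perm k f :=
    if 2 ≤ f then upPerm w[k] (layerTurn w ε k) f
    else downPerm w[(finRotate _).symm k] (layerTurn w ε ((finRotate _).symm k)) f
  nbr_nbr k f := by
    by_cases hf : 2 ≤ f
    · have := (up_down w[k] _ (layerTurn_cases w ε k) f).2.2.2.2.1 hf
      simp only [if_pos hf, if_neg this, Equiv.symm_apply_apply]
    · have := (up_down w[(finRotate _).symm k] _
        (layerTurn_cases w ε ((finRotate _).symm k)) f).2.2.2.2.2 hf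
      simp only [if_neg hf, if_pos this, Equiv.apply_symm_apply]
  perm_perm k f := by
    by_cases hf : 2 ≤ f
    · have h := up_down w[k] _ (layerTurn_cases w ε k) f
      simp only [if_pos hf, if_neg (h.2.2.2.2.1 hf), Equiv.symm_apply_apply]
      exact h.2.2.1
    · have h := up_down w[(finRotate _).symm k] _
        (layerTurn_cases w ε ((finRotate _).symm k)) f
      simp only [if_neg hf, if_pos (h.2.2.2.2.2 hf)]
      exact h.2.2.2.1
  sign_perm k f := by
    split_ifs with hf
    · exact (up_down w[k] _ (layerTurn_cases w ε k) f).1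
    · exact (up_down w[(finRotate _).symm k] _
        (layerTurn_cases w ε ((finRotate _).symm k)) f).2.1
  not_self k f := by
    intro h
    have h2 := (Prod.ext_iff.1 h).2
    by_cases hf : 2 ≤ f
    · have := (up_down w[k] _ (layerTurn_cases w ε k) f).2.2.2.2.1 hf
      simp only [if_pos hf] at h2
      rw [h2] at this
      exact this hf
    · have := (up_down w[(finRotate _).symm k] _
        (layerTurn_cases w ε ((finRotate _).symm k)) f).2.2.2.2.2 hf
      simp only [if_neg hf] at h2
      rw [h2] at this
      exact hf this

/-- The union `V⁺ ∪ V⁻` of the two canonical components of the real deformation variety of the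
monodromy triangulation: the solutions with all `z_j > 0`, where `z_j` is the shape
parameter at the two edges `01, 23` exchanged by the `j`-th diagonal exchange. -/
def canonicalComponents (w : List Letter) (ε : ℤˣ) : Set (Fin w.length → ℝ) :=
  {z | z ∈ realDeformationVariety (monodromyTriangulation w ε) ∧ ∀ j, 0 < z j}

end Regen

end

set_option linter.unusedSectionVars false

noncomputable section

namespace Regen

/-! ### Planar algebras -/

/-- The algebras `ℝ`, `ℂ` and `ℝ + ℝ τ` at once: `plane` gives linear coordinates `a + b κ` in which
the square of the generator is the real number `gen` and `star` is the conjugation. -/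
class PlanarAlgebra (B : Type) [CommRing B] [StarRing B] [Algebra ℝ B] [HasPlane B] where
  /-- the square of the generator -/
  gen : ℝ
  plane_injective : Function.Injective (HasPlane.plane : B → ℂ)
  plane_add : ∀ x y : B, HasPlane.plane (x + y) = HasPlane.plane x + HasPlane.plane y
  plane_algebraMap : ∀ r : ℝ, HasPlane.plane (algebraMap ℝ B r) = r
  re_mul : ∀ x y : B, (HasPlane.plane (x * y)).re =
    (HasPlane.plane x).re * (HasPlane.plane y).re +
      gen * ((HasPlane.plane x).im * (HasPlane.plane y).im)
  im_mul : ∀ x y : B, (HasPlane.plane (x * y)).im =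
    (HasPlane.plane x).re * (HasPlane.plane y).im + (HasPlane.plane x).im * (HasPlane.plane y).re
  re_star : ∀ x : B, (HasPlane.plane (star x)).re = (HasPlane.plane x).re
  im_star : ∀ x : B, (HasPlane.plane (star x)).im = -(HasPlane.plane x).im

instance : PlanarAlgebra ℝ where
  gen := 0
  plane_injective := Complex.ofReal_injective
  plane_add := Complex.ofReal_add
  plane_algebraMap _ := rfl
  re_mul x y := by simp [HasPlane.plane]
  im_mul x y := by simp [HasPlane.plane]
  re_star x := by simp [HasPlane.plane]
  im_star x := by simp [HasPlane.plane]

instance : PlanarAlgebra ℂ where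
  gen := -1
  plane_injective := fun _ _ h => h
  plane_add _ _ := rfl
  plane_algebraMap _ := rfl
  re_mul x y := by simp [HasPlane.plane, sub_eq_add_neg]
  im_mul x y := by simp [HasPlane.plane]
  re_star x := by simp [HasPlane.plane]
  im_star x := by simp [HasPlane.plane]

instance : PlanarAlgebra PseudoComplex where
  gen := 1
  plane_injective x y h := by
    simp only [HasPlane.plane, Complex.mk.injEq] at h
    exact QuadraticAlgebra.ext h.1 h.2
  plane_add x y := by apply Complex.ext <;> simp [HasPlane.plane]
  plane_algebraMap r := by apply Complex.ext <;> simp [HasPlane.plane]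
  re_mul x y := by simp [HasPlane.plane]
  im_mul x y := by simp [HasPlane.plane]
  re_star x := by simp [HasPlane.plane]
  im_star x := by simp [HasPlane.plane]

section Planar

variable {B : Type} [CommRing B] [StarRing B] [Algebra ℝ B] [HasPlane B] [PlanarAlgebra B]

/-- The real coordinate. -/
def rePart (x : B) : ℝ := (HasPlane.plane x).re

/-- The coordinate of the generator. -/
def imPart (x : B) : ℝ := (HasPlane.plane x).im

/-- The square-norm `x * star x` as a real number. -/
def sqNorm (x : B) : ℝ := rePart x ^ 2 - PlanarAlgebra.gen B * imPart x ^ 2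

theorem planar_ext {x y : B} (h₁ : rePart x = rePart y) (h₂ : imPart x = imPart y) : x = y :=
  PlanarAlgebra.plane_injective (Complex.ext h₁ h₂)

@[simp] theorem rePart_add (x y : B) : rePart (x + y) = rePart x + rePart y := by
  simp [rePart, PlanarAlgebra.plane_add]

@[simp] theorem imPart_add (x y : B) : imPart (x + y) = imPart x + imPart y := by
  simp [imPart, PlanarAlgebra.plane_add]

@[simp] theorem rePart_algebraMap (r : ℝ) : rePart (algebraMap ℝ B r) = r := by
  simp [rePart, PlanarAlgebra.plane_algebraMap]

@[simp] theorem imPart_algebraMap (r : ℝ) : imPart (algebraMap ℝ B r) = 0 := by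
  simp [imPart, PlanarAlgebra.plane_algebraMap]

@[simp] theorem rePart_mul (x y : B) :
    rePart (x * y) = rePart x * rePart y + PlanarAlgebra.gen B * (imPart x * imPart y) :=
  PlanarAlgebra.re_mul x y

@[simp] theorem imPart_mul (x y : B) :
    imPart (x * y) = rePart x * imPart y + imPart x * rePart y :=
  PlanarAlgebra.im_mul x y

@[simp] theorem rePart_star (x : B) : rePart (star x) = rePart x := PlanarAlgebra.re_star x

@[simp] theorem imPart_star (x : B) : imPart (star x) = -imPart x := PlanarAlgebra.im_star x

@[simp] theorem rePart_one : rePart (1 : B) = 1 := by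
  simpa using rePart_algebraMap (B := B) 1

@[simp] theorem imPart_one : imPart (1 : B) = 0 := by
  simpa using imPart_algebraMap (B := B) 1

@[simp] theorem rePart_zero : rePart (0 : B) = 0 := by
  simpa using rePart_algebraMap (B := B) 0

@[simp] theorem imPart_zero : imPart (0 : B) = 0 := by
  simpa using imPart_algebraMap (B := B) 0

@[simp] theorem rePart_neg (x : B) : rePart (-x) = -rePart x := by
  have := rePart_add x (-x); rw [add_neg_cancel, rePart_zero] at this; linarith

@[simp] theorem imPart_neg (x : B) : imPart (-x) = -imPart x := by
  have := imPart_add x (-x); rw [add_neg_cancel, imPart_zero] at this; linarith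

@[simp] theorem imPart_sub (x y : B) : imPart (x - y) = imPart x - imPart y := by
  simp [sub_eq_add_neg]

@[simp] theorem rePart_smul (r : ℝ) (x : B) : rePart (r • x) = r * rePart x := by
  simp [Algebra.smul_def]

@[simp] theorem imPart_smul (r : ℝ) (x : B) : imPart (r • x) = r * imPart x := by
  simp [Algebra.smul_def]

@[simp] theorem star_algebraMap (r : ℝ) : star (algebraMap ℝ B r) = algebraMap ℝ B r :=
  planar_ext (by simp) (by simp)

theorem star_real_smul (r : ℝ) (x : B) : star (r • x) = r • star x := by
  simp [Algebra.smul_def]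

theorem mul_star_self (x : B) : x * star x = algebraMap ℝ B (sqNorm x) :=
  planar_ext (by rw [rePart_mul, rePart_star, imPart_star, rePart_algebraMap, sqNorm]; ring)
    (by rw [imPart_mul, rePart_star, imPart_star, imPart_algebraMap]; ring)

theorem sqNorm_mul (x y : B) : sqNorm (x * y) = sqNorm x * sqNorm y := by
  simp [sqNorm]; ring

@[simp] theorem sqNorm_neg (x : B) : sqNorm (-x) = sqNorm x := by
  simp [sqNorm]

@[simp] theorem sqNorm_algebraMap (r : ℝ) : sqNorm (algebraMap ℝ B r) = r ^ 2 := by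
  simp [sqNorm]

@[simp] theorem sqNorm_one : sqNorm (1 : B) = 1 := by
  simp [sqNorm]

theorem isPosReal_mul_star {x : B} (h : 0 < sqNorm x) : IsPosReal (x * star x) :=
  ⟨_, h, mul_star_self x⟩

theorem isUnit_of_sqNorm_pos {x : B} (h : 0 < sqNorm x) : IsUnit x := by
  refine IsUnit.of_mul_eq_one (algebraMap ℝ B (sqNorm x)⁻¹ * star x) ?_
  rw [mul_left_comm, mul_star_self, ← map_mul, inv_mul_cancel₀ h.ne', map_one]

theorem ringInverse_eq {x : B} (h : 0 < sqNorm x) :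
    Ring.inverse x = algebraMap ℝ B (sqNorm x)⁻¹ * star x := by
  refine (isUnit_of_sqNorm_pos h).mul_left_cancel ?_
  rw [Ring.mul_inverse_cancel _ (isUnit_of_sqNorm_pos h), mul_left_comm, mul_star_self, ← map_mul,
    inv_mul_cancel₀ h.ne', map_one]

/-! ### Limits of curves in planar algebras -/

/-- The curve `x` in `B` converges to the real number `a`. -/
def ConvergesTo {ι : Type*} (l : Filter ι) (x : ι → B) (a : ℝ) : Prop :=
  Tendsto (fun t => HasPlane.plane (x t)) l (𝓝 (a : ℂ))

variable {ι : Type*} {l : Filter ι}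

theorem convergesTo_iff {x : ι → B} {a : ℝ} :
    ConvergesTo l x a ↔
      Tendsto (fun t => rePart (x t)) l (𝓝 a) ∧ Tendsto (fun t => imPart (x t)) l (𝓝 0) := by
  constructor
  · intro h
    exact ⟨(Complex.continuous_re.tendsto _).comp h, (Complex.continuous_im.tendsto _).comp h⟩
  · rintro ⟨h₁, h₂⟩
    have := (Complex.continuous_ofReal.tendsto _).comp h₁ |>.add
      (((Complex.continuous_ofReal.tendsto _).comp h₂).mul_const Complex.I)
    simp only [Complex.ofReal_zero, zero_mul, add_zero] at this
    refine this.congr fun t => ?_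
    apply Complex.ext <;> simp [rePart, imPart]

theorem ConvergesTo.add {x y : ι → B} {a b : ℝ} (hx : ConvergesTo l x a) (hy : ConvergesTo l y b) :
    ConvergesTo l (fun t => x t + y t) (a + b) := by
  rw [convergesTo_iff] at *
  exact ⟨by simpa using hx.1.add hy.1, by simpa using hx.2.add hy.2⟩

theorem ConvergesTo.mul {x y : ι → B} {a b : ℝ} (hx : ConvergesTo l x a) (hy : ConvergesTo l y b) :
    ConvergesTo l (fun t => x t * y t) (a * b) := by
  rw [convergesTo_iff] at *
  exact ⟨by simpa using (hx.1.mul hy.1).add ((hx.2.mul hy.2).const_mul (PlanarAlgebra.gen B)),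
    by simpa using (hx.1.mul hy.2).add (hx.2.mul hy.1)⟩

theorem ConvergesTo.star {x : ι → B} {a : ℝ} (hx : ConvergesTo l x a) :
    ConvergesTo l (fun t => star (x t)) a := by
  rw [convergesTo_iff] at *
  exact ⟨by simpa using hx.1, by simpa using hx.2.neg⟩

theorem ConvergesTo.const (a : ℝ) : ConvergesTo l (fun _ => algebraMap ℝ B a) a := by
  rw [convergesTo_iff]
  simp [tendsto_const_nhds]

theorem ConvergesTo.one : ConvergesTo l (fun _ => (1 : B)) 1 := by
  simpa using ConvergesTo.const (l := l) (B := B) 1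

theorem ConvergesTo.zero : ConvergesTo l (fun _ => (0 : B)) 0 := by
  simpa using ConvergesTo.const (l := l) (B := B) 0

theorem ConvergesTo.neg {x : ι → B} {a : ℝ} (hx : ConvergesTo l x a) :
    ConvergesTo l (fun t => -x t) (-a) := by
  rw [convergesTo_iff] at *
  exact ⟨by simpa using hx.1.neg, by simpa using hx.2.neg⟩

theorem ConvergesTo.sub {x y : ι → B} {a b : ℝ} (hx : ConvergesTo l x a) (hy : ConvergesTo l y b) :
    ConvergesTo l (fun t => x t - y t) (a - b) := by
  simpa [sub_eq_add_neg] using hx.add hy.neg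

theorem ConvergesTo.smul {x : ι → B} {a : ℝ} (r : ℝ) (hx : ConvergesTo l x a) :
    ConvergesTo l (fun t => r • x t) (r * a) := by
  simpa [Algebra.smul_def] using (ConvergesTo.const r).mul hx

theorem ConvergesTo.sqNorm {x : ι → B} {a : ℝ} (hx : ConvergesTo l x a) :
    Tendsto (fun t => sqNorm (x t)) l (𝓝 (a ^ 2)) := by
  rw [convergesTo_iff] at hx
  simpa [Regen.sqNorm] using (hx.1.pow 2).sub ((hx.2.pow 2).const_mul (PlanarAlgebra.gen B))

theorem ConvergesTo.eventually_sqNorm_pos {x : ι → B} {a : ℝ} (hx : ConvergesTo l x a)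
    (ha : a ≠ 0) : ∀ᶠ t in l, 0 < Regen.sqNorm (x t) :=
  hx.sqNorm.eventually (lt_mem_nhds (by positivity))

theorem ConvergesTo.ringInverse {x : ι → B} {a : ℝ} (hx : ConvergesTo l x a) (ha : a ≠ 0) :
    ConvergesTo l (fun t => Ring.inverse (x t)) a⁻¹ := by
  have h1 : ConvergesTo l (fun t => (algebraMap ℝ B (Regen.sqNorm (x t))⁻¹)) (a ^ 2)⁻¹ := by
    rw [convergesTo_iff]
    simpa [tendsto_const_nhds] using hx.sqNorm.inv₀ (by positivity)
  have h2 := h1.mul hx.star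
  rw [show (a ^ 2)⁻¹ * a = a⁻¹ by field_simp] at h2
  refine Tendsto.congr' ?_ h2
  filter_upwards [hx.eventually_sqNorm_pos ha] with t ht
  rw [ringInverse_eq ht]

theorem ConvergesTo.sum {α : Type*} (s : Finset α) {x : α → ι → B} {a : α → ℝ}
    (h : ∀ i ∈ s, ConvergesTo l (x i) (a i)) :
    ConvergesTo l (fun t => ∑ i ∈ s, x i t) (∑ i ∈ s, a i) := by
  classical
  induction s using Finset.induction_on with
  | empty => simpa using ConvergesTo.zero
  | insert i s hi ih =>
    simp only [Finset.sum_insert hi]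
    exact (h i (by simp)).add (ih fun j hj => h j (by simp [hj]))

theorem ConvergesTo.prod {α : Type*} (s : Finset α) {x : α → ι → B} {a : α → ℝ}
    (h : ∀ i ∈ s, ConvergesTo l (x i) (a i)) :
    ConvergesTo l (fun t => ∏ i ∈ s, x i t) (∏ i ∈ s, a i) := by
  classical
  induction s using Finset.induction_on with
  | empty => simpa using ConvergesTo.one
  | insert i s hi ih =>
    simp only [Finset.prod_insert hi]
    exact (h i (by simp)).mul (ih fun j hj => h j (by simp [hj]))

/-- Entrywise convergence of matrices to a real matrix. -/
def MatrixConvergesTo {m n : Type*} (l : Filter ι) (X : ι → Matrix m n B) (Y : Matrix m n ℝ) :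
    Prop :=
  ∀ a b, ConvergesTo l (fun t => X t a b) (Y a b)

theorem MatrixConvergesTo.mul {m n o : Type*} [Fintype n] {X : ι → Matrix m n B}
    {X' : ι → Matrix n o B} {Y : Matrix m n ℝ} {Y' : Matrix n o ℝ} (h : MatrixConvergesTo l X Y)
    (h' : MatrixConvergesTo l X' Y') : MatrixConvergesTo l (fun t => X t * X' t) (Y * Y') := by
  intro a b
  simp only [Matrix.mul_apply]
  exact ConvergesTo.sum _ fun i _ => (h a i).mul (h' i b)

theorem MatrixConvergesTo.conjTranspose {m n : Type*} {X : ι → Matrix m n B}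
    {Y : Matrix m n ℝ} (h : MatrixConvergesTo l X Y) :
    MatrixConvergesTo l (fun t => (X t)ᴴ) Yᴴ := by
  intro a b
  simpa [Matrix.conjTranspose_apply] using (h b a).star

theorem MatrixConvergesTo.smul {m n : Type*} (r : ℝ) {X : ι → Matrix m n B}
    {Y : Matrix m n ℝ} (h : MatrixConvergesTo l X Y) :
    MatrixConvergesTo l (fun t => r • X t) (r • Y) := by
  intro a b
  simpa using (h a b).smul r

theorem MatrixConvergesTo.const {m n : Type*} (Y : Matrix m n ℝ) :
    MatrixConvergesTo l (fun _ => Y.map (algebraMap ℝ B)) Y := by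
  intro a b
  simpa using ConvergesTo.const (Y a b)

theorem MatrixConvergesTo.one {m : Type*} [DecidableEq m] :
    MatrixConvergesTo l (fun _ => (1 : Matrix m m B)) 1 := by
  intro a b
  by_cases h : a = b
  · subst h; simpa using ConvergesTo.one
  · simpa [Matrix.one_apply_ne h] using ConvergesTo.zero

theorem MatrixConvergesTo.act {X Z : ι → Matrix (Fin 2) (Fin 2) B}
    {Y W : Matrix (Fin 2) (Fin 2) ℝ} (h : MatrixConvergesTo l X Y) (h' : MatrixConvergesTo l Z W) :
    MatrixConvergesTo l (fun t => act (X t) (Z t)) (act Y W) :=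
  (h.mul h').mul h.conjTranspose

end Planar

/-! ### Frames -/

section Frames

variable {B : Type} [CommRing B]

/-- The vectors `u` for which the ideal points `∞, 0, 1, z` are `u u*`. -/
def idealVector (z : B) : Fin 4 → Fin 2 → B := ![![1, 0], ![0, 1], ![1, 1], ![z, 1]]

/-- The determinant of two vectors. -/
def bracket (x y : Fin 2 → B) : B := x 0 * y 1 - x 1 * y 0

theorem bracket_mulVec (A : Matrix (Fin 2) (Fin 2) B) (x y : Fin 2 → B) :
    bracket (A *ᵥ x) (A *ᵥ y) = A.det * bracket x y := by
  simp only [bracket, Matrix.mulVec, dotProduct, Fin.sum_univ_two, Matrix.det_fin_two]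
  ring

theorem bracket_swap (x y : Fin 2 → B) : bracket x y = -bracket y x := by
  simp only [bracket]; ring

theorem bracket_idealVector (z : B) {v w : Fin 4} (h : v ≠ w) :
    ∃ e : B, (e = 1 ∨ e = z ∨ e = 1 - z) ∧
      (bracket (idealVector z v) (idealVector z w) = e ∨
        bracket (idealVector z v) (idealVector z w) = -e) := by
  fin_cases v <;> fin_cases w <;> simp [bracket, idealVector] at h ⊢

theorem bracket_idealVector_mem (S : Submonoid B) (hS : -1 ∈ S) {z : B} (h0 : z ∈ S)
    (h1 : 1 - z ∈ S) {v w : Fin 4} (h : v ≠ w) :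
    bracket (idealVector z v) (idealVector z w) ∈ S := by
  obtain ⟨e, he, h'⟩ := bracket_idealVector z h
  have : e ∈ S := by rcases he with rfl | rfl | rfl <;> simp [*]
  rcases h' with h' | h' <;> rw [h']
  · exact this
  · simpa using S.mul_mem hS this

theorem isUnit_bracket_idealVector {z : B} (h0 : IsUnit z) (h1 : IsUnit (1 - z)) {v w : Fin 4}
    (h : v ≠ w) : IsUnit (bracket (idealVector z v) (idealVector z w)) :=
  bracket_idealVector_mem (IsUnit.submonoid B) isUnit_one.neg h0 h1 h

/-- The matrix that takes the points `a, b, c` of the projective line to `∞, 0, 1`. -/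
def frameMatrix (a b c : Fin 2 → B) : Matrix (Fin 2) (Fin 2) B :=
  !![bracket c a * b 1, -(bracket c a * b 0); bracket c b * a 1, -(bracket c b * a 0)]

theorem frameMatrix_mulVec (a b c x : Fin 2 → B) :
    frameMatrix a b c *ᵥ x = ![bracket c a * bracket x b, bracket c b * bracket x a] := by
  ext i
  fin_cases i <;>
    simp only [frameMatrix, bracket, Matrix.mulVec, dotProduct, Fin.sum_univ_two] <;> simp <;> ring

theorem det_frameMatrix (a b c : Fin 2 → B) :
    (frameMatrix a b c).det = bracket c a * bracket c b * bracket b a := by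
  simp only [frameMatrix, Matrix.det_fin_two_of, bracket]
  ring

/-- A linear map of the plane is determined up to scale by its action on three lines. -/
theorem eq_smul_of_three_lines {A A' : Matrix (Fin 2) (Fin 2) B} {p q r : Fin 2 → B} {k l m : B}
    (hpq : IsUnit (bracket p q)) (hpr : IsUnit (bracket p r)) (hqr : IsUnit (bracket q r))
    (hA : IsUnit A.det) (hp : A' *ᵥ p = k • A *ᵥ p) (hq : A' *ᵥ q = l • A *ᵥ q)
    (hr : A' *ᵥ r = m • A *ᵥ r) : A' = k • A := by
  have smul_left (c : B) (x y : Fin 2 → B) : bracket (c • x) y = c * bracket x y := by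
    simp only [bracket, Pi.smul_apply, smul_eq_mul]; ring
  have smul_right (c : B) (x y : Fin 2 → B) : bracket x (c • y) = c * bracket x y := by
    simp only [bracket, Pi.smul_apply, smul_eq_mul]; ring
  have hpq' := bracket_mulVec A' p q
  have hpr' := bracket_mulVec A' p r
  have hqr' := bracket_mulVec A' q r
  rw [hp, hq, smul_left, smul_right, bracket_mulVec] at hpq'
  rw [hp, hr, smul_left, smul_right, bracket_mulVec] at hpr'
  rw [hq, hr, smul_left, smul_right, bracket_mulVec] at hqr'
  have plucker (x y w : Fin 2 → B) : bracket x y • w = bracket w y • x + bracket x w • y := by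
    ext i; fin_cases i <;> simp [bracket] <;> ring
  have key := congrArg (fun x => A' *ᵥ x) (plucker p q r)
  simp only [Matrix.mulVec_add, Matrix.mulVec_smul, hp, hq, hr] at key
  have h1 := congrArg (fun x => bracket x (A *ᵥ q)) key
  have add_left (x y w : Fin 2 → B) : bracket (x + y) w = bracket x w + bracket y w := by
    simp only [bracket, Pi.add_apply]; ring
  have self (x : Fin 2 → B) : bracket x x = 0 := by simp only [bracket]; ring
  simp only [add_left, smul_left, bracket_mulVec, self, mul_zero, add_zero] at h1
  have h2 := congrArg (fun x => bracket x (A *ᵥ p)) key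
  simp only [add_left, smul_left, bracket_mulVec, self, mul_zero, zero_add] at h2
  have hmk : m = k := by
    have hu : IsUnit (bracket p q * (A.det * bracket q r)) := hpq.mul (hA.mul hqr)
    refine hu.mul_left_cancel ?_
    rw [bracket_swap r q] at h1
    linear_combination -h1
  have hml : m = l := by
    have hu : IsUnit (bracket p q * (A.det * bracket p r)) := hpq.mul (hA.mul hpr)
    refine hu.mul_left_cancel ?_
    rw [bracket_swap r p, bracket_swap q p] at h2
    linear_combination -h2
  rw [← hml, hmk] at hq
  have e (i : Fin 2) : A' i 0 = k * A i 0 ∧ A' i 1 = k * A i 1 := by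
    have e1 := congrFun hp i
    have e2 := congrFun hq i
    simp only [Matrix.mulVec, dotProduct, Fin.sum_univ_two, Pi.smul_apply, smul_eq_mul] at e1 e2
    constructor
    · refine hpq.mul_left_cancel ?_
      simp only [bracket]; linear_combination q 1 * e1 - p 1 * e2
    · refine hpq.mul_left_cancel ?_
      simp only [bracket]; linear_combination p 0 * e2 - q 0 * e1
  ext i j
  fin_cases j
  · exact (e i).1
  · exact (e i).2

/-- Conjugating the diagonal matrix that moves `1` to the fourth vertex by frame matrices gives a
map that takes `a', b', c'` to `a, b, d`. -/
theorem diagonal_frame_mulVec {a b c d a' b' c' : Fin 2 → B} (hab : IsUnit (bracket a b))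
    (hca : IsUnit (bracket c a)) (hcb : IsUnit (bracket c b)) (hda : IsUnit (bracket d a))
    (hdb : IsUnit (bracket d b)) (hab' : IsUnit (bracket a' b')) (hca' : IsUnit (bracket c' a'))
    (hcb' : IsUnit (bracket c' b')) :
    (∃ k : B, IsUnit k ∧ Matrix.diagonal (frameMatrix a b c *ᵥ d) *ᵥ (frameMatrix a' b' c' *ᵥ a') =
      k • (frameMatrix a b c *ᵥ a)) ∧
    (∃ k : B, IsUnit k ∧ Matrix.diagonal (frameMatrix a b c *ᵥ d) *ᵥ (frameMatrix a' b' c' *ᵥ b') =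
      k • (frameMatrix a b c *ᵥ b)) ∧
    (∃ k : B, IsUnit k ∧ Matrix.diagonal (frameMatrix a b c *ᵥ d) *ᵥ (frameMatrix a' b' c' *ᵥ c') =
      k • (frameMatrix a b c *ᵥ d)) := by
  have self (x : Fin 2 → B) : bracket x x = 0 := by simp only [bracket]; ring
  have hba := hab.neg; rw [← bracket_swap] at hba
  have hba' := hab'.neg; rw [← bracket_swap] at hba'
  simp only [frameMatrix_mulVec, self, mul_zero]
  refine ⟨?_, ?_, ?_⟩
  · obtain ⟨u, hu⟩ := hca.mul hab
    refine ⟨(bracket c a * bracket d b) * (bracket c' a' * bracket a' b') * ↑u⁻¹,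
      ((hca.mul hdb).mul (hca'.mul hab')).mul u⁻¹.isUnit, ?_⟩
    rw [← hu]
    ext i; fin_cases i <;> simp [Matrix.mulVec_diagonal]
  · obtain ⟨u, hu⟩ := hcb.mul hba
    refine ⟨(bracket c b * bracket d a) * (bracket c' b' * bracket b' a') * ↑u⁻¹,
      ((hcb.mul hda).mul (hcb'.mul hba')).mul u⁻¹.isUnit, ?_⟩
    rw [← hu]
    ext i; fin_cases i <;> simp [Matrix.mulVec_diagonal]
  · refine ⟨bracket c' a' * bracket c' b', hca'.mul hcb', ?_⟩
    ext i; fin_cases i <;> simp [Matrix.mulVec_diagonal] <;> ring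

theorem edgeShape_swap (z : B) (a b : Fin 4) : edgeShape z a b = edgeShape z b a := by
  simp only [edgeShape, Finset.pair_comm a b]

theorem edgeShape_eq (z : B) :
    edgeShape z 0 1 = z ∧ edgeShape z 2 3 = z ∧ edgeShape z 0 2 = Ring.inverse (1 - z) ∧
    edgeShape z 1 3 = Ring.inverse (1 - z) ∧ edgeShape z 0 3 = (z - 1) * Ring.inverse z ∧
    edgeShape z 1 2 = (z - 1) * Ring.inverse z := by
  refine ⟨?_, ?_, ?_, ?_, ?_, ?_⟩ <;> rw [edgeShape]
  · exact if_pos (by decide)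
  · exact if_pos (by decide)
  · rw [if_neg (by decide), if_pos (by decide)]
  · rw [if_neg (by decide), if_pos (by decide)]
  · rw [if_neg (by decide), if_neg (by decide)]
  · rw [if_neg (by decide), if_neg (by decide)]

theorem even_perm_cases (π : Equiv.Perm (Fin 4)) (h : Equiv.Perm.sign π = 1) :
    (π 0, π 1, π 2, π 3) ∈ ([(0, 1, 2, 3), (1, 0, 3, 2), (2, 3, 0, 1), (3, 2, 1, 0),
      (0, 2, 3, 1), (1, 3, 2, 0), (2, 0, 1, 3), (3, 1, 0, 2),
      (0, 3, 1, 2), (1, 2, 0, 3), (2, 1, 3, 0), (3, 0, 2, 1)] :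
        List (Fin 4 × Fin 4 × Fin 4 × Fin 4)) := by
  revert π; decide

/-- The fourth vertex of a flag of the tetrahedron `∞, 0, 1, z`, seen in the frame of the flag. -/
theorem cross_ratio {z : B} (h0 : IsUnit z) (h1 : IsUnit (1 - z)) {π : Equiv.Perm (Fin 4)}
    (hπ : Equiv.Perm.sign π = 1) :
    bracket (idealVector z (π 2)) (idealVector z (π 0)) *
        bracket (idealVector z (π 3)) (idealVector z (π 1)) =
      edgeShape z (π 0) (π 1) * (bracket (idealVector z (π 2)) (idealVector z (π 1)) *
        bracket (idealVector z (π 3)) (idealVector z (π 0))) := by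
  have h := even_perm_cases π hπ
  obtain ⟨e01, e23, e02, e13, e03, e12⟩ := edgeShape_eq z
  have i0 := Ring.inverse_mul_cancel z h0
  have i1 := Ring.inverse_mul_cancel (1 - z) h1
  generalize π 0 = a at *; generalize π 1 = b at *; generalize π 2 = c at *
  generalize π 3 = d at *
  simp only [List.mem_cons, Prod.mk.injEq, List.not_mem_nil, or_false] at h
  rcases h with h | h | h | h | h | h | h | h | h | h | h | h <;>
    obtain ⟨rfl, rfl, rfl, rfl⟩ := h <;>
    first
    | rw [e01] | rw [edgeShape_swap, e01] | rw [e23] | rw [edgeShape_swap, e23] | rw [e02]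
    | rw [edgeShape_swap, e02] | rw [e13] | rw [edgeShape_swap, e13] | rw [e03]
    | rw [edgeShape_swap, e03] | rw [e12] | rw [edgeShape_swap, e12]
  all_goals simp [bracket, idealVector]
  all_goals grind

end Frames

section Gluing

variable {B : Type} [CommRing B] {n : ℕ} (T : IdealTriangulation n)

/-- The matrix that takes the first three vertices of a flag to `∞, 0, 1`. -/
def flagFrame (z : Fin n → B) (x : IdealTriangulation.Flag n) : Matrix (Fin 2) (Fin 2) B :=
  frameMatrix (idealVector (z x.1) (x.2 0)) (idealVector (z x.1) (x.2 1))
    (idealVector (z x.1) (x.2 2))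

/-- An even ordering of the vertices whose third vertex is `f`. -/
def faceOrder : Fin 4 → Equiv.Perm (Fin 4) :=
  ![Equiv.swap 0 2 * Equiv.swap 1 3, Equiv.swap 0 3 * Equiv.swap 1 2, 1,
    Equiv.swap 0 1 * Equiv.swap 2 3]

theorem faceOrder_two (f : Fin 4) : faceOrder f 2 = f := by revert f; decide

/-- The gluing map at a face for tetrahedra in the positions `∞, 0, 1, z`. -/
def standardGlue (z : Fin n → B) (j : Fin n) (f : Fin 4) : Matrix (Fin 2) (Fin 2) B :=
  (flagFrame z (j, faceOrder f)).adjugate *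
    (Matrix.diagonal (flagFrame z (j, faceOrder f) *ᵥ idealVector (z j) (faceOrder f 3)) *
      flagFrame z (T.turn (j, faceOrder f)))

theorem det_standardGlue_mem (S : Submonoid B) (hS : -1 ∈ S) {z : Fin n → B} (h0 : ∀ j, z j ∈ S)
    (h1 : ∀ j, 1 - z j ∈ S) (j : Fin n) (f : Fin 4) : (standardGlue T z j f).det ∈ S := by
  have H (x : IdealTriangulation.Flag n) {v w : Fin 4} (h : v ≠ w) :=
    bracket_idealVector_mem S hS (h0 x.1) (h1 x.1) (x.2.injective.ne h)
  have hF (x : IdealTriangulation.Flag n) : (flagFrame z x).det ∈ S := by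
    rw [flagFrame, det_frameMatrix]
    exact S.mul_mem (S.mul_mem (H x (by decide)) (H x (by decide))) (H x (by decide))
  rw [standardGlue, Matrix.det_mul, Matrix.det_mul, Matrix.det_adjugate, Matrix.det_diagonal,
    Fin.prod_univ_two]
  refine S.mul_mem (S.pow_mem (hF _) _) (S.mul_mem ?_ (hF _))
  rw [flagFrame, frameMatrix_mulVec]
  have H' {v w : Fin 4} (h : v ≠ w) := H (j, faceOrder f) h
  exact S.mul_mem (S.mul_mem (H' (by decide)) (H' (by decide)))
    (S.mul_mem (H' (by decide)) (H' (by decide)))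

variable {T} {z : Fin n → B}

theorem isUnit_det_flagFrame (h0 : ∀ j, IsUnit (z j)) (h1 : ∀ j, IsUnit (1 - z j))
    (x : IdealTriangulation.Flag n) : IsUnit (flagFrame z x).det := by
  have H {v w : Fin 4} (h : v ≠ w) := isUnit_bracket_idealVector (h0 x.1) (h1 x.1) h
  rw [flagFrame, det_frameMatrix]
  exact ((H (x.2.injective.ne (by decide))).mul (H (x.2.injective.ne (by decide)))).mul
    (H (x.2.injective.ne (by decide)))

/-- The diagonal map between the frames of a flag and of the next flag matches the vertices of the
common face. -/
theorem diagonal_flagFrame_mulVec (h0 : ∀ j, IsUnit (z j)) (h1 : ∀ j, IsUnit (1 - z j))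
    (x : IdealTriangulation.Flag n) {v : Fin 4} (hv : v ≠ x.2 2) :
    ∃ k : B, IsUnit k ∧ (Matrix.diagonal (flagFrame z x *ᵥ idealVector (z x.1) (x.2 3)) *
        flagFrame z (T.turn x)) *ᵥ
          idealVector (z (T.nbr x.1 (x.2 2))) (T.perm x.1 (x.2 2) v) =
      k • (flagFrame z x *ᵥ idealVector (z x.1) v) := by
  have H (j : Fin n) {v w : Fin 4} (h : v ≠ w) := isUnit_bracket_idealVector (h0 j) (h1 j) h
  have E (π : Equiv.Perm (Fin 4)) {v w : Fin 4} (h : v ≠ w) : π v ≠ π w := π.injective.ne h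
  obtain ⟨i, rfl⟩ := x.2.surjective v
  have hi : i = 0 ∨ i = 1 ∨ i = 3 := by
    have : i ≠ 2 := fun h => hv (by rw [h])
    clear hv; revert i; decide
  have := diagonal_frame_mulVec (H x.1 (E x.2 (v := 0) (w := 1) (by decide)))
    (H x.1 (E x.2 (v := 2) (w := 0) (by decide))) (H x.1 (E x.2 (v := 2) (w := 1) (by decide)))
    (H x.1 (E x.2 (v := 3) (w := 0) (by decide))) (H x.1 (E x.2 (v := 3) (w := 1) (by decide)))
    (H (T.turn x).1 (E (T.turn x).2 (v := 0) (w := 1) (by decide)))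
    (H (T.turn x).1 (E (T.turn x).2 (v := 2) (w := 0) (by decide)))
    (H (T.turn x).1 (E (T.turn x).2 (v := 2) (w := 1) (by decide)))
  have s0 : Equiv.swap (2 : Fin 4) 3 0 = 0 := by decide
  have s1 : Equiv.swap (2 : Fin 4) 3 1 = 1 := by decide
  have t0 : (T.turn x).2 0 = T.perm x.1 (x.2 2) (x.2 0) := by
    simp [IdealTriangulation.turn, s0]
  have t1 : (T.turn x).2 1 = T.perm x.1 (x.2 2) (x.2 1) := by
    simp [IdealTriangulation.turn, s1]
  have t2 : (T.turn x).2 2 = T.perm x.1 (x.2 2) (x.2 3) := by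
    simp [IdealTriangulation.turn]
  simp only [← Matrix.mulVec_mulVec]
  rcases hi with rfl | rfl | rfl
  · rw [← t0]; exact this.1
  · rw [← t1]; exact this.2.1
  · rw [← t2]; exact this.2.2

theorem standardGlue_mulVec (h0 : ∀ j, IsUnit (z j)) (h1 : ∀ j, IsUnit (1 - z j))
    (j : Fin n) {f v : Fin 4} (hv : v ≠ f) :
    ∃ k : B, IsUnit k ∧ standardGlue T z j f *ᵥ idealVector (z (T.nbr j f)) (T.perm j f v) =
      k • idealVector (z j) v := by
  obtain ⟨k, hk, h⟩ := diagonal_flagFrame_mulVec (T := T) h0 h1 (j, faceOrder f) (v := v)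
    (by rwa [faceOrder_two])
  refine ⟨k * (flagFrame z (j, faceOrder f)).det,
    hk.mul (isUnit_det_flagFrame h0 h1 _), ?_⟩
  simp only [faceOrder_two] at h
  rw [standardGlue, ← Matrix.mulVec_mulVec, h, Matrix.mulVec_smul, Matrix.mulVec_mulVec,
    Matrix.adjugate_mul, Matrix.smul_mulVec, Matrix.one_mulVec, smul_smul]

/-- Two maps that match the vertices of adjacent faces agree up to scale. -/
theorem eq_smul_of_match (h0 : ∀ j, IsUnit (z j)) (h1 : ∀ j, IsUnit (1 - z j))
    {j : Fin n} {f : Fin 4} {A A' : Matrix (Fin 2) (Fin 2) B}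
    (hA : IsUnit A.det) (h : ∀ v, v ≠ f → ∃ k : B, IsUnit k ∧
      A' *ᵥ idealVector (z (T.nbr j f)) (T.perm j f v) =
        k • A *ᵥ idealVector (z (T.nbr j f)) (T.perm j f v)) :
    ∃ k : B, IsUnit k ∧ A' = k • A := by
  have H {v w : Fin 4} (h : v ≠ w) := isUnit_bracket_idealVector (h0 (T.nbr j f)) (h1 _)
    ((T.perm j f).injective.ne h)
  obtain ⟨v₁, v₂, v₃, n₁, n₂, n₃, n₄, n₅, n₆⟩ : ∃ v₁ v₂ v₃ : Fin 4,
      v₁ ≠ f ∧ v₂ ≠ f ∧ v₃ ≠ f ∧ v₁ ≠ v₂ ∧ v₁ ≠ v₃ ∧ v₂ ≠ v₃ := by clear h H; revert f; decide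
  obtain ⟨k, hk, e₁⟩ := h v₁ n₁
  obtain ⟨l, -, e₂⟩ := h v₂ n₂
  obtain ⟨m, -, e₃⟩ := h v₃ n₃
  exact ⟨k, hk, eq_smul_of_three_lines (H n₄) (H n₅) (H n₆) hA e₁ e₂ e₃⟩

/-- In the frames of an even flag and of the next one, the gluing map is multiplication by the shape
parameter. -/
theorem flagFrame_mul_standardGlue (h0 : ∀ j, IsUnit (z j)) (h1 : ∀ j, IsUnit (1 - z j))
    (x : IdealTriangulation.Flag n)
    (hx : Equiv.Perm.sign x.2 = 1) :
    ∃ k : B, IsUnit k ∧ flagFrame z x * standardGlue T z x.1 (x.2 2) =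
      k • (Matrix.diagonal ![edgeShape (z x.1) (x.2 0) (x.2 1), 1] * flagFrame z (T.turn x)) := by
  have H {v w : Fin 4} (h : v ≠ w) := isUnit_bracket_idealVector (h0 x.1) (h1 x.1) h
  have E {v w : Fin 4} (h : v ≠ w) : x.2 v ≠ x.2 w := x.2.injective.ne h
  set D := Matrix.diagonal (flagFrame z x *ᵥ idealVector (z x.1) (x.2 3)) with hD
  have hu : IsUnit (D * flagFrame z (T.turn x)).det := by
    rw [Matrix.det_mul, hD, Matrix.det_diagonal, Fin.prod_univ_two, flagFrame, frameMatrix_mulVec]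
    exact IsUnit.mul (((H (E (by decide))).mul (H (E (by decide)))).mul
      ((H (E (by decide))).mul (H (E (by decide))))) (isUnit_det_flagFrame h0 h1 _)
  obtain ⟨k, hk, h⟩ := eq_smul_of_match (T := T) h0 h1 (j := x.1) (f := x.2 2)
    (A' := flagFrame z x * standardGlue T z x.1 (x.2 2)) hu (fun v hv => by
      obtain ⟨k, hk, h⟩ := diagonal_flagFrame_mulVec (T := T) h0 h1 x hv
      obtain ⟨l, hl, h'⟩ := standardGlue_mulVec (T := T) h0 h1 x.1 hv
      obtain ⟨k, rfl⟩ := hk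
      refine ⟨l * ↑k⁻¹, hl.mul k⁻¹.isUnit, ?_⟩
      rw [← Matrix.mulVec_mulVec, h', hD, h, Matrix.mulVec_smul, smul_smul, mul_assoc,
        Units.inv_mul, mul_one])
  refine ⟨k * (bracket (idealVector (z x.1) (x.2 2)) (idealVector (z x.1) (x.2 1)) *
    bracket (idealVector (z x.1) (x.2 3)) (idealVector (z x.1) (x.2 0))),
    hk.mul ((H (E (by decide))).mul (H (E (by decide)))), ?_⟩
  rw [h, mul_smul, ← Matrix.smul_mul (bracket _ _ * bracket _ _)]
  congr 2
  rw [hD, flagFrame, frameMatrix_mulVec, cross_ratio (h0 _) (h1 _) hx]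
  ext i j
  fin_cases i <;> fin_cases j <;> simp [mul_comm]

end Gluing

/-! ### Structures from solutions of Thurston's equations -/

section Action

variable {B : Type} [CommRing B] [StarRing B]

/-- The ideal point `u u*`. -/
def rankOne (u : Fin 2 → B) : Matrix (Fin 2) (Fin 2) B := Matrix.vecMulVec u (star u)

theorem standardPosition_eq (z : B) (v : Fin 4) :
    standardPosition z v = rankOne (idealVector z v) := by
  ext i j
  fin_cases v <;> fin_cases i <;> fin_cases j <;>
    simp [standardPosition, rankOne, idealVector, Matrix.vecMulVec_apply]

theorem act_rankOne (A : Matrix (Fin 2) (Fin 2) B) (u : Fin 2 → B) :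
    act A (rankOne u) = rankOne (A *ᵥ u) := by
  rw [act, rankOne, rankOne, Matrix.mul_vecMulVec, Matrix.vecMulVec_mul, Matrix.star_mulVec]

theorem act_act (A A' X : Matrix (Fin 2) (Fin 2) B) : act A (act A' X) = act (A * A') X := by
  simp only [act, Matrix.conjTranspose_mul, Matrix.mul_assoc]

theorem act_one (X : Matrix (Fin 2) (Fin 2) B) : act 1 X = X := by simp [act]

theorem det_act (A X : Matrix (Fin 2) (Fin 2) B) :
    (act A X).det = A.det * star A.det * X.det := by
  rw [act, Matrix.det_mul, Matrix.det_mul, Matrix.det_conjTranspose]; ring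

theorem conjTranspose_act (A X : Matrix (Fin 2) (Fin 2) B) : (act A X)ᴴ = act A Xᴴ := by
  simp only [act, Matrix.conjTranspose_mul, Matrix.conjTranspose_conjTranspose, Matrix.mul_assoc]

theorem conjTranspose_rankOne (u : Fin 2 → B) : (rankOne u)ᴴ = rankOne u := by
  ext i j; simp [rankOne, Matrix.vecMulVec_apply, mul_comm]

theorem det_rankOne (u : Fin 2 → B) : (rankOne u).det = 0 := by
  simp [rankOne, Matrix.det_fin_two, Matrix.vecMulVec_apply]; ring

theorem rankOne_smul (k : B) (u : Fin 2 → B) : rankOne (k • u) = (k * star k) • rankOne u := by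
  ext i j; simp [rankOne, Matrix.vecMulVec_apply]; ring

theorem act_smul_left (c : B) (A X : Matrix (Fin 2) (Fin 2) B) :
    act (c • A) X = (c * star c) • act A X := by
  simp only [act, Matrix.conjTranspose_smul, Matrix.smul_mul, Matrix.mul_smul, smul_smul,
    mul_comm]

end Action

section Builder

variable {B : Type} [CommRing B] [StarRing B] [Algebra ℝ B]

theorem act_real_smul (A : Matrix (Fin 2) (Fin 2) B) (r : ℝ) (X : Matrix (Fin 2) (Fin 2) B) :
    act A (r • X) = r • act A X := by
  simp [act]

theorem act_sum {α : Type*} (s : Finset α) (A : Matrix (Fin 2) (Fin 2) B)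
    (X : α → Matrix (Fin 2) (Fin 2) B) : act A (∑ i ∈ s, X i) = ∑ i ∈ s, act A (X i) := by
  simp [act, Matrix.mul_sum, Matrix.sum_mul]

variable [HasPlane B] [PlanarAlgebra B]

theorem sqNorm_smul (r : ℝ) (x : B) : sqNorm (r • x) = r ^ 2 * sqNorm x := by
  rw [Algebra.smul_def, sqNorm_mul, sqNorm_algebraMap]

variable (B) in
/-- The elements of positive square-norm. -/
def positiveNorm : Submonoid B where
  carrier := {x | 0 < sqNorm x}
  mul_mem' {x y} hx hy := by
    rw [Set.mem_ofPred_eq] at *; rw [sqNorm_mul]; positivity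
  one_mem' := by simp

theorem sqNorm_ne_zero_of_isUnit {x : B} (h : IsUnit x) : sqNorm x ≠ 0 := by
  obtain ⟨u, rfl⟩ := h
  intro h
  have := sqNorm_mul (u : B) ↑u⁻¹
  rw [h] at this
  simp at this

/-- A real matrix as a matrix over `B`. -/
def realMatrix (Q : Matrix (Fin 2) (Fin 2) ℝ) : Matrix (Fin 2) (Fin 2) B :=
  Q.map (algebraMap ℝ B)

theorem realMatrix_mul (Q Q' : Matrix (Fin 2) (Fin 2) ℝ) :
    (realMatrix (Q * Q') : Matrix (Fin 2) (Fin 2) B) = realMatrix Q * realMatrix Q' :=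
  Matrix.map_mul

theorem realMatrix_one : (realMatrix 1 : Matrix (Fin 2) (Fin 2) B) = 1 :=
  Matrix.map_one _ (map_zero _) (map_one _)

theorem det_realMatrix (Q : Matrix (Fin 2) (Fin 2) ℝ) :
    (realMatrix Q : Matrix (Fin 2) (Fin 2) B).det = algebraMap ℝ B Q.det := by
  simp [realMatrix, Matrix.det_fin_two]

theorem realMatrix_inv_mul {Q : Matrix (Fin 2) (Fin 2) ℝ} (h : Q.det ≠ 0) :
    (realMatrix Q⁻¹ * realMatrix Q : Matrix (Fin 2) (Fin 2) B) = 1 := by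
  rw [← realMatrix_mul, Matrix.nonsing_inv_mul _ h.isUnit, realMatrix_one]

theorem det_sum_standardPosition (z : B) (t : Fin 4 → ℝ) :
    (∑ v, t v • standardPosition z v).det = algebraMap ℝ B
      (t 0 * t 1 + t 0 * t 2 + t 0 * t 3 + t 1 * t 2 + t 1 * t 3 * sqNorm z +
        t 2 * t 3 * sqNorm (1 - z)) := by
  simp only [map_add, map_mul, ← mul_star_self, Matrix.det_fin_two, Fin.sum_univ_four,
    standardPosition]
  simp
  simp only [Algebra.smul_def]
  ring

theorem exists_two_pos {s : Fin 4 → ℝ} (hs : ∀ v, 0 ≤ s v ∧ s v < 1) (h : ∑ v, s v = 1) :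
    ∃ v w, v < w ∧ 0 < s v ∧ 0 < s w := by
  by_contra! H
  have key : ∀ v w, v < w → s v = 0 ∨ s w = 0 := fun v w hvw => by
    by_cases hv : 0 < s v
    · exact Or.inr (le_antisymm (H v w hvw hv) (hs w).1)
    · exact Or.inl (le_antisymm (not_lt.1 hv) (hs v).1)
  rw [Fin.sum_univ_four] at h
  have h0 := hs 0; have h1 := hs 1; have h2 := hs 2; have h3 := hs 3
  have k1 := key 0 1 (by decide); have k2 := key 0 2 (by decide); have k3 := key 0 3 (by decide)
  have k4 := key 1 2 (by decide); have k5 := key 1 3 (by decide); have k6 := key 2 3 (by decide)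
  grind

/-- Positive combinations of the ideal points `∞, 0, 1, z` lie in the model space. -/
theorem inModel_sum {z : B} (h0 : 0 < sqNorm z) (h1 : 0 < sqNorm (1 - z))
    {r : Fin 4 → ℝ} (hr : ∀ v w, 0 < r v * r w) {Q : Matrix (Fin 2) (Fin 2) ℝ} (hQ : Q.det ≠ 0)
    {s : Fin 4 → ℝ} (hs : ∀ v, 0 ≤ s v ∧ s v < 1) (h : ∑ v, s v = 1) :
    InModel (∑ v, s v • r v • act (realMatrix Q) (standardPosition z v)) := by
  have e : ∑ v, s v • r v • act (realMatrix Q) (standardPosition z v) =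
      act (realMatrix Q) (∑ v, (s v * r v) • standardPosition z v) := by
    rw [act_sum]; simp only [act_real_smul, smul_smul]
  rw [e]
  refine ⟨?_, ?_⟩
  · rw [conjTranspose_act, Matrix.conjTranspose_sum]
    congr 1
    refine Finset.sum_congr rfl fun v _ => ?_
    rw [standardPosition_eq]
    conv_rhs => rw [← conjTranspose_rankOne]
    ext i j
    simp [Matrix.conjTranspose_apply, star_real_smul]
  · rw [det_act, det_sum_standardPosition, det_realMatrix, mul_star_self, ← map_mul,
      sqNorm_algebraMap]
    refine ⟨_, mul_pos (by positivity) ?_, rfl⟩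
    have nn (v w : Fin 4) : 0 ≤ (s v * r v) * (s w * r w) := by
      have := mul_nonneg (mul_nonneg (hs v).1 (hs w).1) (hr v w).le
      linarith
    have pp (v w : Fin 4) (hv : 0 < s v) (hw : 0 < s w) : 0 < (s v * r v) * (s w * r w) := by
      have := mul_pos (mul_pos hv hw) (hr v w)
      linarith
    obtain ⟨v, w, hvw, hv, hw⟩ := exists_two_pos hs h
    have n01 := nn 0 1; have n02 := nn 0 2; have n03 := nn 0 3; have n12 := nn 1 2
    have n13 := mul_nonneg (nn 1 3) h0.le; have n23 := mul_nonneg (nn 2 3) h1.le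
    have p := pp v w hv hw
    have p0 := mul_pos p h0
    have p1 := mul_pos p h1
    fin_cases v <;> fin_cases w <;> first | (exact absurd hvw (by decide)) | skip
    all_goals simp only [Fin.zero_eta, Fin.mk_one, Fin.reduceFinMk] at p p0 p1
    all_goals linarith

theorem isIdealPoint_act {z : B} {r : ℝ} (hr : r ≠ 0) {Q : Matrix (Fin 2) (Fin 2) ℝ}
    (hQ : Q.det ≠ 0) (v : Fin 4) :
    IsIdealPoint (r • act (realMatrix Q) (standardPosition z v)) := by
  have : Nontrivial B := ⟨0, 1, fun h => by simpa using congrArg rePart h⟩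
  rw [standardPosition_eq]
  refine ⟨?_, fun h => ?_, ?_⟩
  · conv_rhs => rw [← conjTranspose_rankOne, ← conjTranspose_act]
    ext i j; simp [Matrix.conjTranspose_apply, star_real_smul]
  · rw [smul_eq_zero_iff_right hr] at h
    have h' := congrArg (act (realMatrix Q⁻¹)) h
    rw [act_act, realMatrix_inv_mul hQ, act_one] at h'
    have e0 := congrFun (congrFun h' 0) 0
    have e1 := congrFun (congrFun h' 1) 1
    fin_cases v <;> simp [rankOne, idealVector, act, Matrix.vecMulVec_apply] at e0 e1
  · rw [Matrix.det_smul_of_tower, det_act, det_rankOne]; simp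

/-- The choices that turn shape parameters into a triangulated structure: positions and
representatives of the ideal vertices, and representatives of the gluing maps. -/
structure Marking (n : ℕ) where
  pos : Fin n → Matrix (Fin 2) (Fin 2) ℝ
  scale : Fin n → Fin 4 → ℝ
  glueScale : Fin n → Fin 4 → ℝ
  det_pos : ∀ j, (pos j).det ≠ 0
  scale_mul : ∀ j v w, 0 < scale j v * scale j w
  glueScale_ne : ∀ j f, glueScale j f ≠ 0

variable {n : ℕ} {T : IdealTriangulation n}

/-- The vertices of the marked tetrahedra. -/
def Marking.vertex (m : Marking n) (z : Fin n → B) (j : Fin n) (v : Fin 4) :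
    Matrix (Fin 2) (Fin 2) B :=
  m.scale j v • act (realMatrix (m.pos j)) (standardPosition (z j) v)

/-- The gluing maps of the marked tetrahedra. -/
def Marking.glue (m : Marking n) (T : IdealTriangulation n) (z : Fin n → B) (j : Fin n)
    (f : Fin 4) : Matrix (Fin 2) (Fin 2) B :=
  m.glueScale j f • (realMatrix (m.pos j) * standardGlue T z j f *
    realMatrix (m.pos (T.nbr j f))⁻¹)

theorem Marking.glue_vertex (m : Marking n) {z : Fin n → B} (h0 : ∀ j, 0 < sqNorm (z j))
    (h1 : ∀ j, 0 < sqNorm (1 - z j)) (j : Fin n) (f v : Fin 4) (hv : v ≠ f) :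
    SamePoint (act (m.glue T z j f) (m.vertex z (T.nbr j f) (T.perm j f v)))
      (m.vertex z j v) := by
  obtain ⟨k, hk, h⟩ := standardGlue_mulVec (T := T) (fun j => isUnit_of_sqNorm_pos (h0 j))
    (fun j => isUnit_of_sqNorm_pos (h1 j)) j hv
  have hs (j v) : m.scale j v ≠ 0 := fun h => by simpa [h] using m.scale_mul j v v
  refine ⟨m.glueScale j f ^ 2 * m.scale (T.nbr j f) (T.perm j f v) * sqNorm k *
    (m.scale j v)⁻¹, ?_, ?_⟩
  · have := sqNorm_ne_zero_of_isUnit hk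
    have := m.glueScale_ne j f
    have := hs (T.nbr j f) (T.perm j f v)
    have := hs j v
    positivity
  · rw [Marking.glue, Marking.vertex, Marking.vertex, ← algebraMap_smul B (m.glueScale j f),
      act_smul_left, act_real_smul, act_act, Matrix.mul_assoc,
      realMatrix_inv_mul (m.det_pos _), Matrix.mul_one, ← act_act, standardPosition_eq,
      act_rankOne, h, rankOne_smul, mul_star_self, mul_star_self, sqNorm_algebraMap,
      algebraMap_smul, algebraMap_smul, act_real_smul, standardPosition_eq]
    simp only [smul_smul]
    congr 1
    have := hs j v
    field_simp

theorem Marking.isometry_glue (m : Marking n) {z : Fin n → B} (h0 : ∀ j, 0 < sqNorm (z j))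
    (h1 : ∀ j, 0 < sqNorm (1 - z j)) (j : Fin n) (f : Fin 4) : IsIsometry (m.glue T z j f) := by
  refine isPosReal_mul_star ?_
  have hg : 0 < sqNorm (standardGlue T z j f).det :=
    det_standardGlue_mem T (positiveNorm B) (by simp [positiveNorm]) h0 h1 j f
  have := m.glueScale_ne j f
  have := m.det_pos j
  have hQ := m.det_pos (T.nbr j f)
  rw [Marking.glue, Matrix.det_smul_of_tower, sqNorm_smul, Matrix.det_mul, Matrix.det_mul,
    sqNorm_mul, sqNorm_mul, det_realMatrix, det_realMatrix, sqNorm_algebraMap, sqNorm_algebraMap,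
    Matrix.det_nonsing_inv, Ring.inverse_eq_inv']
  positivity

theorem sign_turn (x : IdealTriangulation.Flag n) :
    Equiv.Perm.sign (T.turn x).2 = Equiv.Perm.sign x.2 := by
  simp [IdealTriangulation.turn, T.sign_perm, Equiv.Perm.sign_swap (show (2 : Fin 4) ≠ 3 by decide)]

theorem sign_turn_iterate (x : IdealTriangulation.Flag n) (k : ℕ) :
    Equiv.Perm.sign (T.turn^[k] x).2 = Equiv.Perm.sign x.2 := by
  induction k with
  | zero => rfl
  | succ k ih => rw [Function.iterate_succ_apply', sign_turn, ih]

theorem Marking.partial_holonomy_glue (m : Marking n) {z : Fin n → B}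
    (h0 : ∀ j, 0 < sqNorm (z j)) (h1 : ∀ j, 0 < sqNorm (1 - z j))
    (x : IdealTriangulation.Flag n) (hx : Equiv.Perm.sign x.2 = 1) (k : ℕ) :
    ∃ c : B, flagFrame z x * realMatrix (m.pos x.1)⁻¹ * ((List.range k).map fun i =>
        m.glue T z (T.turn^[i] x).1 ((T.turn^[i] x).2 2)).prod =
      c • (Matrix.diagonal ![partialHolonomy T z x k, 1] *
        (flagFrame z (T.turn^[k] x) * realMatrix (m.pos (T.turn^[k] x).1)⁻¹)) := by
  induction k with
  | zero =>
    refine ⟨1, ?_⟩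
    have : Matrix.diagonal ![(1 : B), 1] = 1 := by
      ext i j; fin_cases i <;> fin_cases j <;> simp
    simp [partialHolonomy, this]
  | succ k ih =>
    obtain ⟨c, hc⟩ := ih
    obtain ⟨d, -, hd⟩ := flagFrame_mul_standardGlue (T := T)
      (fun j => isUnit_of_sqNorm_pos (h0 j)) (fun j => isUnit_of_sqNorm_pos (h1 j))
      (T.turn^[k] x) (by rw [sign_turn_iterate, hx])
    refine ⟨c * algebraMap ℝ B (m.glueScale (T.turn^[k] x).1 ((T.turn^[k] x).2 2)) * d, ?_⟩
    rw [List.range_succ, List.map_append, List.prod_append, ← Matrix.mul_assoc, hc]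
    simp only [List.map_cons, List.map_nil, List.prod_cons, List.prod_nil, mul_one]
    rw [Function.iterate_succ_apply']
    set y := T.turn^[k] x with hy
    have e1 : flagFrame z y * realMatrix (m.pos y.1)⁻¹ * m.glue T z y.1 (y.2 2) =
        (algebraMap ℝ B (m.glueScale y.1 (y.2 2)) * d) •
          (Matrix.diagonal ![edgeShape (z y.1) (y.2 0) (y.2 1), 1] *
            (flagFrame z (T.turn y) * realMatrix (m.pos (T.turn y).1)⁻¹)) := by
      have e2 : flagFrame z y * realMatrix (m.pos y.1)⁻¹ * (realMatrix (m.pos y.1) *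
          standardGlue T z y.1 (y.2 2) * realMatrix (m.pos (T.nbr y.1 (y.2 2)))⁻¹) =
          flagFrame z y * (realMatrix (m.pos y.1)⁻¹ * realMatrix (m.pos y.1)) *
            standardGlue T z y.1 (y.2 2) * realMatrix (m.pos (T.nbr y.1 (y.2 2)))⁻¹ := by
        simp only [Matrix.mul_assoc]
      rw [Marking.glue, ← algebraMap_smul B (m.glueScale _ _), Matrix.mul_smul, e2,
        realMatrix_inv_mul (m.det_pos _), Matrix.mul_one, hd, Matrix.smul_mul, smul_smul,
        Matrix.mul_assoc]
      rfl
    have e3 : Matrix.diagonal ![partialHolonomy T z x (k + 1), 1] =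
        Matrix.diagonal ![partialHolonomy T z x k, 1] *
          Matrix.diagonal ![edgeShape (z y.1) (y.2 0) (y.2 1), 1] := by
      rw [partialHolonomy, Finset.prod_range_succ]
      ext i j; fin_cases i <;> fin_cases j <;> simp [partialHolonomy, hy]
    rw [Matrix.smul_mul, Matrix.mul_assoc, e1, e3, Matrix.mul_smul, smul_smul, mul_assoc c,
      Matrix.mul_assoc (Matrix.diagonal _)]

theorem Marking.edge_holonomy (m : Marking n) {z : Fin n → B}
    (h0 : ∀ j, 0 < sqNorm (z j)) (h1 : ∀ j, 0 < sqNorm (1 - z j))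
    (x : IdealTriangulation.Flag n) (hx : Equiv.Perm.sign x.2 = 1)
    (h : partialHolonomy T z x (T.valence x) = 1) :
    ∃ c : B, ((List.range (T.valence x)).map fun k =>
      m.glue T z (T.turn^[k] x).1 ((T.turn^[k] x).2 2)).prod =
        c • (1 : Matrix (Fin 2) (Fin 2) B) := by
  obtain ⟨c, hc⟩ := m.partial_holonomy_glue (T := T) h0 h1 x hx (T.valence x)
  refine ⟨c, ?_⟩
  have e : T.turn^[T.valence x] x = x := Function.iterate_minimalPeriod
  have one : Matrix.diagonal ![(1 : B), 1] = 1 := by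
    ext i j; fin_cases i <;> fin_cases j <;> simp
  rw [h, e, one, Matrix.one_mul, ← Matrix.mul_one (c • (_ * _)), Matrix.smul_mul,
    ← Matrix.mul_smul] at hc
  have hu : IsUnit (flagFrame z x * realMatrix (m.pos x.1)⁻¹) := by
    rw [Matrix.isUnit_iff_isUnit_det, Matrix.det_mul, det_realMatrix]
    refine (isUnit_det_flagFrame (fun j => isUnit_of_sqNorm_pos (h0 j))
      (fun j => isUnit_of_sqNorm_pos (h1 j)) x).mul (IsUnit.map _ ?_)
    rw [Matrix.det_nonsing_inv, Ring.inverse_eq_inv']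
    exact (inv_ne_zero (m.det_pos _)).isUnit
  exact hu.mul_left_cancel hc

/-- The triangulated structure with given marking and shape parameters. -/
def Marking.build (m : Marking n) {z : Fin n → B} (h0 : ∀ j, 0 < sqNorm (z j))
    (h1 : ∀ j, 0 < sqNorm (1 - z j)) (hT : ThurstonEquations T z) : TriangulatedStructure T B where
  vertex := m.vertex z
  glue := m.glue T z
  shape := z
  ideal j := ⟨fun v => isIdealPoint_act (fun h => by simpa [h] using m.scale_mul j v v)
      (m.det_pos j) v,
    fun s hs h => inModel_sum (h0 j) (h1 j) (m.scale_mul j) (m.det_pos j) hs h⟩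
  hasShape j := by
    refine ⟨realMatrix (m.pos j)⁻¹, isPosReal_mul_star ?_, fun v => ?_⟩
    · rw [det_realMatrix, sqNorm_algebraMap, Matrix.det_nonsing_inv, Ring.inverse_eq_inv']
      have := m.det_pos j
      positivity
    · refine ⟨m.scale j v, fun h => by simpa [h] using m.scale_mul j v v, ?_⟩
      rw [Marking.vertex, act_real_smul, act_act, realMatrix_inv_mul (m.det_pos j), act_one]
  isometry := m.isometry_glue h0 h1
  glue_vertex := m.glue_vertex h0 h1
  edge_holonomy x hx := m.edge_holonomy h0 h1 x hx (hT x hx).1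
  edge_angle x hx := (hT x hx).2

/-- The marking with all tetrahedra in the positions `∞, 0, 1, z`. -/
def Marking.standard (n : ℕ) : Marking n where
  pos _ := 1
  scale _ _ := 1
  glueScale _ _ := 1
  det_pos _ := by simp
  scale_mul _ _ _ := by simp
  glueScale_ne _ _ := one_ne_zero

theorem sqNorm_real (x : ℝ) : sqNorm x = x ^ 2 := sqNorm_algebraMap (B := ℝ) x

/-- Every point of the real deformation variety is the shape of a foliation. -/
theorem exists_foliation {z : Fin n → ℝ} (hz : z ∈ realDeformationVariety T) :
    ∃ F : Foliation T, F.shape = z :=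
  ⟨(Marking.standard n).build
    (fun j => by rw [sqNorm_real]; have := (hz.1 j).1; positivity)
    (fun j => by rw [sqNorm_real]; have := sub_ne_zero.2 (hz.1 j).2.symm; positivity) hz.2, rfl⟩

end Builder

/-! ### Orientation -/

section Orientation

variable {B : Type} [CommRing B] [StarRing B] [Algebra ℝ B] [HasPlane B] [PlanarAlgebra B]

/-- The action of a real matrix in the coordinates `x₁, …, x₄`. -/
def coordAction (Q : Matrix (Fin 2) (Fin 2) ℝ) : Matrix (Fin 4) (Fin 4) ℝ :=
  !![(Q 0 0 ^ 2 + Q 1 0 ^ 2 + Q 0 1 ^ 2 + Q 1 1 ^ 2) / 2,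
      (Q 0 0 ^ 2 - Q 1 0 ^ 2 + Q 0 1 ^ 2 - Q 1 1 ^ 2) / 2, Q 0 0 * Q 1 0 + Q 0 1 * Q 1 1, 0;
    (Q 0 0 ^ 2 + Q 1 0 ^ 2 - Q 0 1 ^ 2 - Q 1 1 ^ 2) / 2,
      (Q 0 0 ^ 2 - Q 1 0 ^ 2 - Q 0 1 ^ 2 + Q 1 1 ^ 2) / 2, Q 0 0 * Q 1 0 - Q 0 1 * Q 1 1, 0;
    Q 0 0 * Q 0 1 + Q 1 0 * Q 1 1, Q 0 0 * Q 0 1 - Q 1 0 * Q 1 1,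
      Q 0 0 * Q 1 1 + Q 0 1 * Q 1 0, 0;
    0, 0, 0, Q 0 0 * Q 1 1 - Q 0 1 * Q 1 0]

theorem det_coordAction (Q : Matrix (Fin 2) (Fin 2) ℝ) : (coordAction Q).det = Q.det ^ 4 := by
  rw [Matrix.det_fin_two, coordAction, Matrix.det_succ_row_zero]
  simp [Matrix.det_succ_row_zero, Fin.sum_univ_succ, Fin.succAbove, Matrix.submatrix]
  ring

theorem hermCoord_eq (X : Matrix (Fin 2) (Fin 2) B) :
    hermCoord X = ![(rePart (X 0 0) + rePart (X 1 1)) / 2, (rePart (X 0 0) - rePart (X 1 1)) / 2,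
      rePart (X 1 0), imPart (X 1 0)] := rfl

theorem hermCoord_act (Q : Matrix (Fin 2) (Fin 2) ℝ) (r : ℝ) {X : Matrix (Fin 2) (Fin 2) B}
    (hX : X 0 1 = star (X 1 0)) (hX0 : imPart (X 0 0) = 0) (hX1 : imPart (X 1 1) = 0) :
    hermCoord (r • act (realMatrix Q) X) = r • (hermCoord X ᵥ* coordAction Q) := by
  have e (i j : Fin 2) : act (realMatrix Q) X i j =
      (Q i 0 * Q j 0) • X 0 0 + (Q i 0 * Q j 1) • X 0 1 + (Q i 1 * Q j 0) • X 1 0 +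
        (Q i 1 * Q j 1) • X 1 1 := by
    simp only [act, realMatrix, Matrix.mul_apply, Fin.sum_univ_two, Matrix.conjTranspose_apply,
      Matrix.map_apply, star_algebraMap, Algebra.smul_def, map_mul]
    ring
  ext i
  fin_cases i <;>
    simp only [hermCoord_eq, Matrix.smul_apply, e, hX, Matrix.vecMul, dotProduct,
      Fin.sum_univ_four, coordAction, rePart_smul, imPart_smul, rePart_add,
      imPart_add, rePart_star, imPart_star, Pi.smul_apply, smul_eq_mul] <;>
    simp [-mul_eq_mul_left_iff, hX0, hX1] <;> ring

theorem det_hermCoord_standardPosition (z : B) :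
    (Matrix.of fun v => hermCoord (standardPosition z v)).det = imPart z / 2 := by
  rw [Matrix.det_succ_row_zero]
  simp [Matrix.det_succ_row_zero, Fin.sum_univ_succ, Fin.succAbove, Matrix.submatrix,
    hermCoord_eq, standardPosition]
  ring

theorem Marking.isPositivelyOriented {n : ℕ} (m : Marking n) {z : Fin n → B} (j : Fin n)
    (hz : 0 < imPart (z j)) : IsPositivelyOriented (m.vertex z j) := by
  have e : (Matrix.of fun v => hermCoord (m.vertex z j v)) =
      Matrix.diagonal (m.scale j) * ((Matrix.of fun v => hermCoord (standardPosition (z j) v)) *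
        coordAction (m.pos j)) := by
    ext v i
    rw [Matrix.of_apply, Marking.vertex, hermCoord_act, Matrix.diagonal_mul]
    · rfl
    all_goals rw [standardPosition_eq]; simp [rankOne, Matrix.vecMulVec_apply, mul_comm]
  rw [IsPositivelyOriented, e, Matrix.det_mul, Matrix.det_mul, Matrix.det_diagonal,
    det_coordAction, det_hermCoord_standardPosition, Fin.prod_univ_four]
  have h1 := m.scale_mul j 0 1
  have h2 := m.scale_mul j 2 3
  have h3 := mul_pos h1 h2
  have h4 : 0 < (m.pos j).det ^ 4 := by have := m.det_pos j; positivity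
  have h5 := mul_pos h3 (mul_pos (half_pos hz) h4)
  linarith

end Orientation

/-! ### Continuity of marked structures -/

section Continuity

variable {B : Type} [CommRing B] [StarRing B] [Algebra ℝ B] [HasPlane B] [PlanarAlgebra B]
  {ι : Type*} {l : Filter ι} {n : ℕ} {T : IdealTriangulation n} {Z : ι → Fin n → B}
  {z : Fin n → ℝ}

theorem convergesTo_idealVector {x : ι → B} {a : ℝ} (h : ConvergesTo l x a) (v : Fin 4)
    (i : Fin 2) : ConvergesTo l (fun t => idealVector (x t) v i) (idealVector a v i) := by
  fin_cases v <;> fin_cases i <;>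
    first | exact h | exact ConvergesTo.one | exact ConvergesTo.zero

theorem convergesTo_bracket {x y : ι → Fin 2 → B} {a b : Fin 2 → ℝ}
    (hx : ∀ i, ConvergesTo l (fun t => x t i) (a i))
    (hy : ∀ i, ConvergesTo l (fun t => y t i) (b i)) :
    ConvergesTo l (fun t => bracket (x t) (y t)) (bracket a b) :=
  ((hx 0).mul (hy 1)).sub ((hx 1).mul (hy 0))

theorem matrixConvergesTo_flagFrame (h : ∀ j, ConvergesTo l (fun t => Z t j) (z j))
    (x : IdealTriangulation.Flag n) :
    MatrixConvergesTo l (fun t => flagFrame (Z t) x) (flagFrame z x) := by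
  have hv (v : Fin 4) (i : Fin 2) := convergesTo_idealVector (h x.1) v i
  have hb (v w : Fin 4) := convergesTo_bracket (hv v) (hv w)
  intro i j
  fin_cases i <;> fin_cases j
  · exact (hb _ _).mul (hv _ _)
  · exact ((hb _ _).mul (hv _ _)).neg
  · exact (hb _ _).mul (hv _ _)
  · exact ((hb _ _).mul (hv _ _)).neg

theorem matrixConvergesTo_standardGlue (h : ∀ j, ConvergesTo l (fun t => Z t j) (z j))
    (j : Fin n) (f : Fin 4) :
    MatrixConvergesTo l (fun t => standardGlue T (Z t) j f) (standardGlue T z j f) := by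
  have hF := matrixConvergesTo_flagFrame h
  have hA : MatrixConvergesTo l (fun t => (flagFrame (Z t) (j, faceOrder f)).adjugate)
      (flagFrame z (j, faceOrder f)).adjugate := by
    simp only [Matrix.adjugate_fin_two]
    intro a b
    fin_cases a <;> fin_cases b
    · exact hF (j, faceOrder f) 1 1
    · exact (hF (j, faceOrder f) 0 1).neg
    · exact (hF (j, faceOrder f) 1 0).neg
    · exact hF (j, faceOrder f) 0 0
  refine hA.mul (MatrixConvergesTo.mul ?_ (hF _))
  intro a b
  by_cases hab : a = b
  · subst hab
    simp only [Matrix.diagonal_apply_eq, Matrix.mulVec, dotProduct]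
    exact ConvergesTo.sum _ fun i _ => (hF _ _ _).mul (convergesTo_idealVector (h j) _ _)
  · simpa [Matrix.diagonal_apply_ne _ hab] using ConvergesTo.zero

theorem Marking.matrixConvergesTo_glue (m : Marking n)
    (h : ∀ j, ConvergesTo l (fun t => Z t j) (z j)) (j : Fin n) (f : Fin 4) :
    MatrixConvergesTo l (fun t => m.glue T (Z t) j f) (m.glue T z j f) :=
  MatrixConvergesTo.smul _ (((MatrixConvergesTo.const _).mul
    (matrixConvergesTo_standardGlue h j f)).mul (MatrixConvergesTo.const _))

theorem Marking.matrixConvergesTo_vertex (m : Marking n)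
    (h : ∀ j, ConvergesTo l (fun t => Z t j) (z j)) (j : Fin n) (v : Fin 4) :
    MatrixConvergesTo l (fun t => m.vertex (Z t) j v) (m.vertex z j v) := by
  refine MatrixConvergesTo.smul _ (MatrixConvergesTo.act (MatrixConvergesTo.const _) ?_)
  intro a b
  simp only [standardPosition_eq]
  exact (convergesTo_idealVector (h j) v a).mul (convergesTo_idealVector (h j) v b).star

end Continuity

/-! ### Foliations are marked -/

section FoliationMarking

variable {n : ℕ} {T : IdealTriangulation n}

theorem realMatrix_real (Q : Matrix (Fin 2) (Fin 2) ℝ) : realMatrix Q = Q := by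
  ext i j; simp [realMatrix]

theorem det_ne_zero_of_isIsometry {A : Matrix (Fin 2) (Fin 2) ℝ} (h : IsIsometry A) :
    A.det ≠ 0 := by
  obtain ⟨r, hr, h⟩ := h
  intro h0
  rw [h0] at h
  simp at h
  exact hr.ne h

theorem exists_smul_of_rankOne {x y : Fin 2 → ℝ} {r : ℝ} (hr : r ≠ 0) (hy : y ≠ 0)
    (h : rankOne x = r • rankOne y) : ∃ k : ℝ, IsUnit k ∧ x = k • y := by
  obtain ⟨i, hi⟩ := Function.ne_iff.1 hy
  simp only [Pi.zero_apply] at hi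
  have e (j : Fin 2) : x j * x i = r * (y j * y i) := by
    simpa [rankOne, Matrix.vecMulVec_apply] using congrFun (congrFun h j) i
  have hx : x i ≠ 0 := by
    intro h0
    have := e i
    rw [h0, mul_zero] at this
    exact mul_ne_zero hr (mul_ne_zero hi hi) this.symm
  refine ⟨r * y i / x i, (div_ne_zero (mul_ne_zero hr hi) hx).isUnit, ?_⟩
  ext j
  rw [Pi.smul_apply, smul_eq_mul, div_mul_eq_mul_div, eq_div_iff hx, e j]
  ring

theorem idealVector_ne_zero (z : ℝ) (v : Fin 4) : idealVector z v ≠ 0 := by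
  intro h
  have h0 := congrFun h 0
  have h1 := congrFun h 1
  fin_cases v <;> simp [idealVector] at h0 h1

/-- The representatives of the vertices of a collapsed ideal tetrahedron have the same sign. -/
theorem scale_mul_pos {z : ℝ} {r : Fin 4 → ℝ} (hr : ∀ v, r v ≠ 0)
    {Q : Matrix (Fin 2) (Fin 2) ℝ}
    (h : IsIdealTetrahedron fun v => r v • act Q (standardPosition z v)) (v w : Fin 4) :
    0 < r v * r w := by
  rcases eq_or_ne v w with rfl | hvw
  · exact mul_self_pos.2 (hr v)
  set s : Fin 4 → ℝ := fun u => if u = v ∨ u = w then 1 / 2 else 0 with hs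
  have hsum : ∑ u, s u = 1 := by
    clear h hr
    fin_cases v <;> fin_cases w <;> simp [hs, Fin.sum_univ_four] at hvw ⊢ <;> norm_num
  obtain ⟨-, c, hc, e⟩ := h.2 s (fun u => by simp only [hs]; split_ifs <;> norm_num) hsum
  have e' : ∑ u, s u • r u • act Q (standardPosition z u) =
      act Q (∑ u, (s u * r u) • standardPosition z u) := by
    rw [act_sum]; simp only [act_real_smul, smul_smul]
  rw [e', det_act, det_sum_standardPosition, sqNorm_real, sqNorm_real] at e
  have hpos : 0 < s 0 * r 0 * (s 1 * r 1) + s 0 * r 0 * (s 2 * r 2) + s 0 * r 0 * (s 3 * r 3) +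
      s 1 * r 1 * (s 2 * r 2) + s 1 * r 1 * (s 3 * r 3) * z ^ 2 +
      s 2 * r 2 * (s 3 * r 3) * (1 - z) ^ 2 := by
    simp only [Algebra.algebraMap_self, RingHom.id_apply, star_trivial] at e
    rw [← e] at hc
    exact pos_of_mul_pos_right hc (mul_self_nonneg _)
  clear_value s
  subst hs
  clear h hsum e e'
  by_contra! hle
  have hz : r v * r w * z ^ 2 ≤ 0 := mul_nonpos_of_nonpos_of_nonneg hle (sq_nonneg _)
  have hz' : r v * r w * (1 - z) ^ 2 ≤ 0 := mul_nonpos_of_nonpos_of_nonneg hle (sq_nonneg _)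
  fin_cases v <;> fin_cases w <;> simp at hvw hpos hle hz hz' <;> linarith

/-- Every foliation with nondegenerate shapes comes from a marking. -/
theorem exists_marking (F : Foliation T) (h0 : ∀ j, F.shape j ≠ 0) (h1 : ∀ j, F.shape j ≠ 1) :
    ∃ m : Marking n, m.vertex F.shape = F.vertex ∧ m.glue T F.shape = F.glue := by
  choose A hA hAv using F.hasShape
  choose r hr hrv using hAv
  have hdet (j) : (A j).det ≠ 0 := det_ne_zero_of_isIsometry (hA j)
  have hdet' (j) : (A j)⁻¹.det ≠ 0 := by
    rw [Matrix.det_nonsing_inv, Ring.inverse_eq_inv']; exact inv_ne_zero (hdet j)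
  have hv (j v) : r j v • act (A j)⁻¹ (standardPosition (F.shape j) v) = F.vertex j v := by
    rw [← act_real_smul, ← hrv, act_act, Matrix.nonsing_inv_mul _ (hdet j).isUnit, act_one]
  have u0 (j) : IsUnit (F.shape j) := (h0 j).isUnit
  have u1 (j) : IsUnit (1 - F.shape j) := (sub_ne_zero.2 (h1 j).symm).isUnit
  have key (j : Fin n) (f : Fin 4) : ∃ k : ℝ, IsUnit k ∧
      A j * F.glue j f * (A (T.nbr j f))⁻¹ = k • standardGlue T F.shape j f := by
    refine eq_smul_of_match (T := T) u0 u1 (j := j) (f := f)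
      (det_standardGlue_mem T (IsUnit.submonoid ℝ) isUnit_one.neg u0 u1 j f) fun v hvf => ?_
    obtain ⟨c, hc, e⟩ := F.glue_vertex j f v hvf
    obtain ⟨k, hk, hk'⟩ := standardGlue_mulVec (T := T) u0 u1 j hvf
    obtain ⟨k', hk'', e'⟩ : ∃ k' : ℝ, IsUnit k' ∧ (A j * F.glue j f * (A (T.nbr j f))⁻¹) *ᵥ
        idealVector (F.shape (T.nbr j f)) (T.perm j f v) = k' • idealVector (F.shape j) v := by
      refine exists_smul_of_rankOne
        (r := (r (T.nbr j f) (T.perm j f v))⁻¹ * c * r j v)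
        (mul_ne_zero (mul_ne_zero (inv_ne_zero (hr _ _)) hc) (hr _ _)) (idealVector_ne_zero _ _) ?_
      rw [← act_rankOne, ← act_act, ← act_act, ← standardPosition_eq, ← standardPosition_eq]
      rw [← hv (T.nbr j f), act_real_smul] at e
      have e2 := congrArg (act (A j)) e
      rw [act_real_smul, act_real_smul, hrv] at e2
      have := hr (T.nbr j f) (T.perm j f v)
      rw [mul_assoc, mul_smul, mul_smul, ← e2, smul_smul, inv_mul_cancel₀ this, one_smul]
    refine ⟨k' * k⁻¹, hk''.mul hk.inv, ?_⟩
    rw [e', hk', smul_smul, mul_assoc, inv_mul_cancel₀ hk.ne_zero, mul_one]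
  choose c hc hglue using key
  refine ⟨⟨fun j => (A j)⁻¹, r, c, hdet', fun j => ?_, fun j f => (hc j f).ne_zero⟩, ?_, ?_⟩
  · refine scale_mul_pos (z := F.shape j) (Q := (A j)⁻¹) (hr j) ?_
    simp only [hv]
    exact F.ideal j
  · funext j v
    rw [Marking.vertex, realMatrix_real, hv]
  · funext j f
    simp only [Marking.glue, realMatrix_real]
    rw [← Matrix.smul_mul, ← Matrix.mul_smul, ← hglue,
      Matrix.nonsing_inv_nonsing_inv _ (hdet _).isUnit]
    simp only [Matrix.mul_assoc]
    rw [Matrix.nonsing_inv_mul _ (hdet _).isUnit, Matrix.mul_one,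
      ← Matrix.mul_assoc, Matrix.nonsing_inv_mul _ (hdet _).isUnit, Matrix.one_mul]

end FoliationMarking

/-! ### Dihedral angles near a collapsed structure -/

section Angle

/-- The argument is continuous at nonzero real points along the upper half plane. -/
theorem tendsto_arg_of_im_pos {ι : Type*} {l : Filter ι} {q : ι → ℂ} {c : ℝ} (hc : c ≠ 0)
    (h : Tendsto q l (𝓝 (c : ℂ))) (him : ∀ᶠ t in l, 0 < (q t).im) :
    Tendsto (fun t => (q t).arg) l (𝓝 (c : ℂ).arg) := by
  rcases lt_or_gt_of_ne hc with hc | hc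
  · have hcont := Complex.continuousWithinAt_arg_of_re_neg_of_im_zero (z := (c : ℂ))
      (by simpa using hc) (by simp)
    refine hcont.tendsto.comp (tendsto_nhdsWithin_iff.2 ⟨h, ?_⟩)
    filter_upwards [him] with t ht using ht.le
  · exact (Complex.continuousAt_arg (Or.inl (by simpa using hc))).tendsto.comp h

theorem prod_norm_mul_exp_sum_arg (f : ℕ → ℂ) (k : ℕ) (hf : ∀ i < k, f i ≠ 0) :
    f 0 * ((∏ i ∈ Finset.range k, ‖f (i + 1) / f i‖ : ℝ) : ℂ) *
      Complex.exp ((∑ i ∈ Finset.range k, (f (i + 1) / f i).arg : ℝ) * Complex.I) = f k := by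
  induction k with
  | zero => simp
  | succ k ih =>
    have ih := ih fun i hi => hf i (by omega)
    rw [Finset.prod_range_succ, Finset.sum_range_succ]
    push_cast
    push_cast at ih
    rw [add_mul, Complex.exp_add]
    have e := Complex.norm_mul_exp_arg_mul_I (f (k + 1) / f k)
    calc _ = (f 0 * (∏ i ∈ Finset.range k, (‖f (i + 1) / f i‖ : ℂ)) *
        Complex.exp ((∑ i ∈ Finset.range k, ((f (i + 1) / f i).arg : ℂ)) * Complex.I)) *
        (‖f (k + 1) / f k‖ * Complex.exp ((f (k + 1) / f k).arg * Complex.I)) := by ring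
      _ = _ := by rw [ih, e, mul_div_cancel₀ _ (hf k (by omega))]

/-- The angle swept out along a closed polygon is a multiple of `2π`. -/
theorem exists_sum_arg_eq (f : ℕ → ℂ) (k : ℕ) (hf : ∀ i, f i ≠ 0) (h : f k = f 0) :
    ∃ m : ℤ, ∑ i ∈ Finset.range k, (f (i + 1) / f i).arg = m * (2 * Real.pi) := by
  have key := prod_norm_mul_exp_sum_arg f k fun i _ => hf i
  rw [h, mul_assoc] at key
  have key := mul_left_cancel₀ (hf 0) (key.trans (mul_one _).symm)
  set R := ∏ i ∈ Finset.range k, ‖f (i + 1) / f i‖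
  set S := ∑ i ∈ Finset.range k, (f (i + 1) / f i).arg
  have hR : 0 ≤ R := Finset.prod_nonneg fun _ _ => norm_nonneg _
  have hR1 : R = 1 := by
    have := congrArg norm key
    rwa [norm_mul, Complex.norm_exp_ofReal_mul_I, mul_one, norm_one, Complex.norm_real,
      Real.norm_of_nonneg hR] at this
  rw [hR1, Complex.ofReal_one, one_mul, Complex.exp_eq_one_iff] at key
  obtain ⟨m, hm⟩ := key
  refine ⟨m, ?_⟩
  have := congrArg Complex.im hm
  simpa using this

variable {B : Type} [CommRing B] [StarRing B] [Algebra ℝ B] [HasPlane B] [PlanarAlgebra B]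
  {ι : Type*} {l : Filter ι} {n : ℕ} {T : IdealTriangulation n} {Z : ι → Fin n → B}
  {z : Fin n → ℝ}

theorem edgeShape_cases {A : Type} [CommRing A] (z : A) (a b : Fin 4) :
    edgeShape z a b = z ∨ edgeShape z a b = Ring.inverse (1 - z) ∨
      edgeShape z a b = (z - 1) * Ring.inverse z := by
  unfold edgeShape
  split_ifs <;> simp

theorem edgeShape_ne_zero {K : Type} [Field K] {z : K} (h0 : z ≠ 0) (h1 : z ≠ 1) (a b : Fin 4) :
    edgeShape z a b ≠ 0 := by
  rcases edgeShape_cases z a b with h | h | h <;> rw [h] <;> simp [sub_eq_zero, h0, h1, h1.symm]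

theorem convergesTo_edgeShape {x : ι → B} {a : ℝ} (h : ConvergesTo l x a) (h0 : a ≠ 0)
    (h1 : a ≠ 1) (v w : Fin 4) :
    ConvergesTo l (fun t => edgeShape (x t) v w) (edgeShape a v w) := by
  unfold edgeShape
  split_ifs
  · exact h
  · simpa using (ConvergesTo.one.sub h).ringInverse (sub_ne_zero.2 h1.symm)
  · simpa using (h.sub ConvergesTo.one).mul (h.ringInverse h0)

theorem imPart_edgeShape_pos {z : B} (h0 : 0 < sqNorm z) (h1 : 0 < sqNorm (1 - z))
    (h : 0 < imPart z) (a b : Fin 4) : 0 < imPart (edgeShape z a b) := by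
  rcases edgeShape_cases z a b with e | e | e <;> rw [e]
  · exact h
  · rw [ringInverse_eq h1]
    simp only [imPart_mul, rePart_algebraMap, imPart_algebraMap, imPart_star, imPart_sub,
      imPart_one, zero_mul, add_zero, zero_sub, neg_neg]
    positivity
  · rw [sub_mul, Ring.mul_inverse_cancel _ (isUnit_of_sqNorm_pos h0), one_mul, imPart_sub,
      ringInverse_eq h0]
    simp only [imPart_mul, rePart_algebraMap, imPart_algebraMap, imPart_star,
      imPart_one, zero_mul, add_zero, zero_sub, mul_neg, neg_neg]
    positivity

theorem partialHolonomy_succ {A : Type} [CommRing A] (z : Fin n → A)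
    (x : IdealTriangulation.Flag n) (k : ℕ) :
    partialHolonomy T z x (k + 1) = partialHolonomy T z x k *
      edgeShape (z (T.turn^[k] x).1) ((T.turn^[k] x).2 0) ((T.turn^[k] x).2 1) :=
  Finset.prod_range_succ _ _

theorem partialHolonomy_ne_zero {K : Type} [Field K] {z : Fin n → K} (h0 : ∀ j, z j ≠ 0)
    (h1 : ∀ j, z j ≠ 1) (x : IdealTriangulation.Flag n) (k : ℕ) :
    partialHolonomy T z x k ≠ 0 :=
  Finset.prod_ne_zero_iff.2 fun _ _ => edgeShape_ne_zero (h0 _) (h1 _) _ _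

theorem sqNorm_edgeShape_pos {z : B} (h0 : 0 < sqNorm z) (h1 : 0 < sqNorm (1 - z))
    (a b : Fin 4) : 0 < sqNorm (edgeShape z a b) := by
  have hinv {x : B} (h : 0 < sqNorm x) : 0 < sqNorm (Ring.inverse x) := by
    have := sqNorm_mul x (Ring.inverse x)
    rw [Ring.mul_inverse_cancel _ (isUnit_of_sqNorm_pos h), sqNorm_one] at this
    exact pos_of_mul_pos_right (this ▸ one_pos) h.le
  rcases edgeShape_cases z a b with e | e | e <;> rw [e]
  · exact h0
  · exact hinv h1
  · rw [sqNorm_mul, ← neg_sub, sqNorm_neg]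
    exact mul_pos h1 (hinv h0)

theorem sqNorm_partialHolonomy_pos {z : Fin n → B} (h0 : ∀ j, 0 < sqNorm (z j))
    (h1 : ∀ j, 0 < sqNorm (1 - z j)) (x : IdealTriangulation.Flag n) (k : ℕ) :
    0 < sqNorm (partialHolonomy T z x k) :=
  (positiveNorm B).prod_mem fun _ _ => sqNorm_edgeShape_pos (h0 _) (h1 _) _ _

/-- Multiplication by an element with positive imaginary part turns counterclockwise. -/
theorem im_plane_div_pos {w c : B} (hw : 0 < sqNorm w) (hc : 0 < imPart c) :
    0 < (HasPlane.plane (w * c) / HasPlane.plane w).im := by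
  have hne : HasPlane.plane w ≠ 0 := by
    intro h
    have h1 : rePart w = 0 := congrArg Complex.re h
    have h2 : imPart w = 0 := congrArg Complex.im h
    simp [sqNorm, h1, h2] at hw
  rw [Complex.div_im, ← sub_div]
  refine div_pos ?_ (Complex.normSq_pos.2 hne)
  have e : (HasPlane.plane (w * c)).im * (HasPlane.plane w).re -
      (HasPlane.plane (w * c)).re * (HasPlane.plane w).im = imPart c * sqNorm w := by
    change imPart (w * c) * rePart w - rePart (w * c) * imPart w = _
    rw [imPart_mul, rePart_mul, sqNorm]; ring
  rw [e]
  exact mul_pos hc hw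

/-- Near a solution of the real equations, the solutions of the product equations with positive
imaginary parts have the right dihedral angles. -/
theorem eventually_totalAngle (h0 : ∀ j, z j ≠ 0) (h1 : ∀ j, z j ≠ 1)
    (hZ : ∀ j, ConvergesTo l (fun t => Z t j) (z j))
    (him : ∀ᶠ t in l, ∀ j, 0 < imPart (Z t j)) (x : IdealTriangulation.Flag n)
    (hprod : ∀ᶠ t in l, partialHolonomy T (Z t) x (T.valence x) = 1)
    (hang : totalAngle T z x = 2 * Real.pi) :
    ∀ᶠ t in l, totalAngle T (Z t) x = 2 * Real.pi := by
  have n0 : ∀ᶠ t in l, ∀ j, 0 < sqNorm (Z t j) :=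
    eventually_all.2 fun j => (hZ j).eventually_sqNorm_pos (h0 j)
  have n1 : ∀ᶠ t in l, ∀ j, 0 < sqNorm (1 - Z t j) :=
    eventually_all.2 fun j =>
      (ConvergesTo.one.sub (hZ j)).eventually_sqNorm_pos (sub_ne_zero.2 (h1 j).symm)
  have hP (k : ℕ) : ConvergesTo l (fun t => partialHolonomy T (Z t) x k)
      (partialHolonomy T z x k) :=
    ConvergesTo.prod _ fun i _ => convergesTo_edgeShape (hZ _) (h0 _) (h1 _) _ _
  have hne (k : ℕ) := partialHolonomy_ne_zero (T := T) h0 h1 x k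
  have hlim : Tendsto (fun t => totalAngle T (Z t) x) l (𝓝 (2 * Real.pi)) := by
    rw [← hang]
    refine tendsto_finsetSum _ fun k _ => ?_
    have hq := (hP (k + 1)).div (hP k) (by simpa using hne k)
    rw [← Complex.ofReal_div] at hq
    have := tendsto_arg_of_im_pos (div_ne_zero (hne (k + 1)) (hne k)) hq (by
      filter_upwards [n0, n1, him] with t t0 t1 ti
      have := im_plane_div_pos (sqNorm_partialHolonomy_pos (T := T) t0 t1 x k)
        (imPart_edgeShape_pos (t0 _) (t1 _) (ti (T.turn^[k] x).1) ((T.turn^[k] x).2 0)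
          ((T.turn^[k] x).2 1))
      rwa [← partialHolonomy_succ] at this)
    simpa [HasPlane.plane] using this
  have hnear := hlim.eventually (Ioo_mem_nhds (show (0 : ℝ) < 2 * Real.pi by positivity)
    (show 2 * Real.pi < 4 * Real.pi by linarith [Real.pi_pos]))
  filter_upwards [hnear, n0, n1, hprod] with t ht t0 t1 tp
  obtain ⟨m, hm⟩ := exists_sum_arg_eq (fun k => HasPlane.plane (partialHolonomy T (Z t) x k))
    (T.valence x) (fun i h => by
      have := sqNorm_partialHolonomy_pos (T := T) t0 t1 x i
      have r1 : rePart (partialHolonomy T (Z t) x i) = 0 := congrArg Complex.re h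
      have r2 : imPart (partialHolonomy T (Z t) x i) = 0 := congrArg Complex.im h
      simp [sqNorm, r1, r2] at this) (by
      simp only [tp]
      simp [partialHolonomy])
  change totalAngle T (Z t) x = _ at hm
  rw [hm] at ht ⊢
  have hpi := Real.pi_pos
  have m1 : (0 : ℝ) < m := by
    by_contra! h
    have := mul_nonpos_of_nonpos_of_nonneg h (show (0 : ℝ) ≤ 2 * Real.pi by positivity)
    linarith [ht.1]
  have m2 : (m : ℝ) < 2 := by
    by_contra! h
    have := mul_le_mul_of_nonneg_right h (show (0 : ℝ) ≤ 2 * Real.pi by positivity)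
    linarith [ht.2]
  have m3 : m = 1 := by
    have : 0 < m := by exact_mod_cast m1
    have : m < 2 := by exact_mod_cast m2
    omega
  rw [m3]; simp

/-! ### Regeneration from a curve of shape parameters -/

/-- A curve of solutions of the product equations with positive imaginary parts that converges to
the shape of a foliation gives structures that collapse to it. -/
theorem regenerate (F : Foliation T) (h0 : ∀ j, F.shape j ≠ 0) (h1 : ∀ j, F.shape j ≠ 1)
    (Z : ℝ → Fin n → B)
    (hcont : ∀ᶠ s in 𝓝[>] (0 : ℝ), ∀ j, ContinuousAt (fun s => HasPlane.plane (Z s j)) s)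
    (hZ : ∀ j, ConvergesTo (𝓝[>] (0 : ℝ)) (fun s => Z s j) (F.shape j))
    (him : ∀ᶠ s in 𝓝[>] (0 : ℝ), ∀ j, 0 < imPart (Z s j))
    (hprod : ∀ᶠ s in 𝓝[>] (0 : ℝ), ∀ x : IdealTriangulation.Flag n, Equiv.Perm.sign x.2 = 1 →
      partialHolonomy T (Z s) x (T.valence x) = 1) :
    ∃ S : Set.Ioi (0 : ℝ) →
        {S : TriangulatedStructure T B // ∀ j, IsPositivelyOriented (S.vertex j)},
      IsPath (fun t => (S t).1) ∧ CollapsesTo (fun t => (S t).1) F := by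
  have n0 : ∀ᶠ s in 𝓝[>] (0 : ℝ), ∀ j, 0 < sqNorm (Z s j) :=
    eventually_all.2 fun j => (hZ j).eventually_sqNorm_pos (h0 j)
  have n1 : ∀ᶠ s in 𝓝[>] (0 : ℝ), ∀ j, 0 < sqNorm (1 - Z s j) :=
    eventually_all.2 fun j =>
      (ConvergesTo.one.sub (hZ j)).eventually_sqNorm_pos (sub_ne_zero.2 (h1 j).symm)
  have hang : ∀ᶠ s in 𝓝[>] (0 : ℝ), ∀ x : IdealTriangulation.Flag n, Equiv.Perm.sign x.2 = 1 →
      totalAngle T (Z s) x = 2 * Real.pi := by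
    refine eventually_all.2 fun x => ?_
    by_cases hx : Equiv.Perm.sign x.2 = 1
    · filter_upwards [eventually_totalAngle h0 h1 hZ him x
        (hprod.mono fun s hs => hs x hx) (F.edge_angle x hx)] with s hs _ using hs
    · exact Eventually.of_forall fun s h => absurd h hx
  obtain ⟨δ, hδ, hall⟩ := mem_nhdsGT_iff_exists_Ioo_subset.1
    (hcont.and (him.and (hprod.and (n0.and (n1.and hang)))))
  rw [Set.mem_Ioi] at hδ
  obtain ⟨m, hmv, hmg⟩ := exists_marking F h0 h1
  set p : Set.Ioi (0 : ℝ) → ℝ := fun t => δ * (t.1 / (1 + t.1)) with hp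
  have hpos (t : Set.Ioi (0 : ℝ)) : (0 : ℝ) < t.1 := t.2
  have hpI (t) : p t ∈ Set.Ioo 0 δ := by
    have := hpos t
    refine ⟨by positivity, ?_⟩
    have : t.1 / (1 + t.1) < 1 := by rw [div_lt_one (by positivity)]; linarith
    nlinarith
  have hpc : Continuous p := by
    refine continuous_const.mul (continuous_subtype_val.div (by fun_prop) fun t => ?_)
    have := hpos t
    positivity
  have hpt : Tendsto p toZero (𝓝[>] 0) := by
    refine tendsto_nhdsWithin_iff.2 ⟨?_, Eventually.of_forall fun t => (hpI t).1⟩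
    have : Tendsto (fun t : ℝ => δ * (t / (1 + t))) (𝓝 0) (𝓝 (δ * (0 / (1 + 0)))) := by
      refine ContinuousAt.tendsto ?_
      refine continuousAt_const.mul (continuousAt_id.div (by fun_prop) (by simp))
    simp only [zero_div, mul_zero] at this
    exact this.comp tendsto_comap
  have hZp (j) : ConvergesTo toZero (fun t => Z (p t) j) (F.shape j) := (hZ j).comp hpt
  refine ⟨fun t => ⟨m.build (T := T) (z := Z (p t)) (hall (hpI t)).2.2.2.1
    (hall (hpI t)).2.2.2.2.1 (fun x hx => ⟨(hall (hpI t)).2.2.1 x hx,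
      (hall (hpI t)).2.2.2.2.2 x hx⟩), fun j =>
    m.isPositivelyOriented j ((hall (hpI t)).2.1 j)⟩, fun j => ?_, ?_⟩
  · refine continuous_iff_continuousAt.2 fun t => ?_
    exact ContinuousAt.comp (f := p) (g := fun s => HasPlane.plane (Z s j))
      ((hall (hpI t)).1 j) hpc.continuousAt
  · set S : Set.Ioi (0 : ℝ) → TriangulatedStructure T B := fun t =>
      m.build (T := T) (z := Z (p t)) (hall (hpI t)).2.2.2.1
        (hall (hpI t)).2.2.2.2.1 (fun x hx => ⟨(hall (hpI t)).2.2.1 x hx,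
          (hall (hpI t)).2.2.2.2.2 x hx⟩) with hS
    change CollapsesTo S F
    have hhol (path : List (Fin 4)) : ∀ j, MatrixConvergesTo toZero
        (fun t => (S t).holonomy j path) (F.holonomy j path) := by
      induction path with
      | nil => exact fun j => MatrixConvergesTo.one
      | cons f path ih =>
        intro j
        refine MatrixConvergesTo.mul ?_ (ih _)
        rw [← hmg]
        exact m.matrixConvergesTo_glue hZp j f
    refine ⟨fun j path v => ⟨fun _ => 1, fun _ => one_ne_zero, ?_⟩,
      fun j path => ⟨fun _ => 1, fun _ => isUnit_one, ?_⟩, hZp⟩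
    · simp only [one_smul]
      refine MatrixConvergesTo.act (hhol path j) ?_
      rw [← hmv]
      exact m.matrixConvergesTo_vertex hZp _ v
    · simp only [one_smul]
      exact hhol path j

end Angle

/-! ### Edge cycles -/

section Cycles

variable {n : ℕ} (T : IdealTriangulation n)

/-- The flag of the same edge with the opposite orientation. -/
def reverseFlag : Equiv.Perm (IdealTriangulation.Flag n) :=
  Function.Involutive.toPerm (fun x => (x.1, x.2 * halfTurn)) fun x => by
    have : halfTurn * halfTurn = 1 := by decide
    simp [mul_assoc, this]

theorem turn_reverse_turn (x : IdealTriangulation.Flag n) :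
    T.turn (reverseFlag (T.turn x)) = reverseFlag x := by
  have e2 : (T.turn x).2 (halfTurn 2) = T.perm x.1 (x.2 2) (x.2 2) := by
    have : Equiv.swap (2 : Fin 4) 3 (halfTurn 2) = 2 := by decide
    simp [IdealTriangulation.turn, this]
  have e3 : Equiv.swap (2 : Fin 4) 3 * halfTurn * Equiv.swap 2 3 = halfTurn := by decide
  refine Prod.ext ?_ ?_
  · change T.nbr (T.turn x).1 ((T.turn x).2 (halfTurn 2)) = x.1
    rw [e2]
    exact T.nbr_nbr _ _
  · change T.perm (T.turn x).1 ((T.turn x).2 (halfTurn 2)) * ((T.turn x).2 * halfTurn) *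
      Equiv.swap 2 3 = x.2 * halfTurn
    rw [e2]
    have := T.perm_perm x.1 (x.2 2)
    change T.perm (T.turn x).1 _ = _ at this
    rw [this]
    simp only [IdealTriangulation.turn, mul_assoc, inv_mul_cancel_left]
    rw [← mul_assoc (Equiv.swap 2 3), e3]

/-- Turning around edges as a permutation of the flags. -/
def turnPerm : Equiv.Perm (IdealTriangulation.Flag n) where
  toFun := T.turn
  invFun x := reverseFlag (T.turn (reverseFlag x))
  left_inv x := by
    change reverseFlag (T.turn (reverseFlag (T.turn x))) = x
    rw [turn_reverse_turn]; exact reverseFlag.left_inv x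
  right_inv x := by
    rw [turn_reverse_turn]; exact reverseFlag.left_inv x

open Classical in
/-- The flags around the edge of a flag. -/
def edgeCycle (x : IdealTriangulation.Flag n) : Finset (IdealTriangulation.Flag n) :=
  {y | (turnPerm T).SameCycle x y}

variable {T}

theorem mem_edgeCycle {x y : IdealTriangulation.Flag n} :
    y ∈ edgeCycle T x ↔ (turnPerm T).SameCycle x y := by simp [edgeCycle]

theorem edgeCycle_eq {x y : IdealTriangulation.Flag n} (h : (turnPerm T).SameCycle x y) :
    edgeCycle T x = edgeCycle T y := by
  ext u
  simp only [mem_edgeCycle]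
  exact ⟨fun h' => h.symm.trans h', fun h' => h.trans h'⟩

theorem turnPerm_pow (x : IdealTriangulation.Flag n) (k : ℕ) :
    (turnPerm T ^ k) x = T.turn^[k] x := by
  rw [← Equiv.Perm.iterate_eq_pow]; rfl

theorem valence_pos (x : IdealTriangulation.Flag n) : 0 < T.valence x :=
  Function.minimalPeriod_pos_of_mem_periodicPts
    ((turnPerm T).injective.mem_periodicPts x)

theorem edgeCycle_eq_image (x : IdealTriangulation.Flag n) :
    edgeCycle T x = (Finset.range (T.valence x)).image fun k => T.turn^[k] x := by
  ext y
  simp only [mem_edgeCycle, Finset.mem_image, Finset.mem_range]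
  constructor
  · intro h
    obtain ⟨k, -, hk⟩ := h.exists_pow_eq'
    refine ⟨k % T.valence x, Nat.mod_lt _ (valence_pos x), ?_⟩
    rw [turnPerm_pow] at hk
    rw [← hk]
    exact Function.iterate_mod_minimalPeriod_eq
  · rintro ⟨k, -, rfl⟩
    exact ⟨k, by rw [zpow_natCast, turnPerm_pow]⟩

@[to_additive]
theorem prod_edgeCycle {M : Type*} [CommMonoid M] (f : IdealTriangulation.Flag n → M)
    (x : IdealTriangulation.Flag n) :
    ∏ y ∈ edgeCycle T x, f y = ∏ k ∈ Finset.range (T.valence x), f (T.turn^[k] x) := by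
  rw [edgeCycle_eq_image, Finset.prod_image]
  intro a ha b hb h
  simp only [Finset.coe_range] at ha hb
  exact Function.iterate_injOn_Iio_minimalPeriod ha hb h

theorem sign_of_mem_edgeCycle {x y : IdealTriangulation.Flag n} (h : y ∈ edgeCycle T x) :
    Equiv.Perm.sign y.2 = Equiv.Perm.sign x.2 := by
  rw [edgeCycle_eq_image] at h
  obtain ⟨k, -, rfl⟩ := Finset.mem_image.1 h
  exact sign_turn_iterate x k

/-- The shape parameter at the edge of a flag. -/
def flagShape {A : Type} [CommRing A] (z : Fin n → A) (x : IdealTriangulation.Flag n) : A :=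
  edgeShape (z x.1) (x.2 0) (x.2 1)

theorem partialHolonomy_valence {A : Type} [CommRing A] (z : Fin n → A)
    (x : IdealTriangulation.Flag n) :
    partialHolonomy T z x (T.valence x) = ∏ y ∈ edgeCycle T x, flagShape z y := by
  rw [prod_edgeCycle]; rfl

/-- If the total angle of a real solution is `2π`, exactly two flags around the edge have negative
shape parameter. -/
theorem card_negative {z : Fin n → ℝ} (h0 : ∀ j, z j ≠ 0) (h1 : ∀ j, z j ≠ 1)
    {x : IdealTriangulation.Flag n} (h : totalAngle T z x = 2 * Real.pi) :
    ((edgeCycle T x).filter fun y => flagShape z y < 0).card = 2 := by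
  have e : totalAngle T z x = ∑ y ∈ edgeCycle T x, if flagShape z y < 0 then Real.pi else 0 := by
    rw [sum_edgeCycle, totalAngle]
    refine Finset.sum_congr rfl fun k _ => ?_
    have hr : (HasPlane.plane (partialHolonomy T z x (k + 1)) /
        HasPlane.plane (partialHolonomy T z x k)) = ((flagShape z (T.turn^[k] x) : ℝ) : ℂ) := by
      rw [partialHolonomy_succ]
      change ((_ * _ : ℝ) : ℂ) / ((_ : ℝ) : ℂ) = _
      rw [Complex.ofReal_mul, mul_div_cancel_left₀]
      · rfl
      · exact_mod_cast partialHolonomy_ne_zero h0 h1 x k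
    rw [hr]
    split_ifs with hneg
    · exact Complex.arg_ofReal_of_neg hneg
    · exact Complex.arg_ofReal_of_nonneg (not_lt.1 hneg)
  rw [e, ← Finset.sum_filter, Finset.sum_const, nsmul_eq_mul] at h
  exact_mod_cast mul_right_cancel₀ Real.pi_ne_zero h

/-! ### Types of edges -/

/-- The pair of opposite edges that contains `a b`. -/
def edgeType (a b : Fin 4) : Fin 3 :=
  if ({a, b} : Finset (Fin 4)) = {0, 1} ∨ ({a, b} : Finset (Fin 4)) = {2, 3} then 0
  else if ({a, b} : Finset (Fin 4)) = {0, 2} ∨ ({a, b} : Finset (Fin 4)) = {1, 3} then 1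
  else 2

/-- The three shape parameters of a tetrahedron. -/
def typeShape {A : Type} [CommRing A] (z : A) : Fin 3 → A :=
  ![z, Ring.inverse (1 - z), (z - 1) * Ring.inverse z]

theorem edgeShape_eq_typeShape {A : Type} [CommRing A] (z : A) (a b : Fin 4) :
    edgeShape z a b = typeShape z (edgeType a b) := by
  unfold edgeShape edgeType
  split_ifs <;> rfl

/-- The type of the edge of a flag. -/
def flagType (x : IdealTriangulation.Flag n) : Fin 3 := edgeType (x.2 0) (x.2 1)

theorem flagShape_eq {A : Type} [CommRing A] (z : Fin n → A) (x : IdealTriangulation.Flag n) :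
    flagShape z x = typeShape (z x.1) (flagType x) := edgeShape_eq_typeShape _ _ _

/-- The half turn of the tetrahedra, acting on flags. -/
def halfTurnFlag : Equiv.Perm (IdealTriangulation.Flag n) :=
  Function.Involutive.toPerm (fun x => (x.1, halfTurn * x.2)) fun x => by
    have : halfTurn * halfTurn = 1 := by decide
    simp [← mul_assoc, this]

theorem edgeType_halfTurn (π : Equiv.Perm (Fin 4)) :
    edgeType ((π * halfTurn) 0) ((π * halfTurn) 1) = edgeType (π 0) (π 1) ∧
      edgeType ((halfTurn * π) 0) ((halfTurn * π) 1) = edgeType (π 0) (π 1) := by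
  revert π; decide

theorem flagType_reverse (x : IdealTriangulation.Flag n) :
    flagType (reverseFlag x) = flagType x := (edgeType_halfTurn x.2).1

theorem flagType_halfTurn (x : IdealTriangulation.Flag n) :
    flagType (halfTurnFlag x) = flagType x := (edgeType_halfTurn x.2).2

/-- Each pair of opposite edges has four even flags. -/
@[to_additive]
theorem prod_even_edgeType {M : Type*} [CommMonoid M] (f : Fin 3 → M) :
    ∏ π : Equiv.Perm (Fin 4) with Equiv.Perm.sign π = 1, f (edgeType (π 0) (π 1)) =
      (f 0 * f 1 * f 2) ^ 4 := by
  rw [← Finset.prod_fiberwise (g := fun π : Equiv.Perm (Fin 4) => edgeType (π 0) (π 1)),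
    Fin.prod_univ_three, mul_pow, mul_pow]
  congr 1
  · congr 1
    · rw [Finset.prod_congr rfl (g := fun _ => f 0)
        (fun π hπ => by rw [(Finset.mem_filter.1 hπ).2]), Finset.prod_const]
      congr 1
    · rw [Finset.prod_congr rfl (g := fun _ => f 1)
        (fun π hπ => by rw [(Finset.mem_filter.1 hπ).2]), Finset.prod_const]
      congr 1
  · rw [Finset.prod_congr rfl (g := fun _ => f 2)
      (fun π hπ => by rw [(Finset.mem_filter.1 hπ).2]), Finset.prod_const]
    congr 1

/-- The even flags. -/
def evenFlags (n : ℕ) : Finset (IdealTriangulation.Flag n) :=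
  {x | Equiv.Perm.sign x.2 = 1}

theorem mem_evenFlags {x : IdealTriangulation.Flag n} :
    x ∈ evenFlags n ↔ Equiv.Perm.sign x.2 = 1 := by simp [evenFlags]

@[to_additive]
theorem prod_evenFlags {M : Type*} [CommMonoid M] (f : Fin n → Fin 3 → M) :
    ∏ x ∈ evenFlags n, f x.1 (flagType x) = ∏ j, (f j 0 * f j 1 * f j 2) ^ 4 := by
  have e : evenFlags n = Finset.univ ×ˢ
      ({π | Equiv.Perm.sign π = 1} : Finset (Equiv.Perm (Fin 4))) := by
    ext x; simp [evenFlags]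
  rw [e, Finset.prod_product]
  exact Finset.prod_congr rfl fun j _ => prod_even_edgeType (f j)

end Cycles

/-! ### Edges of the monodromy triangulation -/

section Monodromy

/-- A set of tetrahedra that is closed under passing to the next layer is empty or everything. -/
theorem forall_of_finRotate {n : ℕ} {S : Fin n → Prop} (h : ∀ k, S k → S (finRotate n k))
    {k : Fin n} (hk : S k) (l : Fin n) : S l := by
  cases n with
  | zero => exact k.elim0
  | succ n =>
    have key (i : ℕ) : ∀ l : Fin (n + 1), l.val = (k.val + i) % (n + 1) → S l := by
      induction i with
      | zero =>
        intro l hl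
        rwa [show l = k from Fin.ext (by rw [hl, add_zero, Nat.mod_eq_of_lt k.2])]
      | succ i ih =>
        intro l hl
        have := h _ (ih ⟨(k.val + i) % (n + 1), Nat.mod_lt _ n.succ_pos⟩ rfl)
        rw [finRotate_apply] at this
        convert this using 1
        refine Fin.ext ?_
        rw [hl, Fin.val_add]
        simp [← add_assoc]
    refine key (l.val + (n + 1 - k.val)) l ?_
    rw [show k.val + (l.val + (n + 1 - k.val)) = l.val + (n + 1) by omega, Nat.add_mod_right,
      Nat.mod_eq_of_lt l.2]

/-- The upward flag at a vertical edge. -/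
def upVertical : Equiv.Perm (Fin 4) := Equiv.swap 1 2 * Equiv.swap 2 3

/-- The upward flag at a horizontal edge. -/
def upHorizontal : Equiv.Perm (Fin 4) := Equiv.swap 2 0 * Equiv.swap 2 3

theorem upPerm_upVertical (a : Letter) {h : Equiv.Perm (Fin 4)} (hh : h = 1 ∨ h = halfTurn)
    {π : Equiv.Perm (Fin 4)} (hπ : π = upVertical ∨ π = halfTurn * upVertical) :
    2 ≤ π 2 ∧ (a = .L → upPerm a h (π 2) * π * Equiv.swap 2 3 = upVertical ∨
      upPerm a h (π 2) * π * Equiv.swap 2 3 = halfTurn * upVertical) ∧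
    (a = .R → halfTurn * (upPerm a h (π 2) * π * Equiv.swap 2 3) * halfTurn =
      upPerm a h (π 2) * π * Equiv.swap 2 3) := by
  rcases hh with rfl | rfl <;> rcases hπ with rfl | rfl <;> cases a <;> simp <;> decide

theorem upPerm_upHorizontal (a : Letter) {h : Equiv.Perm (Fin 4)} (hh : h = 1 ∨ h = halfTurn)
    {π : Equiv.Perm (Fin 4)} (hπ : π = upHorizontal ∨ π = halfTurn * upHorizontal) :
    2 ≤ π 2 ∧ (a = .R → upPerm a h (π 2) * π * Equiv.swap 2 3 = upHorizontal ∨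
      upPerm a h (π 2) * π * Equiv.swap 2 3 = halfTurn * upHorizontal) ∧
    (a = .L → halfTurn * (upPerm a h (π 2) * π * Equiv.swap 2 3) * halfTurn =
      upPerm a h (π 2) * π * Equiv.swap 2 3) := by
  rcases hh with rfl | rfl <;> rcases hπ with rfl | rfl <;> cases a <;> simp <;> decide

theorem halfTurn_upPerm (a : Letter) {h : Equiv.Perm (Fin 4)} (hh : h = 1 ∨ h = halfTurn)
    (f : Fin 4) : (2 ≤ halfTurn f ↔ 2 ≤ f) ∧
      upPerm a h (halfTurn f) * halfTurn = halfTurn * upPerm a h f ∧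
      downPerm a h (halfTurn f) * halfTurn = halfTurn * downPerm a h f := by
  rcases hh with rfl | rfl <;> cases a <;> revert f <;> decide

variable {w : List Letter} {ε : ℤˣ}

local notation "𝒯" => monodromyTriangulation w ε

theorem turn_halfTurnFlag (x : IdealTriangulation.Flag w.length) :
    (𝒯).turn (halfTurnFlag x) = halfTurnFlag ((𝒯).turn x) := by
  have h1 := halfTurn_upPerm w[x.1] (layerTurn_cases w ε x.1) (x.2 2)
  have h2 := halfTurn_upPerm w[(finRotate _).symm x.1]
    (layerTurn_cases w ε ((finRotate _).symm x.1)) (x.2 2)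
  refine Prod.ext ?_ ?_
  · change (𝒯).nbr x.1 (halfTurn (x.2 2)) = (𝒯).nbr x.1 (x.2 2)
    simp only [monodromyTriangulation, h1.1]
  · change (𝒯).perm x.1 (halfTurn (x.2 2)) * (halfTurn * x.2) * Equiv.swap 2 3 =
      halfTurn * ((𝒯).perm x.1 (x.2 2) * x.2 * Equiv.swap 2 3)
    rw [← mul_assoc]
    simp only [monodromyTriangulation, h1.1]
    split_ifs
    · rw [h1.2.1]; simp only [mul_assoc]
    · rw [h2.2.2]; simp only [mul_assoc]

theorem turn_up {x : IdealTriangulation.Flag w.length} (h : 2 ≤ x.2 2) :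
    (𝒯).turn x = (finRotate _ x.1,
      upPerm w[x.1] (layerTurn w ε x.1) (x.2 2) * x.2 * Equiv.swap 2 3) := by
  simp [IdealTriangulation.turn, monodromyTriangulation, h]

/-- Turning up around a vertical edge ends at a diagonal. -/
theorem exists_diagonal_vertical (hR : ∃ k : Fin w.length, w[k] = .R) (k : Fin w.length) :
    ∃ y, (turnPerm 𝒯).SameCycle (k, upVertical) y ∧ halfTurn * y.2 * halfTurn = y.2 := by
  by_contra! H
  have key : ∀ l, ∃ π, (π = upVertical ∨ π = halfTurn * upVertical) ∧
      (turnPerm 𝒯).SameCycle (k, upVertical) (l, π) ∧ w[l] = .L := by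
    have step (l π) (hπ : π = upVertical ∨ π = halfTurn * upVertical)
        (hs : (turnPerm 𝒯).SameCycle (k, upVertical) (l, π)) : w[l] = .L := by
      have hl := upPerm_upVertical w[l] (layerTurn_cases w ε l) hπ
      cases e : w[l] with
      | L => rfl
      | R =>
        refine absurd ?_ (H _ (hs.trans (Equiv.Perm.SameCycle.rfl.apply_right)))
        change halfTurn * ((𝒯).turn (l, π)).2 * halfTurn = ((𝒯).turn (l, π)).2
        rw [turn_up hl.1]
        exact hl.2.2 e
    refine forall_of_finRotate (S := fun l => ∃ π, (π = upVertical ∨ π = halfTurn * upVertical) ∧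
      (turnPerm 𝒯).SameCycle (k, upVertical) (l, π) ∧ w[l] = .L) ?_ (k := k)
      ⟨_, Or.inl rfl, Equiv.Perm.SameCycle.rfl, step k _ (Or.inl rfl) Equiv.Perm.SameCycle.rfl⟩
    rintro l ⟨π, hπ, hs, hL⟩
    have hl := upPerm_upVertical w[l] (layerTurn_cases w ε l) hπ
    have hs' : (turnPerm 𝒯).SameCycle (k, upVertical) ((𝒯).turn (l, π)) :=
      hs.trans (Equiv.Perm.SameCycle.rfl.apply_right)
    rw [turn_up hl.1] at hs'
    exact ⟨_, hl.2.1 hL, hs', step _ _ (hl.2.1 hL) hs'⟩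
  obtain ⟨l, hl⟩ := hR
  obtain ⟨π, -, -, h⟩ := key l
  rw [hl] at h
  exact Letter.noConfusion h

/-- Turning up around a horizontal edge ends at a diagonal. -/
theorem exists_diagonal_horizontal (hL : ∃ k : Fin w.length, w[k] = .L) (k : Fin w.length) :
    ∃ y, (turnPerm 𝒯).SameCycle (k, upHorizontal) y ∧ halfTurn * y.2 * halfTurn = y.2 := by
  by_contra! H
  have key : ∀ l, ∃ π, (π = upHorizontal ∨ π = halfTurn * upHorizontal) ∧
      (turnPerm 𝒯).SameCycle (k, upHorizontal) (l, π) ∧ w[l] = .R := by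
    have step (l π) (hπ : π = upHorizontal ∨ π = halfTurn * upHorizontal)
        (hs : (turnPerm 𝒯).SameCycle (k, upHorizontal) (l, π)) : w[l] = .R := by
      have hl := upPerm_upHorizontal w[l] (layerTurn_cases w ε l) hπ
      cases e : w[l] with
      | R => rfl
      | L =>
        refine absurd ?_ (H _ (hs.trans (Equiv.Perm.SameCycle.rfl.apply_right)))
        change halfTurn * ((𝒯).turn (l, π)).2 * halfTurn = ((𝒯).turn (l, π)).2
        rw [turn_up hl.1]
        exact hl.2.2 e
    refine forall_of_finRotate
      (S := fun l => ∃ π, (π = upHorizontal ∨ π = halfTurn * upHorizontal) ∧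
        (turnPerm 𝒯).SameCycle (k, upHorizontal) (l, π) ∧ w[l] = .R) ?_ (k := k)
      ⟨_, Or.inl rfl, Equiv.Perm.SameCycle.rfl, step k _ (Or.inl rfl) Equiv.Perm.SameCycle.rfl⟩
    rintro l ⟨π, hπ, hs, hL⟩
    have hl := upPerm_upHorizontal w[l] (layerTurn_cases w ε l) hπ
    have hs' : (turnPerm 𝒯).SameCycle (k, upHorizontal) ((𝒯).turn (l, π)) :=
      hs.trans (Equiv.Perm.SameCycle.rfl.apply_right)
    rw [turn_up hl.1] at hs'
    exact ⟨_, hl.2.1 hL, hs', step _ _ (hl.2.1 hL) hs'⟩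
  obtain ⟨l, hl⟩ := hL
  obtain ⟨π, -, -, h⟩ := key l
  rw [hl] at h
  exact Letter.noConfusion h

theorem sameCycle_halfTurn {x y : IdealTriangulation.Flag w.length}
    (h : (turnPerm 𝒯).SameCycle x y) :
    (turnPerm 𝒯).SameCycle (halfTurnFlag x) (halfTurnFlag y) := by
  have e : halfTurnFlag * turnPerm 𝒯 * halfTurnFlag⁻¹ = turnPerm 𝒯 := by
    rw [mul_inv_eq_iff_eq_mul]
    ext1 x
    exact (turn_halfTurnFlag x).symm
  have := Equiv.Perm.SameCycle.conj (g := halfTurnFlag) h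
  rwa [e] at this

theorem sameCycle_reverse {n : ℕ} {T : IdealTriangulation n} {x y : IdealTriangulation.Flag n}
    (h : (turnPerm T).SameCycle x y) :
    (turnPerm T).SameCycle (reverseFlag x) (reverseFlag y) := by
  have e : reverseFlag * turnPerm T * reverseFlag⁻¹ = (turnPerm T)⁻¹ := by
    rw [mul_inv_eq_iff_eq_mul, eq_inv_mul_iff_mul_eq]
    ext1 x
    exact turn_reverse_turn T x
  have := Equiv.Perm.SameCycle.conj (g := reverseFlag) h
  rwa [e, Equiv.Perm.sameCycle_inv] at this

/-- The product over an edge cycle of a function of the type of the edge is invariant under the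
symmetries of the tetrahedra. -/
@[to_additive]
theorem prod_edgeCycle_symm {M : Type*} [CommMonoid M] {n : ℕ} {T : IdealTriangulation n}
    (g : Equiv.Perm (IdealTriangulation.Flag n))
    (hg : ∀ x y, (turnPerm T).SameCycle x y → (turnPerm T).SameCycle (g x) (g y))
    (hinv : ∀ x, g (g x) = x)
    {f : IdealTriangulation.Flag n → M} (hf : ∀ x, f (g x) = f x)
    (x : IdealTriangulation.Flag n) :
    ∏ y ∈ edgeCycle T (g x), f y = ∏ y ∈ edgeCycle T x, f y := by
  refine Finset.prod_nbij' g g ?_ ?_ (fun y _ => hinv y) (fun y _ => hinv y)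
    (fun y _ => (hf y).symm)
  · intro y hy
    rw [mem_edgeCycle] at hy ⊢
    simpa [hinv] using hg _ _ hy
  · intro y hy
    rw [mem_edgeCycle] at hy ⊢
    exact hg _ _ hy

theorem edgeType_cases (π : Equiv.Perm (Fin 4)) (h : Equiv.Perm.sign π = 1) :
    (edgeType (π 0) (π 1) = 1 → π = upVertical ∨ π = halfTurn * upVertical ∨
      π = upVertical * halfTurn ∨ π = halfTurn * (upVertical * halfTurn)) ∧
    (edgeType (π 0) (π 1) = 2 → π = upHorizontal ∨ π = halfTurn * upHorizontal ∨
      π = upHorizontal * halfTurn ∨ π = halfTurn * (upHorizontal * halfTurn)) := by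
  revert π; decide

/-- The upward flag with negative shape parameter. -/
def upFlag {n : ℕ} (z : Fin n → ℝ) (j : Fin n) : IdealTriangulation.Flag n :=
  (j, if 1 < z j then upVertical else upHorizontal)

theorem sign_upFlag {n : ℕ} (z : Fin n → ℝ) (j : Fin n) :
    Equiv.Perm.sign (upFlag z j).2 = 1 := by
  have h1 : Equiv.Perm.sign upVertical = 1 := by decide
  have h2 : Equiv.Perm.sign upHorizontal = 1 := by decide
  unfold upFlag; split_ifs <;> assumption

theorem typeShape_neg_iff {z : ℝ} (hz : 0 < z) (h1 : z ≠ 1) (i : Fin 3) :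
    typeShape z i < 0 ↔ i = if 1 < z then 1 else 2 := by
  split_ifs with h
  · fin_cases i <;> simp [typeShape, h, hz.le]
  · have h : z < 1 := lt_of_le_of_ne (not_lt.1 h) h1
    fin_cases i <;> simp [typeShape, hz.le, h.le]
    exact mul_neg_of_neg_of_pos (sub_neg.2 h) (inv_pos.2 hz)

theorem flagType_upFlag {n : ℕ} (z : Fin n → ℝ) (j : Fin n) :
    flagType (upFlag z j) = if 1 < z j then 1 else 2 := by
  have h1 : edgeType (upVertical 0) (upVertical 1) = 1 := by decide
  have h2 : edgeType (upHorizontal 0) (upHorizontal 1) = 2 := by decide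
  unfold upFlag flagType; split_ifs <;> assumption

theorem flagShape_upFlag_neg {n : ℕ} {z : Fin n → ℝ} (hz : ∀ j, 0 < z j) (h1 : ∀ j, z j ≠ 1)
    (j : Fin n) : flagShape z (upFlag z j) < 0 := by
  rw [flagShape_eq, typeShape_neg_iff (hz _) (h1 _), flagType_upFlag]; rfl

/-- The negative flags of a tetrahedron are related by its symmetries. -/
theorem negative_cases {n : ℕ} {z : Fin n → ℝ} (hz : ∀ j, 0 < z j) (h1 : ∀ j, z j ≠ 1)
    {x : IdealTriangulation.Flag n} (hx : Equiv.Perm.sign x.2 = 1) (hneg : flagShape z x < 0) :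
    x = upFlag z x.1 ∨ x = halfTurnFlag (upFlag z x.1) ∨ x = reverseFlag (upFlag z x.1) ∨
      x = halfTurnFlag (reverseFlag (upFlag z x.1)) := by
  rw [flagShape_eq, typeShape_neg_iff (hz _) (h1 _)] at hneg
  have h := edgeType_cases x.2 hx
  unfold upFlag
  split_ifs at hneg ⊢
  · rcases h.1 hneg with h | h | h | h
    · exact Or.inl (Prod.ext rfl h)
    · exact Or.inr (Or.inl (Prod.ext rfl h))
    · exact Or.inr (Or.inr (Or.inl (Prod.ext rfl h)))
    · exact Or.inr (Or.inr (Or.inr (Prod.ext rfl h)))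
  · rcases h.2 hneg with h | h | h | h
    · exact Or.inl (Prod.ext rfl h)
    · exact Or.inr (Or.inl (Prod.ext rfl h))
    · exact Or.inr (Or.inr (Or.inl (Prod.ext rfl h)))
    · exact Or.inr (Or.inr (Or.inr (Prod.ext rfl h)))

@[to_additive]
theorem prod_edgeCycle_negative {M : Type*} [CommMonoid M] {z : Fin w.length → ℝ}
    (hz : ∀ j, 0 < z j) (h1 : ∀ j, z j ≠ 1) (f : Fin w.length → Fin 3 → M)
    {x : IdealTriangulation.Flag w.length} (hx : Equiv.Perm.sign x.2 = 1)
    (hneg : flagShape z x < 0) :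
    ∏ y ∈ edgeCycle 𝒯 x, f y.1 (flagType y) =
      ∏ y ∈ edgeCycle 𝒯 (upFlag z x.1), f y.1 (flagType y) := by
  have hh (u) := prod_edgeCycle_symm (T := 𝒯) halfTurnFlag (fun _ _ => sameCycle_halfTurn)
    (fun x => halfTurnFlag.left_inv x) (f := fun y => f y.1 (flagType y))
    (fun y => by rw [flagType_halfTurn]; rfl) u
  have hr (u) := prod_edgeCycle_symm (T := 𝒯) reverseFlag (fun _ _ => sameCycle_reverse)
    (fun x => reverseFlag.left_inv x) (f := fun y => f y.1 (flagType y))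
    (fun y => by rw [flagType_reverse]; rfl) u
  rcases negative_cases hz h1 hx hneg with h | h | h | h
  · conv_lhs => rw [h]
  · conv_lhs => rw [h, hh]
  · conv_lhs => rw [h, hr]
  · conv_lhs => rw [h, hh, hr]

/-- An edge with a positive real solution has only the tetrahedron `j` as negative tetrahedron if
it has the negative flag `upFlag z j`. -/
theorem negative_mem_edgeCycle {z : Fin w.length → ℝ} (hR : ∃ k : Fin w.length, w[k] = .R)
    (hL : ∃ k : Fin w.length, w[k] = .L) (hz : z ∈ canonicalComponents w ε)
    {j : Fin w.length} {x : IdealTriangulation.Flag w.length}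
    (hx : x ∈ edgeCycle 𝒯 (upFlag z j)) (hneg : flagShape z x < 0) : x.1 = j := by
  obtain ⟨⟨h01, hT⟩, hpos⟩ := hz
  have h1 (j) := (h01 j).2
  have hcard := card_negative (fun j => (h01 j).1) h1 (hT _ (sign_upFlag z j)).2
  obtain ⟨y, hy, hyd⟩ : ∃ y, (turnPerm 𝒯).SameCycle (upFlag z j) y ∧
      halfTurn * y.2 * halfTurn = y.2 := by
    unfold upFlag; split_ifs
    · exact exists_diagonal_vertical hR j
    · exact exists_diagonal_horizontal hL j
  have hyf : reverseFlag (halfTurnFlag y) = y := Prod.ext rfl hyd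
  set u := reverseFlag (halfTurnFlag (upFlag z j)) with hu
  have hs : (turnPerm 𝒯).SameCycle (upFlag z j) u := by
    have := sameCycle_reverse (sameCycle_halfTurn hy)
    rw [hyf] at this
    exact hy.trans this.symm
  have hune : u ≠ upFlag z j := by
    intro h
    have := congrArg Prod.snd h
    change halfTurn * (upFlag z j).2 * halfTurn = (upFlag z j).2 at this
    unfold upFlag at this
    have h1 : halfTurn * upVertical * halfTurn ≠ upVertical := by decide
    have h2 : halfTurn * upHorizontal * halfTurn ≠ upHorizontal := by decide
    split_ifs at this
    · exact h1 this
    · exact h2 this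
  have hneg0 := flagShape_upFlag_neg hpos h1 j
  have hnegu : flagShape z u < 0 := by
    rw [flagShape_eq, hu, flagType_reverse, flagType_halfTurn]
    rw [flagShape_eq] at hneg0
    exact hneg0
  have hsub : ({upFlag z j, u} : Finset _) ⊆
      (edgeCycle 𝒯 (upFlag z j)).filter fun y => flagShape z y < 0 := by
    intro v hv
    rw [Finset.mem_insert, Finset.mem_singleton] at hv
    rw [Finset.mem_filter, mem_edgeCycle]
    rcases hv with rfl | rfl
    · exact ⟨Equiv.Perm.SameCycle.rfl, hneg0⟩
    · exact ⟨hs, hnegu⟩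
  have heq := Finset.eq_of_subset_of_card_le hsub
    (by rw [hcard, Finset.card_pair hune.symm])
  have : x ∈ ({upFlag z j, u} : Finset _) := by
    rw [heq]; exact Finset.mem_filter.2 ⟨hx, hneg⟩
  rw [Finset.mem_insert, Finset.mem_singleton] at this
  rcases this with rfl | rfl <;> rfl

end Monodromy

/-! ### Curves of solutions -/

section Curves

variable {ι : Type*} [Fintype ι]

/-- The infinitesimal generator of an irreducible Markov chain with stationary weights `m`: the
entries off the diagonal are nonnegative and the columns have weighted sum zero. -/
structure IsGenerator (K : ι → ι → ℝ) (m : ι → ℕ) : Prop where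
  weight_pos : ∀ j, 0 < m j
  off_diag : ∀ j l, j ≠ l → 0 ≤ K j l
  column_sum : ∀ l, ∑ j, (m j : ℝ) * K j l = 0
  irreducible : ∀ S : ι → Prop, (∀ j, S j → ∀ l, j ≠ l → 0 < K j l → S l) →
    ∀ j, S j → ∀ l, S l

variable {K : ι → ι → ℝ} {m : ι → ℕ} {𝕜 : Type} [RCLike 𝕜]

theorem IsGenerator.norm_mem_kernel (hK : IsGenerator K m) {p : ι → 𝕜}
    (hp : ∀ j, ∑ l, (K j l : 𝕜) * p l = 0) (j : ι) : ∑ l, K j l * ‖p l‖ = 0 := by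
  classical
  have nonneg (j : ι) : 0 ≤ ∑ l, K j l * ‖p l‖ := by
    by_cases hd : 0 ≤ K j j
    · refine Finset.sum_nonneg fun l _ => mul_nonneg ?_ (norm_nonneg _)
      by_cases h : j = l
      · rw [← h]; exact hd
      · exact hK.off_diag j l h
    · have h := hp j
      rw [← Finset.add_sum_erase _ _ (Finset.mem_univ j)] at h ⊢
      have e : ‖(K j j : 𝕜) * p j‖ = -(K j j * ‖p j‖) := by
        rw [norm_mul, RCLike.norm_ofReal, abs_of_neg (not_le.1 hd), neg_mul]
      have h2 : ‖(K j j : 𝕜) * p j‖ ≤ ∑ l ∈ Finset.univ.erase j, K j l * ‖p l‖ := by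
        rw [eq_neg_of_add_eq_zero_left h, norm_neg]
        refine (norm_sum_le _ _).trans (Finset.sum_le_sum fun l hl => ?_)
        rw [norm_mul, RCLike.norm_ofReal,
          abs_of_nonneg (hK.off_diag j l (Finset.ne_of_mem_erase hl).symm)]
      linarith
  have total : ∑ j, (m j : ℝ) * ∑ l, K j l * ‖p l‖ = 0 := by
    simp only [Finset.mul_sum]
    rw [Finset.sum_comm]
    refine Finset.sum_eq_zero fun l _ => ?_
    simp only [← mul_assoc]
    rw [← Finset.sum_mul, hK.column_sum, zero_mul]
  have := (Finset.sum_eq_zero_iff_of_nonneg fun j _ =>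
    mul_nonneg (Nat.cast_nonneg _) (nonneg j)).1 total j (Finset.mem_univ j)
  have hm : (m j : ℝ) ≠ 0 := by exact_mod_cast (hK.weight_pos j).ne'
  exact (mul_eq_zero.1 this).resolve_left hm

theorem IsGenerator.eq_zero_of_kernel (hK : IsGenerator K m) {p : ι → 𝕜}
    (hp : ∀ j, ∑ l, (K j l : 𝕜) * p l = 0) {i : ι} (hi : p i = 0) : p = 0 := by
  classical
  funext l
  refine hK.irreducible (fun l => p l = 0) (fun j hj l hjl hpos => ?_) i hi l
  have h := hK.norm_mem_kernel hp j
  rw [← Finset.add_sum_erase _ _ (Finset.mem_univ j), hj, norm_zero, mul_zero, zero_add] at h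
  have := (Finset.sum_eq_zero_iff_of_nonneg fun l hl =>
    mul_nonneg (hK.off_diag j l (Finset.ne_of_mem_erase hl).symm) (norm_nonneg _)).1 h l
      (Finset.mem_erase.2 ⟨hjl.symm, Finset.mem_univ l⟩)
  exact norm_eq_zero.1 ((mul_eq_zero.1 this).resolve_left hpos.ne')

theorem IsGenerator.exists_pos_kernel [Nonempty ι] (hK : IsGenerator K m) :
    ∃ p : ι → ℝ, (∀ j, 0 < p j) ∧ ∀ j, ∑ l, K j l * p l = 0 := by
  classical
  have hdet : (Matrix.of K).det = 0 := by
    refine Matrix.exists_vecMul_eq_zero_iff.1 ⟨fun j => m j, ?_, ?_⟩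
    · intro h
      obtain ⟨j⟩ := ‹Nonempty ι›
      have := congrFun h j
      have := hK.weight_pos j
      simp_all
    · funext l
      exact hK.column_sum l
  obtain ⟨p, hp0, hp⟩ := Matrix.exists_mulVec_eq_zero_iff.2 hdet
  have hp' (j) : ∑ l, ((K j l : ℝ) : ℝ) * p l = 0 := congrFun hp j
  refine ⟨fun j => ‖p j‖, fun j => norm_pos_iff.2 fun h => hp0 ?_, fun j =>
    hK.norm_mem_kernel hp' j⟩
  exact hK.eq_zero_of_kernel hp' h

/-- Near a point where the logarithmic derivatives of the functions `F j` form a generator and their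
weighted product is constant, the equations `F j = 1` have a curve of solutions whose
velocity is real and positive. -/
theorem exists_curve [Nonempty ι] (hK : IsGenerator K m) {F : ι → (ι → 𝕜) → 𝕜} {z : ι → 𝕜}
    (hF : ∀ j, HasStrictFDerivAt (F j)
      (∑ l, (K j l : 𝕜) • ContinuousLinearMap.proj (R := 𝕜) (φ := fun _ : ι => 𝕜) l) z)
    (h1 : ∀ j, F j z = 1) (hprod : ∀ᶠ x in 𝓝 z, ∏ j, F j x ^ m j = 1) :
    ∃ (Z : 𝕜 → ι → 𝕜) (p : ι → ℝ), Z 0 = z ∧ (∀ j, 0 < p j) ∧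
      (∀ j, HasDerivAt (fun s => Z s j) (p j : 𝕜) 0) ∧
      (∀ᶠ s in 𝓝 (0 : 𝕜), ContinuousAt Z s) ∧ ∀ᶠ s in 𝓝 (0 : 𝕜), ∀ j, F j (Z s) = 1 := by
  classical
  obtain ⟨p, hpos, hker⟩ := hK.exists_pos_kernel
  set c : ℝ := ∑ l, p l with hc
  have hcpos : 0 < c := Finset.sum_pos (fun l _ => hpos l) Finset.univ_nonempty
  let ℓ : (ι → 𝕜) →L[𝕜] 𝕜 :=
    ∑ l, ContinuousLinearMap.proj (R := 𝕜) (φ := fun _ : ι => 𝕜) l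
  have hℓ (q : ι → 𝕜) : ℓ q = ∑ l, q l := by simp [ℓ]
  let D : (ι → 𝕜) →L[𝕜] (ι → 𝕜) := ContinuousLinearMap.pi fun j =>
    (∑ l, (K j l : 𝕜) • ContinuousLinearMap.proj (R := 𝕜) (φ := fun _ : ι => 𝕜) l) + ℓ
  have hD (q : ι → 𝕜) (j : ι) : D q j = ∑ l, (K j l : 𝕜) * q l + ∑ l, q l := by
    simp [D, hℓ]
  let Φ : (ι → 𝕜) → (ι → 𝕜) := fun x j => F j x - 1 + ℓ (x - z)
  have hΦz : Φ z = 0 := by funext j; simp [Φ, h1]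
  have hΦ : HasStrictFDerivAt Φ D z := by
    refine hasStrictFDerivAt_pi.2 fun j => ?_
    refine ((hF j).sub_const 1).add ?_
    exact ℓ.hasStrictFDerivAt.comp z ((hasStrictFDerivAt_id z).sub_const z)
  have hinj : Function.Injective (D : (ι → 𝕜) →ₗ[𝕜] (ι → 𝕜)) := by
    refine (injective_iff_map_eq_zero _).2 fun q hq => ?_
    have hq' (j) : ∑ l, (K j l : 𝕜) * q l + ∑ l, q l = 0 := by
      rw [← hD]; exact congrFun hq j
    have hsum : ∑ l, q l = 0 := by
      have h : ∑ j, (m j : 𝕜) * (∑ l, (K j l : 𝕜) * q l + ∑ l, q l) = 0 := by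
        simp only [hq', mul_zero, Finset.sum_const_zero]
      simp only [mul_add, Finset.sum_add_distrib] at h
      have h0 : ∑ j, (m j : 𝕜) * ∑ l, (K j l : 𝕜) * q l = 0 := by
        simp only [Finset.mul_sum]
        rw [Finset.sum_comm]
        refine Finset.sum_eq_zero fun l _ => ?_
        simp only [← mul_assoc]
        rw [← Finset.sum_mul]
        have : ∑ j, (m j : 𝕜) * (K j l : 𝕜) = ((∑ j, (m j : ℝ) * K j l : ℝ) : 𝕜) := by
          push_cast; rfl
        rw [this, hK.column_sum, RCLike.ofReal_zero, zero_mul]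
      rw [h0, zero_add, ← Finset.sum_mul, ← Nat.cast_sum] at h
      refine (mul_eq_zero.1 h).resolve_left (Nat.cast_ne_zero.2 ?_)
      exact (Finset.sum_pos (fun j _ => hK.weight_pos j) Finset.univ_nonempty).ne'
    obtain ⟨i⟩ := ‹Nonempty ι›
    have hpi : (p i : 𝕜) ≠ 0 := by exact_mod_cast (hpos i).ne'
    set t : 𝕜 := q i / p i with ht
    have hq0 : (fun l => q l - t * p l) = 0 := by
      refine hK.eq_zero_of_kernel (i := i) (fun j => ?_) (by simp [ht, hpi])
      have e : ∑ l, (K j l : 𝕜) * (p l : 𝕜) = 0 := by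
        rw [← RCLike.ofReal_zero, ← hker j]; push_cast; rfl
      have e2 := hq' j
      rw [hsum, add_zero] at e2
      simp only [mul_sub, Finset.sum_sub_distrib, e2, zero_sub, neg_eq_zero]
      simp only [mul_left_comm _ t]
      rw [← Finset.mul_sum, e, mul_zero]
    have hqt (l) : q l = t * p l := sub_eq_zero.1 (congrFun hq0 l)
    have ht0 : t = 0 := by
      simp only [hqt] at hsum
      rw [← Finset.mul_sum] at hsum
      refine (mul_eq_zero.1 hsum).resolve_right ?_
      have : ∑ l, (p l : 𝕜) = ((c : ℝ) : 𝕜) := by rw [hc]; push_cast; rfl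
      rw [this]
      exact_mod_cast hcpos.ne'
    funext l
    rw [hqt, ht0, zero_mul]; rfl
  let E : (ι → 𝕜) ≃L[𝕜] (ι → 𝕜) :=
    (LinearEquiv.ofInjectiveEndo (D : (ι → 𝕜) →ₗ[𝕜] (ι → 𝕜)) hinj).toContinuousLinearEquiv
  have hE : (E : (ι → 𝕜) →L[𝕜] (ι → 𝕜)) = D := by
    ext1 q; rfl
  rw [← hE] at hΦ
  let g := hΦ.localInverse Φ E z
  let line : 𝕜 → (ι → 𝕜) := fun s _ => s
  have hline : HasDerivAt line (fun _ => 1) 0 := hasDerivAt_pi.2 fun _ => hasDerivAt_id _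
  have hline0 : line 0 = Φ z := by rw [hΦz]; rfl
  have hlinet : Tendsto line (𝓝 0) (𝓝 (Φ z)) := by
    rw [← hline0]; exact hline.continuousAt
  have hgt : Tendsto (fun s => g (line s)) (𝓝 0) (𝓝 z) := hΦ.localInverse_tendsto.comp hlinet
  have hvel : E.symm (fun _ => 1) = fun j => ((p j / c : ℝ) : 𝕜) := by
    rw [ContinuousLinearEquiv.symm_apply_eq]
    funext j
    have e1 : E (fun j => ((p j / c : ℝ) : 𝕜)) j = D (fun j => ((p j / c : ℝ) : 𝕜)) j := rfl
    rw [e1, hD]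
    have e2 : ∑ l, (K j l : 𝕜) * ((p l / c : ℝ) : 𝕜) + ∑ l, ((p l / c : ℝ) : 𝕜) =
        ((∑ l, K j l * (p l / c) + ∑ l, p l / c : ℝ) : 𝕜) := by push_cast; rfl
    rw [e2, ← Finset.sum_div, ← hc, div_self hcpos.ne']
    simp only [← mul_div_assoc]
    rw [← Finset.sum_div, hker, zero_div, zero_add, RCLike.ofReal_one]
  refine ⟨fun s => g (line s), fun j => p j / c, ?_, fun j => div_pos (hpos j) hcpos, ?_, ?_, ?_⟩
  · change g (line 0) = z
    rw [hline0]; exact hΦ.localInverse_apply_image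
  · have hd := hΦ.to_localInverse.hasFDerivAt
    rw [← hline0] at hd
    have := hd.comp_hasDerivAt 0 hline
    rw [hasDerivAt_pi] at this
    intro j
    have := this j
    simp only [ContinuousLinearEquiv.coe_coe, hvel] at this
    exact this
  · have hopen := (hΦ.toOpenPartialHomeomorph Φ).open_target
    have hmem : line 0 ∈ (hΦ.toOpenPartialHomeomorph Φ).target := by
      rw [hline0]; exact hΦ.image_mem_toOpenPartialHomeomorph_target
    have hlc : Continuous line := continuous_pi fun _ => continuous_id
    filter_upwards [(hopen.preimage hlc).mem_nhds hmem] with s hs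
    exact ((hΦ.toOpenPartialHomeomorph Φ).continuousAt_symm hs).comp hlc.continuousAt
  · let r : 𝕜 → 𝕜 := fun s => s - ℓ (g (line s) - z)
    have hr : Tendsto r (𝓝 0) (𝓝 0) := by
      have : Tendsto r (𝓝 0) (𝓝 (0 - ℓ (z - z))) :=
        tendsto_id.sub ((ℓ.continuous.tendsto _).comp (hgt.sub_const z))
      simpa using this
    have hM : (∑ j, m j) ≠ 0 :=
      (Finset.sum_pos (fun j _ => hK.weight_pos j) Finset.univ_nonempty).ne'
    have hpow : ∀ᶠ x in 𝓝 (0 : 𝕜), (1 + x) ^ (∑ j, m j) = 1 → x = 0 := by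
      have hder : HasDerivAt (fun x : 𝕜 => (1 + x) ^ (∑ j, m j)) ((∑ j, m j : ℕ) : 𝕜) 0 := by
        have := ((hasDerivAt_id (0 : 𝕜)).const_add 1).fun_pow (∑ j, m j)
        simpa using this
      have := hder.eventually_ne (c := 1) (Nat.cast_ne_zero.2 hM)
      rw [eventually_nhdsWithin_iff] at this
      filter_upwards [this] with x hx hx1
      by_contra hne
      exact hx hne hx1
    filter_upwards [hlinet.eventually hΦ.eventually_right_inverse, hgt.eventually hprod,
      hr.eventually hpow] with s hs hs2 hs3
    have key (j : ι) : F j (g (line s)) = 1 + r s := by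
      have := congrFun hs j
      change F j (g (line s)) - 1 + ℓ (g (line s) - z) = s at this
      simp only [r]
      linear_combination this
    have hr0 : r s = 0 := by
      refine hs3 ?_
      rw [← Finset.prod_pow_eq_pow_sum]
      simpa only [key] using hs2
    intro j
    rw [key, hr0, add_zero]

/-- The derivative of a product in terms of logarithmic derivatives. -/
theorem hasStrictFDerivAt_prod_of_log {E α : Type*} [NormedAddCommGroup E] [NormedSpace 𝕜 E]
    (s : Finset α) {f : α → E → 𝕜} {g : α → E →L[𝕜] 𝕜} {x : E}
    (h : ∀ i ∈ s, HasStrictFDerivAt (f i) (f i x • g i) x) :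
    HasStrictFDerivAt (fun y => ∏ i ∈ s, f i y) ((∏ i ∈ s, f i x) • ∑ i ∈ s, g i) x := by
  classical
  induction s using Finset.induction_on with
  | empty => simpa using hasStrictFDerivAt_const (1 : 𝕜) x
  | insert i s hi ih =>
    simp only [Finset.prod_insert hi, Finset.sum_insert hi]
    refine ((h i (by simp)).mul (ih fun j hj => h j (by simp [hj]))).congr_fderiv ?_
    ext v
    simp
    ring

end Curves

/-! ### Deformations of positive real solutions -/

section Deformation

theorem map_ringInverse_of_isUnit {A A' : Type} [CommRing A] [CommRing A'] (φ : A →+* A') {a : A}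
    (h : IsUnit a) : φ (Ring.inverse a) = Ring.inverse (φ a) := by
  refine (h.map φ).mul_left_cancel ?_
  rw [Ring.mul_inverse_cancel _ (h.map φ), ← map_mul, Ring.mul_inverse_cancel _ h, map_one]

theorem map_typeShape {A A' : Type} [CommRing A] [CommRing A'] (φ : A →+* A') {z : A}
    (h0 : IsUnit z) (h1 : IsUnit (1 - z)) (i : Fin 3) :
    φ (typeShape z i) = typeShape (φ z) i := by
  fin_cases i
  · rfl
  · simp [typeShape, map_ringInverse_of_isUnit φ h1]
  · simp [typeShape, map_ringInverse_of_isUnit φ h0]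

theorem map_partialHolonomy {n : ℕ} {T : IdealTriangulation n} {A A' : Type} [CommRing A]
    [CommRing A'] (φ : A →+* A') {z : Fin n → A} (h0 : ∀ j, IsUnit (z j))
    (h1 : ∀ j, IsUnit (1 - z j)) (x : IdealTriangulation.Flag n) (k : ℕ) :
    φ (partialHolonomy T z x k) = partialHolonomy T (fun j => φ (z j)) x k := by
  unfold partialHolonomy
  rw [map_prod]
  refine Finset.prod_congr rfl fun i _ => ?_
  rw [edgeShape_eq_typeShape, edgeShape_eq_typeShape, map_typeShape φ (h0 _) (h1 _)]

theorem typeShape_prod {K : Type} [Field K] {z : K} (h0 : z ≠ 0) (h1 : z ≠ 1) :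
    typeShape z 0 * typeShape z 1 * typeShape z 2 = -1 := by
  have : 1 - z ≠ 0 := sub_ne_zero.2 h1.symm
  simp only [typeShape, Ring.inverse_eq_inv']
  simp
  field_simp
  ring

/-- The logarithmic derivatives of the three shape parameters of a tetrahedron. -/
def typeDlog (z : ℝ) : Fin 3 → ℝ := ![z⁻¹, (1 - z)⁻¹, (z * (z - 1))⁻¹]

theorem typeDlog_sum {z : ℝ} (h0 : z ≠ 0) (h1 : z ≠ 1) :
    typeDlog z 0 + typeDlog z 1 + typeDlog z 2 = 0 := by
  have : 1 - z ≠ 0 := sub_ne_zero.2 h1.symm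
  have : z - 1 ≠ 0 := sub_ne_zero.2 h1
  simp [typeDlog]
  field_simp
  ring

theorem typeDlog_pos {z : ℝ} (h0 : 0 < z) (h1 : z ≠ 1) {i : Fin 3} (h : ¬ typeShape z i < 0) :
    0 < typeDlog z i := by
  rw [typeShape_neg_iff h0 h1] at h
  split_ifs at h with hz
  · fin_cases i
    · simpa [typeDlog] using h0
    · exact absurd rfl h
    · simpa [typeDlog] using mul_pos (inv_pos.2 (sub_pos.2 hz)) (inv_pos.2 h0)
  · have hz : z < 1 := lt_of_le_of_ne (not_lt.1 hz) h1
    fin_cases i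
    · simpa [typeDlog] using h0
    · simpa [typeDlog] using hz
    · exact absurd rfl h

theorem hasStrictDerivAt_typeShape {𝕜 : Type} [RCLike 𝕜] {z : ℝ} (h0 : z ≠ 0) (h1 : z ≠ 1)
    (i : Fin 3) : HasStrictDerivAt (fun x : 𝕜 => typeShape x i)
      (typeShape (z : 𝕜) i * (typeDlog z i : ℝ)) (z : 𝕜) := by
  have k0 : (z : 𝕜) ≠ 0 := by exact_mod_cast h0
  have k1 : (z : 𝕜) ≠ 1 := by exact_mod_cast h1
  have k2 : 1 - (z : 𝕜) ≠ 0 := sub_ne_zero.2 k1.symm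
  have k3 : (z : 𝕜) - 1 ≠ 0 := sub_ne_zero.2 k1
  have hid : HasStrictDerivAt (fun x : 𝕜 => x) 1 (z : 𝕜) := hasStrictDerivAt_id _
  fin_cases i
  · simpa [typeShape, typeDlog, k0] using hid
  · have := (hasStrictDerivAt_inv k2).comp (z : 𝕜)
      (HasStrictDerivAt.const_sub 1 hid)
    simp only [typeShape, typeDlog, Ring.inverse_eq_inv']
    simp at this ⊢
    refine this.congr_deriv ?_
    field_simp
  · have := HasStrictDerivAt.fun_mul
      (HasDerivAtFilter.sub_const (1 : 𝕜) hid) (hasStrictDerivAt_inv k0)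
    simp only [typeShape, typeDlog, Ring.inverse_eq_inv']
    simp at this ⊢
    refine this.congr_deriv ?_
    field_simp
    ring

variable {w : List Letter} {ε : ℤˣ}

local notation "𝒯" => monodromyTriangulation w ε

/-- The number of negative even flags of a tetrahedron. -/
def negativeCount {n : ℕ} (z : Fin n → ℝ) (j : Fin n) : ℕ :=
  (((evenFlags n).filter fun x => flagShape z x < 0).filter fun x => x.1 = j).card

/-- Each flag is counted twice if the edges are counted by their negative flags. -/
@[to_additive]
theorem prod_negativeCount {M : Type*} [CommMonoid M] {z : Fin w.length → ℝ}
    (hz : z ∈ canonicalComponents w ε) (f : Fin w.length → Fin 3 → M) :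
    ∏ j, (∏ y ∈ edgeCycle 𝒯 (upFlag z j), f y.1 (flagType y)) ^ negativeCount z j =
      (∏ x ∈ evenFlags w.length, f x.1 (flagType x)) ^ 2 := by
  obtain ⟨⟨h01, hT⟩, hpos⟩ := hz
  have h1 (j) := (h01 j).2
  set Neg := (evenFlags w.length).filter fun x => flagShape z x < 0 with hNeg
  have e1 : (∏ x ∈ evenFlags w.length, f x.1 (flagType x)) ^ 2 = ∏ x ∈ evenFlags w.length,
      ∏ y ∈ (edgeCycle 𝒯 x).filter fun y => flagShape z y < 0, f x.1 (flagType x) := by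
    rw [← Finset.prod_pow]
    refine Finset.prod_congr rfl fun x hx => ?_
    rw [Finset.prod_const, card_negative (fun j => (h01 j).1) h1 (hT x (mem_evenFlags.1 hx)).2]
  have e2 : ∏ x ∈ evenFlags w.length,
      ∏ y ∈ (edgeCycle 𝒯 x).filter fun y => flagShape z y < 0, f x.1 (flagType x) =
      ∏ y ∈ Neg, ∏ x ∈ edgeCycle 𝒯 y, f x.1 (flagType x) := by
    refine Finset.prod_comm' fun x y => ?_
    simp only [hNeg, Finset.mem_filter, mem_evenFlags]
    constructor
    · rintro ⟨hx, hy, hn⟩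
      exact ⟨mem_edgeCycle.2 (mem_edgeCycle.1 hy).symm, by rw [sign_of_mem_edgeCycle hy, hx], hn⟩
    · rintro ⟨hx, hy, hn⟩
      exact ⟨by rw [sign_of_mem_edgeCycle hx, hy], mem_edgeCycle.2 (mem_edgeCycle.1 hx).symm, hn⟩
  rw [e1, e2, ← Finset.prod_fiberwise Neg (fun x => x.1)]
  refine Finset.prod_congr rfl fun j _ => ?_
  rw [negativeCount, ← hNeg, ← Finset.prod_const]
  refine Finset.prod_congr rfl fun x hx => ?_
  obtain ⟨hxN, hxj⟩ := Finset.mem_filter.1 hx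
  obtain ⟨he, hn⟩ := Finset.mem_filter.1 hxN
  rw [← hxj]
  exact (prod_edgeCycle_negative hpos h1 f (mem_evenFlags.1 he) hn).symm

/-- The logarithmic derivatives of the edge equations. -/
def edgeJacobian (w : List Letter) (ε : ℤˣ) (z : Fin w.length → ℝ) (j l : Fin w.length) : ℝ :=
  ∑ y ∈ edgeCycle (monodromyTriangulation w ε) (upFlag z j), if y.1 = l then typeDlog (z y.1) (flagType y) else 0

theorem isGenerator_edgeJacobian {z : Fin w.length → ℝ} (hR : ∃ k : Fin w.length, w[k] = .R)
    (hL : ∃ k : Fin w.length, w[k] = .L) (hz : z ∈ canonicalComponents w ε) :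
    IsGenerator (edgeJacobian w ε z) (negativeCount z) := by
  have h01 := hz.1.1
  have hpos := hz.2
  have h1 (j) := (h01 j).2
  have term (j l : Fin w.length) (hjl : j ≠ l) (y) (hy : y ∈ edgeCycle 𝒯 (upFlag z j))
      (hyl : y.1 = l) : 0 < typeDlog (z y.1) (flagType y) := by
    refine typeDlog_pos (hpos _) (h1 _) fun hneg => hjl ?_
    rw [← flagShape_eq] at hneg
    rw [← hyl, negative_mem_edgeCycle hR hL hz hy hneg]
  have nonneg (j l : Fin w.length) (hjl : j ≠ l) (y) (hy : y ∈ edgeCycle 𝒯 (upFlag z j)) :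
      0 ≤ if y.1 = l then typeDlog (z y.1) (flagType y) else 0 := by
    split_ifs with h
    · exact (term j l hjl y hy h).le
    · exact le_rfl
  refine ⟨fun j => ?_, fun j l hjl => Finset.sum_nonneg (nonneg j l hjl), fun l => ?_, ?_⟩
  · refine Finset.card_pos.2 ⟨upFlag z j, ?_⟩
    simp only [Finset.mem_filter, mem_evenFlags]
    exact ⟨⟨sign_upFlag z j, flagShape_upFlag_neg hpos h1 j⟩, rfl⟩
  · have := sum_negativeCount hz fun j i => if j = l then typeDlog (z j) i else 0
    simp only [nsmul_eq_mul] at this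
    refine this.trans ?_
    rw [sum_evenFlags (fun j i => if j = l then typeDlog (z j) i else 0)]
    refine mul_eq_zero_of_right _ (Finset.sum_eq_zero fun j _ => ?_)
    split_ifs with h
    · rw [typeDlog_sum (h01 j).1 (h1 j), nsmul_zero]
    · simp
  · intro S hS j hj
    refine forall_of_finRotate (fun k hk => ?_) hj
    by_cases hk' : k = finRotate _ k
    · rwa [← hk']
    refine hS k hk _ hk' ?_
    have hup : 2 ≤ (upFlag z k).2 2 := by
      have a1 : 2 ≤ upVertical 2 := by decide
      have a2 : 2 ≤ upHorizontal 2 := by decide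
      unfold upFlag; split_ifs <;> assumption
    have hmem : (𝒯).turn (upFlag z k) ∈ edgeCycle 𝒯 (upFlag z k) :=
      mem_edgeCycle.2 (Equiv.Perm.SameCycle.rfl.apply_right)
    have hfst : ((𝒯).turn (upFlag z k)).1 = finRotate _ k := by rw [turn_up hup]; rfl
    refine Finset.sum_pos' (nonneg k _ hk') ⟨_, hmem, ?_⟩
    rw [if_pos hfst]
    exact term k _ hk' _ hmem hfst

/-- A positive real solution lies on a curve of solutions with real positive velocity. -/
theorem exists_solution_curve (𝕜 : Type) [RCLike 𝕜] {z : Fin w.length → ℝ}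
    (hR : ∃ k : Fin w.length, w[k] = .R) (hL : ∃ k : Fin w.length, w[k] = .L)
    (hz : z ∈ canonicalComponents w ε) :
    ∃ (Z : 𝕜 → Fin w.length → 𝕜) (p : Fin w.length → ℝ), (∀ j, Z 0 j = (z j : 𝕜)) ∧
      (∀ j, 0 < p j) ∧ (∀ j, HasDerivAt (fun s => Z s j) (p j : 𝕜) 0) ∧
      (∀ᶠ s in 𝓝 (0 : 𝕜), ContinuousAt Z s) ∧
      ∀ᶠ s in 𝓝 (0 : 𝕜), ∀ x : IdealTriangulation.Flag w.length, Equiv.Perm.sign x.2 = 1 →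
        partialHolonomy 𝒯 (Z s) x ((𝒯).valence x) = 1 := by
  have hne : Nonempty (Fin w.length) := ⟨hR.choose⟩
  have h01 := hz.1.1
  have hpos := hz.2
  have h1 (j) := (h01 j).2
  set zc : Fin w.length → 𝕜 := fun j => (z j : 𝕜) with hzc
  let F : Fin w.length → (Fin w.length → 𝕜) → 𝕜 := fun j Z =>
    ∏ y ∈ edgeCycle 𝒯 (upFlag z j), typeShape (Z y.1) (flagType y)
  have hF1 (j) : F j zc = 1 := by
    have e := map_partialHolonomy (T := 𝒯) (algebraMap ℝ 𝕜) (fun j => (h01 j).1.isUnit)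
      (fun j => (sub_ne_zero.2 (h1 j).symm).isUnit) (upFlag z j) ((𝒯).valence (upFlag z j))
    rw [(hz.1.2 _ (sign_upFlag z j)).1, map_one, partialHolonomy_valence] at e
    rw [e]
    exact Finset.prod_congr rfl fun y _ => (flagShape_eq _ _).symm
  have hF (j) : HasStrictFDerivAt (F j) (∑ l, (edgeJacobian w ε z j l : 𝕜) •
      ContinuousLinearMap.proj (R := 𝕜) (φ := fun _ : Fin w.length => 𝕜) l) zc := by
    have := hasStrictFDerivAt_prod_of_log (edgeCycle 𝒯 (upFlag z j))
      (f := fun y (Z : Fin w.length → 𝕜) => typeShape (Z y.1) (flagType y))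
      (g := fun y => ((typeDlog (z y.1) (flagType y) : ℝ) : 𝕜) •
        ContinuousLinearMap.proj (R := 𝕜) (φ := fun _ : Fin w.length => 𝕜) y.1) (x := zc)
      (fun y _ => by
        have h := hasStrictDerivAt_typeShape (𝕜 := 𝕜) (h01 y.1).1 (h1 y.1) (flagType y)
        have h2 := HasStrictDerivAt.comp_hasStrictFDerivAt (x := zc)
          (f := fun Z : Fin w.length → 𝕜 => Z y.1) h
          (ContinuousLinearMap.proj (R := 𝕜) (φ := fun _ : Fin w.length => 𝕜)
            y.1).hasStrictFDerivAt
        refine h2.congr_fderiv ?_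
        rw [smul_smul])
    refine this.congr_fderiv ?_
    have e := hF1 j
    simp only [F] at e
    rw [e, one_smul]
    ext v
    simp only [edgeJacobian, _root_.sum_apply, _root_.smul_apply,
      ContinuousLinearMap.proj_apply, smul_eq_mul, map_sum, Finset.sum_mul]
    rw [Finset.sum_comm]
    refine Finset.sum_congr rfl fun y _ => ?_
    rw [Finset.sum_eq_single y.1]
    · rw [if_pos rfl]
    · intro l _ hl
      rw [if_neg hl.symm]; simp
    · simp
  have hprod : ∀ᶠ Z in 𝓝 zc, ∏ j, F j Z ^ negativeCount z j = 1 := by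
    have hev : ∀ᶠ Z in 𝓝 zc, ∀ j, Z j ≠ 0 ∧ Z j ≠ 1 := by
      refine eventually_all.2 fun j => ?_
      have hc : Tendsto (fun Z : Fin w.length → 𝕜 => Z j) (𝓝 zc) (𝓝 (zc j)) :=
        (continuous_apply j).tendsto _
      have k0 : zc j ≠ 0 := by simp only [hzc]; exact_mod_cast (h01 j).1
      have k1 : zc j ≠ 1 := by simp only [hzc]; exact_mod_cast (h01 j).2
      exact (hc.eventually_ne k0).and (hc.eventually_ne k1)
    filter_upwards [hev] with Z hZ
    rw [prod_negativeCount hz fun j i => typeShape (Z j) i,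
      prod_evenFlags fun j i => typeShape (Z j) i]
    have : ∀ j ∈ Finset.univ, (typeShape (Z j) 0 * typeShape (Z j) 1 * typeShape (Z j) 2) ^ 4 =
        (1 : 𝕜) := fun j _ => by rw [typeShape_prod (hZ j).1 (hZ j).2]; norm_num
    rw [Finset.prod_congr rfl this]
    simp
  obtain ⟨Z, p, hZ0, hp, hd, hc, hs⟩ :=
    exists_curve (isGenerator_edgeJacobian hR hL hz) hF hF1 hprod
  refine ⟨Z, p, fun j => by rw [hZ0], hp, hd, hc, ?_⟩
  filter_upwards [hs] with s hs x hx
  have hcard := card_negative (fun j => (h01 j).1) h1 (hz.1.2 x hx).2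
  obtain ⟨y, hy⟩ := Finset.card_pos.1 (hcard ▸ two_pos)
  obtain ⟨hy, hneg⟩ := Finset.mem_filter.1 hy
  rw [partialHolonomy_valence, edgeCycle_eq (mem_edgeCycle.1 hy)]
  simp only [flagShape_eq]
  rw [prod_edgeCycle_negative hpos h1 (fun j i => typeShape (Z s j) i)
    (by rw [sign_of_mem_edgeCycle hy, hx]) hneg]
  exact hs y.1

end Deformation

/-! ### Words of Anosov elements -/

section Words

theorem exists_eigenvector_of_conj {φ P : Matrix.SpecialLinearGroup (Fin 2) ℤ} {ε : ℤˣ}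
    {M : Matrix (Fin 2) (Fin 2) ℤ} (hM : (P * φ * P⁻¹).1 = (ε : ℤ) • M) {a : ℝ}
    (ha : Module.End.HasEigenvalue (Matrix.toLin' (φ.1.map (Int.cast : ℤ → ℝ))) a) :
    ∃ v : Fin 2 → ℝ, v ≠ 0 ∧ ((ε : ℤ) : ℝ) • (M.map (Int.cast : ℤ → ℝ) *ᵥ v) = a • v := by
  obtain ⟨v, hv⟩ := ha.exists_hasEigenvector
  have hv1 := hv.apply_eq_smul
  rw [Matrix.toLin'_apply] at hv1
  have cast_mul (A B : Matrix (Fin 2) (Fin 2) ℤ) : (A * B).map (Int.cast : ℤ → ℝ) =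
      A.map (Int.cast : ℤ → ℝ) * B.map (Int.cast : ℤ → ℝ) :=
    Matrix.map_mul (f := Int.castRingHom ℝ)
  have cast_one : (1 : Matrix (Fin 2) (Fin 2) ℤ).map (Int.cast : ℤ → ℝ) = 1 := by
    simp
  have hinv : (P⁻¹).1.map (Int.cast : ℤ → ℝ) * P.1.map (Int.cast : ℤ → ℝ) = 1 := by
    rw [← cast_mul, ← Matrix.SpecialLinearGroup.coe_mul, inv_mul_cancel,
      Matrix.SpecialLinearGroup.coe_one, cast_one]
  refine ⟨P.1.map (Int.cast : ℤ → ℝ) *ᵥ v, fun h => hv.2 ?_, ?_⟩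
  · have := congrArg (fun u => (P⁻¹).1.map (Int.cast : ℤ → ℝ) *ᵥ u) h
    simp only [Matrix.mulVec_mulVec, Matrix.mulVec_zero] at this
    rwa [hinv, Matrix.one_mulVec] at this
  · have e : ((ε : ℤ) : ℝ) • M.map (Int.cast : ℤ → ℝ) =
        ((P * φ * P⁻¹).1).map (Int.cast : ℤ → ℝ) := by
      rw [hM]
      ext i j
      simp only [Matrix.smul_apply, Matrix.map_apply, smul_eq_mul, Int.cast_mul]
    rw [← Matrix.smul_mulVec, e, Matrix.SpecialLinearGroup.coe_mul,
      Matrix.SpecialLinearGroup.coe_mul, cast_mul, cast_mul, Matrix.mulVec_mulVec,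
      Matrix.mul_assoc, hinv, Matrix.mul_one, ← Matrix.mulVec_mulVec, hv1, Matrix.mulVec_smul]

/-- The word of an Anosov element is not a power of `L`. -/
theorem exists_letter_R {φ P : Matrix.SpecialLinearGroup (Fin 2) ℤ} (hφ : IsAnosov φ) {ε : ℤˣ}
    {w : List Letter} (hw : (P * φ * P⁻¹).1 = (ε : ℤ) • wordMat w) :
    ∃ k : Fin w.length, w[k] = .R := by
  by_contra! H
  have hall : ∀ a ∈ w, a = Letter.L := by
    intro a ha
    obtain ⟨k, hk, rfl⟩ := List.getElem_of_mem ha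
    cases e : w[k] with
    | L => rfl
    | R => exact absurd e (H ⟨k, hk⟩)
  obtain ⟨c, hc⟩ : ∃ c : ℤ, wordMat w = !![1, 0; c, 1] := by
    clear hw H
    induction w with
    | nil => exact ⟨0, by simp [wordMat, Matrix.one_fin_two]⟩
    | cons a w ih =>
      obtain ⟨c, hc⟩ := ih fun b hb => hall b (by simp [hb])
      refine ⟨1 + c, ?_⟩
      have e : wordMat (a :: w) = a.mat * wordMat w := by simp [wordMat]
      rw [e, hc, hall a (by simp)]
      simp [Letter.mat]
  have key (a : ℝ) (ha : Module.End.HasEigenvalue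
      (Matrix.toLin' (φ.1.map (Int.cast : ℤ → ℝ))) a) : a = ((ε : ℤ) : ℝ) := by
    obtain ⟨v, hv, e⟩ := exists_eigenvector_of_conj hw ha
    rw [hc] at e
    have e0 := congrFun e 0
    have e1 := congrFun e 1
    simp at e0 e1
    by_cases h0 : v 0 = 0
    · have h1 : v 1 ≠ 0 := fun h1 => hv (by funext i; fin_cases i <;> simp [h0, h1])
      rw [h0] at e1
      simp [h1] at e1
      exact e1.symm
    · simp [h0] at e0
      exact e0.symm
  obtain ⟨a, b, hab, ha, hb⟩ := hφ
  exact hab ((key a ha).trans (key b hb).symm)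

/-- The word of an Anosov element is not a power of `R`. -/
theorem exists_letter_L {φ P : Matrix.SpecialLinearGroup (Fin 2) ℤ} (hφ : IsAnosov φ) {ε : ℤˣ}
    {w : List Letter} (hw : (P * φ * P⁻¹).1 = (ε : ℤ) • wordMat w) :
    ∃ k : Fin w.length, w[k] = .L := by
  by_contra! H
  have hall : ∀ a ∈ w, a = Letter.R := by
    intro a ha
    obtain ⟨k, hk, rfl⟩ := List.getElem_of_mem ha
    cases e : w[k] with
    | R => rfl
    | L => exact absurd e (H ⟨k, hk⟩)
  obtain ⟨c, hc⟩ : ∃ c : ℤ, wordMat w = !![1, c; 0, 1] := by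
    clear hw H
    induction w with
    | nil => exact ⟨0, by simp [wordMat, Matrix.one_fin_two]⟩
    | cons a w ih =>
      obtain ⟨c, hc⟩ := ih fun b hb => hall b (by simp [hb])
      refine ⟨c + 1, ?_⟩
      have e : wordMat (a :: w) = a.mat * wordMat w := by simp [wordMat]
      rw [e, hc, hall a (by simp)]
      simp [Letter.mat]
  have key (a : ℝ) (ha : Module.End.HasEigenvalue
      (Matrix.toLin' (φ.1.map (Int.cast : ℤ → ℝ))) a) : a = ((ε : ℤ) : ℝ) := by
    obtain ⟨v, hv, e⟩ := exists_eigenvector_of_conj hw ha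
    rw [hc] at e
    have e0 := congrFun e 0
    have e1 := congrFun e 1
    simp at e0 e1
    by_cases h1 : v 1 = 0
    · have h0 : v 0 ≠ 0 := fun h0 => hv (by funext i; fin_cases i <;> simp [h0, h1])
      rw [h1] at e0
      simp [h0] at e0
      exact e0.symm
    · simp [h1] at e1
      exact e1.symm
  obtain ⟨a, b, hab, ha, hb⟩ := hφ
  exact hab ((key a ha).trans (key b hb).symm)

end Words

/-! ### Regeneration of canonical foliations -/

section Regeneration

theorem eventually_pos_of_hasDerivAt {f : ℝ → ℝ} {a : ℝ} (h : HasDerivAt f a 0) (h0 : f 0 = 0)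
    (ha : 0 < a) : ∀ᶠ s in 𝓝[>] (0 : ℝ), 0 < f s := by
  have := (hasDerivAt_iff_tendsto_slope.1 h).eventually (lt_mem_nhds ha)
  have h2 : ∀ᶠ s in 𝓝[>] (0 : ℝ), 0 < slope f 0 s :=
    this.filter_mono (nhdsWithin_mono _ fun s hs => ne_of_gt hs)
  filter_upwards [h2, self_mem_nhdsWithin] with s hs hpos
  rw [slope_def_field, h0, sub_zero, sub_zero] at hs
  have := mul_pos hs (Set.mem_Ioi.1 hpos)
  rwa [div_mul_cancel₀ _ (ne_of_gt hpos)] at this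

/-- The characters `a + b τ ↦ a ± b` of the pseudo-complex numbers. -/
def pseudoCharacter (σ : ℤˣ) : PseudoComplex →+* ℝ where
  toFun z := z.re + ((σ : ℤ) : ℝ) * z.im
  map_zero' := by simp
  map_one' := by rw [QuadraticAlgebra.re_one, QuadraticAlgebra.im_one, mul_zero, add_zero]
  map_add' x y := by rw [QuadraticAlgebra.re_add, QuadraticAlgebra.im_add]; ring
  map_mul' x y := by
    rcases Int.units_eq_one_or σ with rfl | rfl <;> simp <;> ring

theorem pseudo_ext {x y : PseudoComplex} (h : ∀ σ, pseudoCharacter σ x = pseudoCharacter σ y) :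
    x = y := by
  have h1 := h 1
  have h2 := h (-1)
  simp [pseudoCharacter] at h1 h2
  exact QuadraticAlgebra.ext (by linarith) (by linarith)

variable {w : List Letter} {ε : ℤˣ}

theorem exists_hyperbolic {F : Foliation (monodromyTriangulation w ε)}
    (hR : ∃ k : Fin w.length, w[k] = .R) (hL : ∃ k : Fin w.length, w[k] = .L)
    (hz : F.shape ∈ canonicalComponents w ε) :
    ∃ H : Set.Ioi (0 : ℝ) → HyperbolicStructure (monodromyTriangulation w ε),
      IsPath (fun t => (H t).1) ∧ CollapsesTo (fun t => (H t).1) F := by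
  obtain ⟨Z, p, hZ0, hp, hd, hc, hs⟩ := exists_solution_curve ℂ hR hL hz
  have hline : Continuous fun s : ℝ => (s : ℂ) * Complex.I := by fun_prop
  have ht : Tendsto (fun s : ℝ => (s : ℂ) * Complex.I) (𝓝[>] 0) (𝓝 0) := by
    have := (hline.tendsto 0).mono_left (nhdsWithin_le_nhds (s := Set.Ioi 0))
    simpa using this
  refine regenerate F (fun j => (hz.1.1 j).1) (fun j => (hz.1.1 j).2)
    (fun s => Z ((s : ℂ) * Complex.I)) ?_ (fun j => ?_) ?_ (ht.eventually hs)
  · filter_upwards [ht.eventually hc] with s hs j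
    exact ContinuousAt.comp (f := fun s : ℝ => (s : ℂ) * Complex.I) (g := fun u => Z u j)
      ((continuous_apply j).continuousAt.comp hs) hline.continuousAt
  · have h1 : Tendsto (fun u => Z u j) (𝓝 0) (𝓝 (F.shape j : ℂ)) := by
      have := (hd j).continuousAt.tendsto
      rwa [hZ0] at this
    exact h1.comp ht
  · refine eventually_all.2 fun j => ?_
    have hder : HasDerivAt (fun s : ℝ => Z ((s : ℂ) * Complex.I) j) ((p j : ℂ) * Complex.I) 0 := by
      have h1 : HasDerivAt (fun s : ℝ => (s : ℂ) * Complex.I) (1 * Complex.I) 0 :=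
        (Complex.ofRealCLM.hasDerivAt (x := (0 : ℝ))).mul_const Complex.I
      have h2 : HasDerivAt (fun u => Z u j) (p j : ℂ) (((0 : ℝ) : ℂ) * Complex.I) := by
        simpa using hd j
      rw [one_mul] at h1
      exact h2.comp (0 : ℝ) h1
    have him : HasDerivAt (fun s : ℝ => (Z ((s : ℂ) * Complex.I) j).im) (p j) 0 := by
      exact (Complex.imCLM.hasFDerivAt.comp_hasDerivAt (0 : ℝ) hder).congr_deriv (by simp)
    refine eventually_pos_of_hasDerivAt him ?_ (hp j)
    change (Z (((0 : ℝ) : ℂ) * Complex.I) j).im = 0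
    rw [Complex.ofReal_zero, zero_mul, hZ0]
    exact Complex.ofReal_im _

theorem exists_adS {F : Foliation (monodromyTriangulation w ε)}
    (hR : ∃ k : Fin w.length, w[k] = .R) (hL : ∃ k : Fin w.length, w[k] = .L)
    (hz : F.shape ∈ canonicalComponents w ε) :
    ∃ A : Set.Ioi (0 : ℝ) → AdSStructure (monodromyTriangulation w ε),
      IsPath (fun t => (A t).1) ∧ CollapsesTo (fun t => (A t).1) F := by
  obtain ⟨Z, p, hZ0, hp, hd, hc, hs⟩ := exists_solution_curve ℝ hR hL hz
  have hneg : Tendsto (fun s : ℝ => -s) (𝓝 0) (𝓝 0) := by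
    simpa using (continuous_neg (G := ℝ)).tendsto 0
  have hle : 𝓝[>] (0 : ℝ) ≤ 𝓝 0 := nhdsWithin_le_nhds
  set Y : ℝ → Fin w.length → PseudoComplex := fun s j =>
    ⟨(Z s j + Z (-s) j) / 2, (Z s j - Z (-s) j) / 2⟩ with hY
  have hchar (s : ℝ) (σ : ℤˣ) (j) : pseudoCharacter σ (Y s j) = Z (((σ : ℤ) : ℝ) * s) j := by
    rcases Int.units_eq_one_or σ with rfl | rfl <;> simp [pseudoCharacter, hY] <;> ring
  have hconv (j) : ConvergesTo (𝓝[>] (0 : ℝ)) (fun s => Y s j) (F.shape j) := by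
    have h1 : Tendsto (fun s => Z s j) (𝓝 0) (𝓝 (F.shape j)) := by
      have := (hd j).continuousAt.tendsto
      rwa [hZ0] at this
    have h2 := h1.comp hneg
    rw [convergesTo_iff]
    constructor
    · have := ((h1.add h2).div_const 2).mono_left hle
      rwa [add_self_div_two] at this
    · have := ((h1.sub h2).div_const 2).mono_left hle
      rwa [sub_self, zero_div] at this
  refine regenerate F (fun j => (hz.1.1 j).1) (fun j => (hz.1.1 j).2) Y ?_ hconv ?_ ?_
  · filter_upwards [hc.filter_mono hle, (hneg.eventually hc).filter_mono hle] with s h1 h2 j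
    have c1 : ContinuousAt (fun s => Z s j) s := (continuous_apply j).continuousAt.comp h1
    have c2 : ContinuousAt (fun s => Z (-s) j) s :=
      ContinuousAt.comp (f := fun s : ℝ => -s) (g := fun s => Z s j)
        ((continuous_apply j).continuousAt.comp h2) continuous_neg.continuousAt
    have e : (fun s => HasPlane.plane (Y s j)) = fun s =>
        (((Z s j + Z (-s) j) / 2 : ℝ) : ℂ) + ((Z s j - Z (-s) j) / 2 : ℝ) * Complex.I := by
      funext s
      rw [← Complex.mk_eq_add_mul_I]; rfl
    rw [e]
    exact (Complex.continuous_ofReal.continuousAt.comp ((c1.add c2).div_const 2)).add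
      ((Complex.continuous_ofReal.continuousAt.comp ((c1.sub c2).div_const 2)).mul
        continuousAt_const)
  · refine eventually_all.2 fun j => ?_
    have h1 : HasDerivAt (fun s => Z s j) (p j) 0 := hd j
    have h2 : HasDerivAt (fun s => Z (-s) j) (-p j) 0 := by
      have h3 : HasDerivAt (fun s => Z s j) (p j) (-0) := by simpa using h1
      exact (h3.comp (0 : ℝ) (hasDerivAt_neg (0 : ℝ))).congr_deriv (by simp)
    have h3 := (h1.sub h2).div_const 2
    rw [sub_neg_eq_add, add_self_div_two] at h3
    refine eventually_pos_of_hasDerivAt h3 ?_ (hp j)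
    change (Z 0 j - Z (-0) j) / 2 = 0
    rw [neg_zero, sub_self, zero_div]
  · have n0 : ∀ᶠ s in 𝓝[>] (0 : ℝ), ∀ j, 0 < sqNorm (Y s j) :=
      eventually_all.2 fun j => (hconv j).eventually_sqNorm_pos (hz.1.1 j).1
    have n1 : ∀ᶠ s in 𝓝[>] (0 : ℝ), ∀ j, 0 < sqNorm (1 - Y s j) :=
      eventually_all.2 fun j => (ConvergesTo.one.sub (hconv j)).eventually_sqNorm_pos
        (sub_ne_zero.2 (hz.1.1 j).2.symm)
    filter_upwards [n0, n1, hs.filter_mono hle, (hneg.eventually hs).filter_mono hle]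
      with s s0 s1 hs1 hs2 x hx
    refine pseudo_ext fun σ => ?_
    rw [map_partialHolonomy (pseudoCharacter σ) (fun j => isUnit_of_sqNorm_pos (s0 j))
      (fun j => isUnit_of_sqNorm_pos (s1 j)), map_one]
    simp only [hchar]
    rcases Int.units_eq_one_or σ with rfl | rfl
    · simpa using hs1 x hx
    · simpa using hs2 x hx

end Regeneration

end Regen
end

theorem theorem2 (φ P : Matrix.SpecialLinearGroup (Fin 2) ℤ) (hφ : Regen.IsAnosov φ)
    (ε : ℤˣ) (w : List Regen.Letter)
    (hw : (P * φ * P⁻¹).1 = (ε : ℤ) • Regen.wordMat w)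
    (z : Fin w.length → ℝ) (hz : z ∈ Regen.canonicalComponents w ε) :
    (∃ F : Regen.Foliation (Regen.monodromyTriangulation w ε), F.shape = z) ∧
    ∀ F : Regen.Foliation (Regen.monodromyTriangulation w ε), F.shape = z →
      (∃ H : Set.Ioi (0 : ℝ) → Regen.HyperbolicStructure (Regen.monodromyTriangulation w ε),
        Regen.IsPath (fun t => (H t).1) ∧ Regen.CollapsesTo (fun t => (H t).1) F) ∧
      (∃ A : Set.Ioi (0 : ℝ) → Regen.AdSStructure (Regen.monodromyTriangulation w ε),
        Regen.IsPath (fun t => (A t).1) ∧ Regen.CollapsesTo (fun t => (A t).1) F) := by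
  have hR := Regen.exists_letter_R hφ hw
  have hL := Regen.exists_letter_L hφ hw
  refine ⟨Regen.exists_foliation hz.1, ?_⟩
  rintro F rfl
  exact ⟨Regen.exists_hyperbolic hR hL hz, Regen.exists_adS hR hL hz⟩
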